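/- **Conventions.** Let $\mathbb{C}^+=\{z\in\mathbb{C}:\operatorname{Im}z>0\}$. A (complex-valued) tempered distribution $T$ on $\mathbb{R}$ is *causal* if it is supported in $[0,\infty)$; its Fourier transform in $\mathbb{C}^+$ is $\hat T(z)=\langle T,e^{iz\,\cdot}\rangle$ (the exponential being smoothly cut off on the negative half-axis, away from the support). A causal tempered distribution $T$ is *minimum phase* if $\hat T$ and $1/\hat T$ are both analytic in $\mathbb{C}^+$ (in particular $\hat T$ has no zeros there). Its *onset time* is $\tau=\inf\operatorname{supp}T\ge 0$. The Hilbert transform is $\mathcal{H}B=B*\mathrm{vp}\,\frac1{\pi\omega}$; for a tempered distribution $B=\int b(t)e^{i\omega t}\,dt$ with $b$ a function of polynomial growth this is $\mathcal{H}B=\int(-i\,\mathrm{sgn}\,t)\,b(t)e^{i\omega t}\,dt$. **Theorem.** Let $T$ be a minimum phase tempered distribution. Then there is an analytic function $L$ on $\mathbb{C}^+$ with $e^{L}=\hat T$, i.e. $\ln\hat T$ is analytic in $\mathbb{C}^+$, and every such $L=\ln\hat T$ has the following properties. 1. $L$ satisfies the Kramers–Kronig dispersion relations with two subtractions: (a)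 for every $c>0$ the functions $u(x)=\operatorname{Re}L(x+ic)$ and $v(x)=\operatorname{Im}L(x+ic)$ satisfy, for all real $\omega_0\neq\omega$, $$u(\omega)-u(\omega_0)-(\omega-\omega_0)u'(\omega_0)=\frac{(\omega-\omega_0)^2}{\pi}\,\mathrm{vp}\!\!\int_{-\infty}^{\infty}\frac{v(x)-v(\omega_0)-(x-\omega_0)v'(\omega_0)}{(x-\omega_0)^2(x-\omega)}\,dx,$$ $$v(\omega)-v(\omega_0)-(\omega-\omega_0)v'(\omega_0)=-\frac{(\omega-\omega_0)^2}{\pi}\,\mathrm{vp}\!\!\int_{-\infty}^{\infty}\frac{u(x)-u(\omega_0)-(x-\omega_0)u'(\omega_0)}{(x-\omega_0)^2(x-\omega)}\,dx,$$ where the integrals converge absolutely away from $x=\omega$ and their principal values at $x=\omega$ exist; (b) on the real axis, $\operatorname{Re}L(\cdot+ic)$ and $\operatorname{Im}L(\cdot+ic)$ converge, as $c\to0^+$, against every Schwartz function to tempered distributions $R$ and $X$, and for every $\omega_0\in\mathbb{R}$ there are tempered distributions $A,B$ with $R=(\omega-\omega_0)^2A$, $X=(\omega-\omega_0)^2B$,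 $A=-\mathcal{H}B$ and $B=\mathcal{H}A$. 2. There is a continuous function $f:\mathbb{R}\to\mathbb{C}$ of at most polynomial growth, vanishing on $(-\infty,0)$, such that $$L(z)=i\tau z+\widehat{D^2f}(z)\qquad(z\in\mathbb{C}^+),$$ where $D^2f$ is the second distributional derivative of $f$. Thus for a signal with onset at time zero ($\tau=0$), $\ln\hat T$ is the Fourier transform of the second-order derivative of a causal continuous function. -/

import Mathlib

open Complex MeasureTheory Filter Topology Set
open scoped SchwartzMap ContDiff

noncomputable section

namespace MinPhase

/-! ### The Fourier transform of a causal tempered distribution in the upper half-plane -/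

/-- The open upper half-plane, as a set of complex numbers. -/
def upperHalf : Set ℂ := {z : ℂ | 0 < z.im}

/-- A smooth cut-off, equal to `1` on `[-1, ∞)` and to `0` on `(-∞, -2]`. -/
def cutoff (t : ℝ) : ℂ := ((Real.smoothTransition (t + 2) : ℝ) : ℂ)

/-- The function `t ↦ exp (i z t)`, cut off on the far negative half-axis. -/
def cutExp (z : ℂ) (t : ℝ) : ℂ := cutoff t * cexp (I * z * t)

theorem cutoff_contDiff : ContDiff ℝ ∞ cutoff :=
  Complex.ofRealCLM.contDiff.comp
    (Real.smoothTransition.contDiff.comp (contDiff_id.add contDiff_const))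

theorem cutoff_eq_one {t : ℝ} (ht : -1 ≤ t) : cutoff t = 1 := by
  simp [cutoff, Real.smoothTransition.one_of_one_le (show (1 : ℝ) ≤ t + 2 by linarith)]

theorem cutoff_eq_zero {t : ℝ} (ht : t ≤ -2) : cutoff t = 0 := by
  simp [cutoff, Real.smoothTransition.zero_of_nonpos (show t + 2 ≤ 0 by linarith)]

theorem cutoff_temperate : Function.HasTemperateGrowth cutoff := by
  have hsupp : HasCompactSupport (fderiv ℝ cutoff) := by
    refine HasCompactSupport.intro (isCompact_Icc (a := (-2 : ℝ)) (b := -1)) fun t ht => ?_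
    rcases not_and_or.1 (show ¬ ((-2 : ℝ) ≤ t ∧ t ≤ -1) from ht) with h | h
    · have : cutoff =ᶠ[𝓝 t] fun _ => (0 : ℂ) := by
        filter_upwards [Iio_mem_nhds (not_le.1 h)] with s hs
        exact cutoff_eq_zero (le_of_lt hs)
      rw [this.fderiv_eq]; simp
    · have : cutoff =ᶠ[𝓝 t] fun _ => (1 : ℂ) := by
        filter_upwards [Ioi_mem_nhds (not_le.1 h)] with s hs
        exact cutoff_eq_one (le_of_lt hs)
      rw [this.fderiv_eq]; simp
  refine Function.HasTemperateGrowth.of_fderiv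
    (hsupp.hasTemperateGrowth (cutoff_contDiff.fderiv_right (by simp)))
    (cutoff_contDiff.differentiable (by simp)) (k := 0) (C := 1) fun t => ?_
  simpa [cutoff, abs_of_nonneg (Real.smoothTransition.nonneg _)] using
    Real.smoothTransition.le_one (t + 2)

theorem cexp_contDiff (z : ℂ) : ContDiff ℝ ∞ (fun t : ℝ => cexp (I * z * t)) :=
  (contDiff_const.mul Complex.ofRealCLM.contDiff).cexp

theorem iteratedDeriv_cexp_line (z : ℂ) (n : ℕ) :
    iteratedDeriv n (fun t : ℝ => cexp (I * z * t)) =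
      fun t : ℝ => (I * z) ^ n * cexp (I * z * t) := by
  induction n with
  | zero => ext t; simp
  | succ n ih =>
    rw [iteratedDeriv_succ, ih]
    ext t
    have h0 : HasDerivAt (fun s : ℝ => I * z * (s : ℂ)) (I * z * 1) t :=
      (Complex.ofRealCLM.hasDerivAt (x := t)).const_mul (I * z)
    have h1 := (h0.cexp).const_mul ((I * z) ^ n)
    rw [h1.deriv]
    ring

theorem cutExp_contDiff (z : ℂ) : ContDiff ℝ ∞ (cutExp z) :=
  cutoff_contDiff.mul (cexp_contDiff z)

theorem cutExp_decay {z : ℂ} (hz : 0 < z.im) (k n : ℕ) :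
    ∃ C : ℝ, ∀ t : ℝ, ‖t‖ ^ k * ‖iteratedFDeriv ℝ n (cutExp z) t‖ ≤ C := by
  obtain ⟨m, C, hC0, hC⟩ := cutoff_temperate.norm_iteratedFDeriv_le_uniform n
  set y := z.im with hy
  set A : ℝ := ∑ i ∈ Finset.range (n + 1), (n.choose i : ℝ) * C * ‖z‖ ^ (n - i) with hA
  have hA0 : 0 ≤ A := Finset.sum_nonneg fun i _ => by positivity
  refine ⟨A * (((k + m).factorial : ℝ) / y ^ (k + m) * Real.exp (5 * y)), fun t => ?_⟩
  by_cases ht : t < -2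
  · have hz0 : iteratedFDeriv ℝ n (cutExp z) t = 0 := by
      have hev : cutExp z =ᶠ[𝓝 t] fun _ => (0 : ℂ) := by
        filter_upwards [Iio_mem_nhds ht] with s hs
        simp [cutExp, cutoff_eq_zero (le_of_lt hs)]
      rw [(hev.iteratedFDeriv ℝ n).eq_of_nhds]
      simp
    rw [hz0]
    simp only [norm_zero, mul_zero]
    positivity
  · push Not at ht
    have hexp : ∀ j : ℕ, ‖iteratedFDeriv ℝ j (fun s : ℝ => cexp (I * z * s)) t‖ =
        ‖z‖ ^ j * Real.exp (-(y * t)) := by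
      intro j
      rw [norm_iteratedFDeriv_eq_norm_iteratedDeriv, iteratedDeriv_cexp_line]
      simp [Complex.norm_exp, hy]
    have h1 : ‖iteratedFDeriv ℝ n (cutExp z) t‖ ≤
        A * ((1 + ‖t‖) ^ m * Real.exp (-(y * t))) := by
      refine (norm_iteratedFDeriv_mul_le cutoff_contDiff (cexp_contDiff z) t
        (n := n) (by exact_mod_cast le_top)).trans ?_
      rw [hA, Finset.sum_mul]
      refine Finset.sum_le_sum fun i hi => ?_
      rw [hexp]
      have := hC i (by simpa [Nat.lt_succ_iff] using hi) t
      calc (n.choose i : ℝ) * ‖iteratedFDeriv ℝ i cutoff t‖ *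
            (‖z‖ ^ (n - i) * Real.exp (-(y * t)))
          ≤ (n.choose i : ℝ) * (C * (1 + ‖t‖) ^ m) *
            (‖z‖ ^ (n - i) * Real.exp (-(y * t))) := by gcongr
        _ = _ := by ring
    have habs : ‖t‖ ≤ t + 4 := by
      rw [Real.norm_eq_abs, abs_le]; constructor <;> linarith
    have h5 : 0 ≤ y * (t + 5) := mul_nonneg hz.le (by linarith)
    have h2 := Real.pow_div_factorial_le_exp (y * (t + 5)) h5 (k + m)
    have h3 : (t + 5) ^ (k + m) ≤
        ((k + m).factorial : ℝ) / y ^ (k + m) * Real.exp (y * (t + 5)) := by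
      rw [mul_pow, div_le_iff₀ (by positivity)] at h2
      rw [div_mul_eq_mul_div, le_div_iff₀ (by positivity)]
      linarith
    calc ‖t‖ ^ k * ‖iteratedFDeriv ℝ n (cutExp z) t‖
        ≤ (t + 5) ^ k * (A * ((t + 5) ^ m * Real.exp (-(y * t)))) := by
          have hk : ‖t‖ ^ k ≤ (t + 5) ^ k := pow_le_pow_left₀ (norm_nonneg _) (by linarith) k
          have hm : (1 + ‖t‖) ^ m ≤ (t + 5) ^ m :=
            pow_le_pow_left₀ (by positivity) (by linarith) m
          have hk0 : 0 ≤ (t + 5) ^ k := pow_nonneg (by linarith) k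
          refine mul_le_mul hk (h1.trans ?_) (norm_nonneg _) hk0
          gcongr
      _ = A * ((t + 5) ^ (k + m) * Real.exp (-(y * t))) := by ring
      _ ≤ A * (((k + m).factorial : ℝ) / y ^ (k + m) * Real.exp (y * (t + 5)) *
            Real.exp (-(y * t))) := by gcongr
      _ = A * (((k + m).factorial : ℝ) / y ^ (k + m) * Real.exp (5 * y)) := by
          rw [mul_assoc (_ / _), ← Real.exp_add]
          ring_nf

/-- For `z` in the upper half-plane, a Schwartz function equal to `exp (i z t)` for `t ≥ -1`
(and `0` for the other values of `z`). -/
def expTest (z : ℂ) : 𝓢(ℝ, ℂ) :=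
  if hz : 0 < z.im then ⟨cutExp z, cutExp_contDiff z, cutExp_decay hz⟩ else 0

theorem expTest_apply {z : ℂ} (hz : 0 < z.im) {t : ℝ} (ht : -1 ≤ t) :
    expTest z t = cexp (I * z * t) := by
  have : expTest z t = cutExp z t := by
    rw [expTest, dif_pos hz]; rfl
  rw [this, cutExp, cutoff_eq_one ht, one_mul]

/-- A tempered distribution on the line is causal if it vanishes on `(-∞, 0)`. -/
def IsCausal (T : 𝓢'(ℝ, ℂ)) : Prop := Distribution.IsVanishingOn T (Iio (0 : ℝ))

/-- The Fourier transform `T̂(z) = ⟨T, exp (i z t)⟩` of a causal tempered distribution at a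
point `z` of the upper half-plane. As `T` is supported in `[0, ∞)`, the cut-off of the exponential
on the negative half-axis does not affect the value. -/
def fourierHat (T : 𝓢'(ℝ, ℂ)) (z : ℂ) : ℂ := T (expTest z)

/-- A causal tempered distribution is minimum phase if its Fourier transform and the reciprocal
of its Fourier transform are analytic in the upper half-plane. -/
structure IsMinimumPhase (T : 𝓢'(ℝ, ℂ)) : Prop where
  causal : IsCausal T
  analytic : DifferentiableOn ℂ (fourierHat T) upperHalf
  ne_zero : ∀ z ∈ upperHalf, fourierHat T z ≠ 0
  analytic_inv : DifferentiableOn ℂ (fun z => (fourierHat T z)⁻¹) upperHalf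

/-- `L` is an analytic logarithm of `T̂` in the upper half-plane. -/
def IsLogHat (T : 𝓢'(ℝ, ℂ)) (L : ℂ → ℂ) : Prop :=
  DifferentiableOn ℂ L upperHalf ∧ ∀ z ∈ upperHalf, cexp (L z) = fourierHat T z

/-- `f` is a measurable function of at most polynomial growth. -/
def PolyGrowth (f : ℝ → ℂ) : Prop :=
  AEStronglyMeasurable f volume ∧ ∃ (C : ℝ) (k : ℕ), ∀ t : ℝ, ‖f t‖ ≤ C * (1 + |t|) ^ k

/-- The tempered distribution `U` is the function `f` of polynomial growth. -/
def IsFunction (U : 𝓢'(ℝ, ℂ)) (f : ℝ → ℂ) : Prop :=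
  PolyGrowth f ∧ ∀ φ : 𝓢(ℝ, ℂ), U φ = ∫ t, f t * φ t

/-- The second distributional derivative. -/
def secondDeriv (U : 𝓢'(ℝ, ℂ)) : 𝓢'(ℝ, ℂ) :=
  TemperedDistribution.derivCLM ℂ (TemperedDistribution.derivCLM ℂ U)

/-! ### Kramers-Kronig relations with two subtractions -/

/-- `J` is the Cauchy principal value, at the point `a`, of the integral of `F` over the line. -/
def HasPrincipalValue (F : ℝ → ℝ) (a J : ℝ) : Prop :=
  (∀ ε : ℝ, 0 < ε → IntegrableOn F {x | ε < |x - a|}) ∧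
    Tendsto (fun ε : ℝ => ∫ x in {x | ε < |x - a|}, F x) (𝓝[>] 0) (𝓝 J)

/-- For functions `u`, `v` on the line with prescribed derivatives `u'`, `v'` at `w₀`, the
twice-subtracted relation
`u(w) - u(w₀) - (w - w₀) u' = s (w - w₀)² / π · vp ∫ N(x) / ((x - w₀)² (x - w)) dx`,
with `N(x) = v(x) - v(w₀) - (x - w₀) v'`. -/
def TwiceSubtracted (s : ℝ) (u v : ℝ → ℝ) (w₀ u' v' w : ℝ) : Prop :=
  ∃ J : ℝ,
    HasPrincipalValue
      (fun x => (v x - v w₀ - (x - w₀) * v') / ((x - w₀) ^ 2 * (x - w))) w J ∧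
    u w - u w₀ - (w - w₀) * u' = s * ((w - w₀) ^ 2 / Real.pi) * J

/-- The Kramers-Kronig relations with two subtractions for the real and imaginary parts of `L`
on the horizontal line of height `c`, with an arbitrary real subtraction point `w₀`. -/
def KKOnLine (L : ℂ → ℂ) (c : ℝ) : Prop :=
  ∀ w₀ w : ℝ, w ≠ w₀ →
    TwiceSubtracted 1 (fun x => (L (x + c * I)).re) (fun x => (L (x + c * I)).im)
      w₀ (deriv L (w₀ + c * I)).re (deriv L (w₀ + c * I)).im w ∧
    TwiceSubtracted (-1) (fun x => (L (x + c * I)).im) (fun x => (L (x + c * I)).re)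
      w₀ (deriv L (w₀ + c * I)).im (deriv L (w₀ + c * I)).re w

/-- The tempered distribution `G` on the real axis is the boundary value, from above, of the
function `u` on the upper half-plane. -/
def IsBoundaryValue (u : ℂ → ℂ) (G : 𝓢'(ℝ, ℂ)) : Prop :=
  ∀ φ : 𝓢(ℝ, ℂ),
    (∀ c : ℝ, 0 < c → Integrable fun x : ℝ => u (x + c * I) * φ x) ∧
    Tendsto (fun c : ℝ => ∫ x : ℝ, u (x + c * I) * φ x) (𝓝[>] 0) (𝓝 (G φ))

/-- The tempered distribution `G` is the Fourier transform `ω ↦ ∫ b(t) exp (i ω t) dt` of the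
function `b` of polynomial growth. -/
def IsFourierOf (b : ℝ → ℂ) (G : 𝓢'(ℝ, ℂ)) : Prop :=
  PolyGrowth b ∧ ∀ φ : 𝓢(ℝ, ℂ), G φ = ∫ t : ℝ, b t * ∫ w : ℝ, cexp (I * w * t) * φ w

/-- `A` is the Hilbert transform of `B`, that is the convolution of `B` with `vp 1/(π ω)`, for
tempered distributions whose inverse Fourier transforms are functions of polynomial growth.
With the kernel `exp (i ω t)` the Fourier multiplier of this convolution is `-i sgn t`. -/
def IsHilbertTransform (B A : 𝓢'(ℝ, ℂ)) : Prop :=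
  ∃ b : ℝ → ℂ, IsFourierOf b B ∧ IsFourierOf (fun t => -I * (Real.sign t : ℂ) * b t) A

/-- The Kramers-Kronig relations with two subtractions on the real axis, in the sense of
distributions, for the real and imaginary parts `R`, `X` of a boundary value, with subtraction
point `w₀`: there are distributional quotients `A = R / (ω - w₀)²` and `B = X / (ω - w₀)²` which
are Hilbert transforms of one another. (Such quotients are unique up to multiples of the delta
function at `w₀` and of its derivative; these account for the subtraction constants.) -/
def KKOnAxis (R X : 𝓢'(ℝ, ℂ)) (w₀ : ℝ) : Prop :=
  ∃ A B : 𝓢'(ℝ, ℂ),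
    R = TemperedDistribution.smulLeftCLM ℂ (fun w : ℝ => ((w : ℂ) - w₀) ^ 2) A ∧
    X = TemperedDistribution.smulLeftCLM ℂ (fun w : ℝ => ((w : ℂ) - w₀) ^ 2) B ∧
    IsHilbertTransform B (-A) ∧ IsHilbertTransform A B

/-- The real and imaginary parts of the function `L`, analytic in the upper half-plane, satisfy
the Kramers-Kronig dispersion relations with two subtractions: pointwise on every line above the
real axis and, for the distributional boundary values, on the real axis itself. -/
def SatisfiesKKTwoSubtractions (L : ℂ → ℂ) : Prop :=
  (∀ c : ℝ, 0 < c → KKOnLine L c) ∧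
  ∃ R X : 𝓢'(ℝ, ℂ),
    IsBoundaryValue (fun z => ((L z).re : ℂ)) R ∧
    IsBoundaryValue (fun z => ((L z).im : ℂ)) X ∧
    ∀ w₀ : ℝ, KKOnAxis R X w₀

end MinPhase

end

open Complex MeasureTheory Filter Topology Set
open scoped SchwartzMap ContDiff

noncomputable section

namespace MinPhase

/-! ### Cauchy's theorem on the upper half-plane -/

/-! Everything rests on one growth estimate. A causal tempered distribution satisfies |T̂(z)| ≤ C
(1+|z|)^N e^{Im z} (1+1/Im z)^b. Since T̂ has no zeros in the simply connected upper half-plane, an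
analytic logarithm L exists, and the real part of W = L + iz is bounded above by logarithms of |z|
and 1/Im z (`IsLogHat.isLogBounded`). A one-sided bound on the real part already controls an
analytic function: away from the real axis some p = K + N log(1 - iz) dominates W, so W = p - (p -
W) is a difference of functions with non-negative real part, and both obey the Carathéodory
inequality and the Herglotz representation.

Representation. Herglotz's formula gives a linear term plus a Cauchy-type integral of a
Poisson-integrable function, and that integral is (z+i)² times the Laplace transform of a bounded
causal density (`exists_laplace_of_re_nonneg`). Applied to z ↦ W(c(z+i)), it yields W(z) = iaz - z²
f̂_c(z) for Im z > c, where f_c may grow like e^{ct}. By uniqueness of Laplace transforms f_c is the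
same function f for all c ≤ 1, and the constants involved grow only like a power of 1/c; choosing c
of order 1/|t| shows that f grows polynomially (`IsLogBounded.exists_rep`).

Onset time. Removing the added iz turns the coefficient a into a - 1. For Im z > 1 the
representation bounds |T̂| by a power of |z| times e^{-(a-1) Im z}, so T vanishes on (-∞, a-1) by a
Paley-Wiener argument (`isVanishingOn_of_norm_fourierHat_le`). Conversely, if T vanishes on (-∞, s),
then T̂(iy) is at most a power of y times e^{-ry} for r < s, whereas y² f̂(iy) = o(y) because f is
continuous with f(0) = 0; hence s ≤ a - 1. So a - 1 is the onset time.

Dispersion relations. On a horizontal line the second divided difference of L at ω₀ is analytic and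
integrable against 1/(1+|x|), by a square-root trick (`integrable_norm_div_of_re_nonneg`). Cauchy's
formula then holds for it as a principal value, and its real and imaginary parts are the two
relations. On the real axis, L is z² times the transform of a causal function, and division by
(z-ω₀)² preserves this form with a new causal G. The real and imaginary parts of the boundary value
of Ĝ have densities supported in both directions of time, which the multiplier -i sgn t exchanges.
-/

/-- The half-plane of complex numbers with imaginary part larger than `a`. -/
def aboveLine (a : ℝ) : Set ℂ := {z : ℂ | a < z.im}

theorem isOpen_aboveLine (a : ℝ) : IsOpen (aboveLine a) :=
  isOpen_lt continuous_const Complex.continuous_im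

theorem mem_aboveLine {a : ℝ} {z : ℂ} : z ∈ aboveLine a ↔ a < z.im := Iff.rfl

theorem aboveLine_anti {a b : ℝ} (h : a ≤ b) : aboveLine b ⊆ aboveLine a :=
  fun _ hz => lt_of_le_of_lt h hz

theorem upperHalf_eq_aboveLine : upperHalf = aboveLine 0 := rfl

/-- `h` is of at most polynomial growth on the closed upper half-plane. -/
def PolyBounded (h : ℂ → ℂ) : Prop :=
  ∃ (C : ℝ) (m : ℕ), ∀ z : ℂ, 0 ≤ z.im → ‖h z‖ ≤ C * (1 + ‖z‖) ^ m

theorem continuous_real_of_differentiableOn {h : ℂ → ℂ} {d : ℝ} (hd : 0 < d)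
    (hh : DifferentiableOn ℂ h (aboveLine (-d))) : Continuous fun x : ℝ => h x := by
  refine hh.continuousOn.comp_continuous Complex.continuous_ofReal fun x => ?_
  simp [mem_aboveLine, hd]

/-- Cauchy's theorem on the rectangle with base [-R, R] and height R: the other three sides have
total length 4R, and |h| ≤ C/R² on them. -/
theorem integral_real_eq_zero_of_decay {h : ℂ → ℂ} {d C : ℝ} (hd : 0 < d)
    (hh : DifferentiableOn ℂ h (aboveLine (-d)))
    (hC : ∀ z : ℂ, 0 ≤ z.im → ‖h z‖ ≤ C / (1 + ‖z‖) ^ 2) : ∫ x : ℝ, h x = 0 := by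
  have hcont := continuous_real_of_differentiableOn hd hh
  have hC0 : 0 ≤ C := by simpa using (norm_nonneg _).trans (hC 0 (by simp))
  have hint : Integrable fun x : ℝ => h x := by
    refine (integrable_inv_one_add_sq.const_mul C).mono' hcont.aestronglyMeasurable
      (ae_of_all _ fun x => (hC x (by simp)).trans ?_)
    rw [div_eq_mul_inv]
    gcongr
    have : ‖(x : ℂ)‖ ^ 2 = x ^ 2 := by simp
    nlinarith [norm_nonneg (x : ℂ)]
  have hlim := intervalIntegral_tendsto_integral hint
    tendsto_neg_atTop_atBot tendsto_id
  refine tendsto_nhds_unique hlim (squeeze_zero_norm' (a := fun R : ℝ => 4 * C / R) ?_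
    (tendsto_const_nhds.div_atTop tendsto_id))
  filter_upwards [eventually_gt_atTop 0] with R hR
  have hrect := integral_boundary_rect_eq_zero_of_differentiableOn h (-R : ℝ) (R + R * I : ℂ)
    (hh.mono fun z hz => by
      have h1 : z.im ∈ uIcc (0 : ℝ) R := by simpa using hz.2
      rw [uIcc_of_le hR.le] at h1
      exact lt_of_lt_of_le (by simpa using hd) h1.1)
  simp only [ofReal_re, ofReal_im, add_re, add_im, mul_re, mul_im, I_re, I_im, mul_zero, mul_one,
    zero_mul, add_zero, zero_add, sub_self, ofReal_zero] at hrect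
  have hbd : ∀ z : ℂ, 0 ≤ z.im → R ≤ ‖z‖ → ‖h z‖ ≤ C / R ^ 2 := fun z hz hz' => by
    refine (hC z hz).trans ?_
    gcongr
    linarith
  have htop : ‖∫ x in (-R)..R, h (x + R * I)‖ ≤ C / R ^ 2 * |R - -R| := by
    refine intervalIntegral.norm_integral_le_of_norm_le_const fun x _ => hbd _ (by simp [hR.le]) ?_
    have := abs_im_le_norm (x + R * I : ℂ)
    simpa [abs_of_pos hR] using this
  have hside : ∀ s : ℝ, |s| = R → ‖∫ y in (0 : ℝ)..R, h (s + y * I)‖ ≤ C / R ^ 2 * |R - 0| := by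
    intro s hs
    refine intervalIntegral.norm_integral_le_of_norm_le_const fun y hy => hbd _ ?_ ?_
    · rw [uIoc_of_le hR.le] at hy
      simpa using hy.1.le
    · have := abs_re_le_norm (s + y * I : ℂ)
      simpa [hs] using this
  have h1 := hside R (abs_of_pos hR)
  have h2 := hside (-R) (by simp [abs_of_pos hR])
  have heq : ∫ x in (-R)..R, h x = (∫ x in (-R)..R, h (x + R * I)) -
      I • (∫ y in (0 : ℝ)..R, h (R + y * I)) + I • ∫ y in (0 : ℝ)..R, h ((-R : ℝ) + y * I) := by
    linear_combination hrect
  simp only [id]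
  rw [heq]
  refine (norm_add_le _ _).trans ((add_le_add (norm_sub_le _ _) le_rfl).trans ?_)
  simp only [norm_smul, norm_I, one_mul]
  refine (add_le_add (add_le_add htop h1) h2).trans (le_of_eq ?_)
  rw [sub_neg_eq_add, sub_zero, abs_of_pos hR, abs_of_pos (by linarith : 0 < R + R)]
  field_simp
  ring

/-- Powers of 1 - iez serve as convergence factors: the zero -i/e is below the real axis, and on the
closed upper half-plane the modulus is at least 1 and at least e|z|. -/
theorem one_le_norm_one_sub_mul_I {e : ℝ} (he : 0 ≤ e) {z : ℂ} (hz : 0 ≤ z.im) :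
    1 ≤ ‖1 - I * e * z‖ := by
  have h1 : (1 - I * e * z).re = 1 + e * z.im := by simp
  calc (1 : ℝ) ≤ 1 + e * z.im := by nlinarith
    _ = (1 - I * e * z).re := h1.symm
    _ ≤ _ := re_le_norm _

theorem mul_norm_le_norm_one_sub_mul_I {e : ℝ} (he : 0 ≤ e) {z : ℂ} (hz : 0 ≤ z.im) :
    e * ‖z‖ ≤ ‖1 - I * e * z‖ := by
  have h2 : ‖1 - I * e * z‖ ^ 2 = (1 + e * z.im) ^ 2 + (e * z.re) ^ 2 := by
    rw [Complex.sq_norm, Complex.normSq_apply]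
    simp; ring
  have h3 : ‖z‖ ^ 2 = z.re ^ 2 + z.im ^ 2 := by
    rw [Complex.sq_norm, Complex.normSq_apply]; ring
  refine abs_le_of_sq_le_sq' ?_ (norm_nonneg _) |>.2
  rw [h2, mul_pow, h3]
  nlinarith [mul_nonneg he hz]

/-- A function of polynomial growth, analytic near the closed upper half-plane and integrable on
the real line, has vanishing integral over the real line. -/
theorem integral_real_eq_zero {h : ℂ → ℂ} {d : ℝ} (hd : 0 < d)
    (hh : DifferentiableOn ℂ h (aboveLine (-d))) (hb : PolyBounded h)
    (hint : Integrable fun x : ℝ => h x) : ∫ x : ℝ, h x = 0 := by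
  obtain ⟨C, m, hC⟩ := hb
  have hC0 : 0 ≤ C := by simpa using (norm_nonneg _).trans (hC 0 (by simp))
  -- Division by (1 - iez)^(m+2) restores quadratic decay without creating poles above -1/e. The
  -- factor is removed by letting e → 0 under the integral.
  have key : ∀ e : ℝ, 0 < e → ∫ x : ℝ, h x / (1 - I * e * x) ^ (m + 2) = 0 := by
    intro e he
    have hd' : 0 < min d (1 / e) := lt_min hd (by positivity)
    refine integral_real_eq_zero_of_decay (h := fun z => h z / (1 - I * e * z) ^ (m + 2))
      (C := C * (1 + 1 / e) ^ (m + 2)) hd' ?_ ?_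
    · refine (hh.mono (aboveLine_anti (neg_le_neg (min_le_left _ _)))).div
        (by fun_prop) fun z hz => pow_ne_zero _ fun h0 => ?_
      have h1 : (1 - I * e * z).re = 0 := by rw [h0]; rfl
      have h2 : (1 - I * e * z).re = 1 + e * z.im := by simp
      have h3 : -(1 / e) < z.im :=
        lt_of_le_of_lt (neg_le_neg (min_le_right d (1 / e))) hz
      have h4 : e * (-(1 / e)) < e * z.im := mul_lt_mul_of_pos_left h3 he
      have h5 : e * (-(1 / e)) = -1 := by field_simp
      linarith
    · intro z hz
      have h1 := one_le_norm_one_sub_mul_I he.le hz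
      have h2 := mul_norm_le_norm_one_sub_mul_I he.le hz
      have h3 : 1 + ‖z‖ ≤ (1 + 1 / e) * ‖1 - I * e * z‖ := by
        have : ‖z‖ ≤ 1 / e * ‖1 - I * e * z‖ := by
          rw [one_div, ← div_eq_inv_mul, le_div_iff₀ he]; linarith
        linarith
      rw [norm_div, norm_pow, div_le_div_iff₀ (by positivity) (by positivity)]
      calc ‖h z‖ * (1 + ‖z‖) ^ 2 ≤ C * (1 + ‖z‖) ^ m * (1 + ‖z‖) ^ 2 := by gcongr; exact hC z hz
        _ = C * (1 + ‖z‖) ^ (m + 2) := by ring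
        _ ≤ C * ((1 + 1 / e) * ‖1 - I * e * z‖) ^ (m + 2) := by gcongr
        _ = _ := by rw [mul_pow]; ring
  have hcont := continuous_real_of_differentiableOn hd hh
  have hlim : Tendsto (fun e : ℝ => ∫ x : ℝ, h x / (1 - I * e * x) ^ (m + 2)) (𝓝[>] 0)
      (𝓝 (∫ x : ℝ, h x)) := by
    refine tendsto_integral_filter_of_dominated_convergence (fun x => ‖h x‖) ?_ ?_ hint.norm ?_
    · filter_upwards [self_mem_nhdsWithin] with e he
      refine (hcont.div (by fun_prop) fun x => pow_ne_zero _ fun h0 => ?_).aestronglyMeasurable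
      have := one_le_norm_one_sub_mul_I (le_of_lt he) (z := (x : ℂ)) (by simp)
      rw [h0] at this
      simp at this
      linarith
    · filter_upwards [self_mem_nhdsWithin] with e he
      refine ae_of_all _ fun x => ?_
      rw [norm_div, norm_pow]
      exact div_le_self (norm_nonneg _)
        (one_le_pow₀ (one_le_norm_one_sub_mul_I (le_of_lt he) (by simp)))
    · refine ae_of_all _ fun x => ?_
      have hc : Continuous fun e : ℝ => (1 - I * e * x) ^ (m + 2) := by fun_prop
      have h2 := (tendsto_const_nhds (x := h x)).div (hc.tendsto 0) (by simp)
      simp only [ofReal_zero, mul_zero, zero_mul, sub_zero, one_pow, div_one] at h2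
      exact h2.mono_left nhdsWithin_le_nhds
  refine tendsto_nhds_unique hlim (tendsto_const_nhds.congr' ?_)
  filter_upwards [self_mem_nhdsWithin] with e he
  exact (key e he).symm

/-- Within distance 1 of a the quotient is bounded by compactness, and farther out the division by z
- a only decreases the modulus. -/
theorem polyBounded_dslope {h : ℂ → ℂ} {d : ℝ} (hd : 0 < d)
    (hh : DifferentiableOn ℂ h (aboveLine (-d))) (hb : PolyBounded h) {a : ℂ} (ha : 0 ≤ a.im) :
    PolyBounded (dslope h a) := by
  obtain ⟨C, m, hC⟩ := hb
  have hC0 : 0 ≤ C := by simpa using (norm_nonneg _).trans (hC 0 (by simp))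
  have hs : aboveLine (-d) ∈ 𝓝 a := (isOpen_aboveLine _).mem_nhds (by
    rw [mem_aboveLine]; linarith)
  have hdiff := (differentiableOn_dslope hs).2 hh
  have hK : IsCompact (Metric.closedBall a 1 ∩ {z : ℂ | 0 ≤ z.im}) :=
    (isCompact_closedBall a 1).inter_right (isClosed_le continuous_const continuous_im)
  obtain ⟨B, hB⟩ := hK.exists_bound_of_continuousOn (f := dslope h a) (hdiff.continuousOn.mono
    fun z hz => lt_of_lt_of_le (neg_lt_zero.2 hd) hz.2)
  refine ⟨|B| + (C + ‖h a‖), m, fun z hz => ?_⟩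
  have h1 : (1 : ℝ) ≤ (1 + ‖z‖) ^ m := one_le_pow₀ (by linarith [norm_nonneg z])
  by_cases hza : ‖z - a‖ ≤ 1
  · have := hB z ⟨by simpa [dist_eq_norm] using hza, hz⟩
    calc ‖dslope h a z‖ ≤ |B| * 1 := by rw [mul_one]; exact this.trans (le_abs_self B)
      _ ≤ (|B| + (C + ‖h a‖)) * (1 + ‖z‖) ^ m := by gcongr; linarith [norm_nonneg (h a)]
  · push Not at hza
    have hne : z ≠ a := by rintro rfl; simp at hza; linarith
    rw [dslope_of_ne _ hne, slope_def_field, norm_div]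
    calc ‖h z - h a‖ / ‖z - a‖ ≤ ‖h z - h a‖ := div_le_self (norm_nonneg _) hza.le
      _ ≤ ‖h z‖ + ‖h a‖ * 1 := by rw [mul_one]; exact norm_sub_le _ _
      _ ≤ C * (1 + ‖z‖) ^ m + ‖h a‖ * (1 + ‖z‖) ^ m := by gcongr; exact hC z hz
      _ ≤ (|B| + (C + ‖h a‖)) * (1 + ‖z‖) ^ m := by nlinarith [abs_nonneg B]

/-! ### Closure properties of polynomial growth. -/

theorem PolyBounded.nonneg_bound {h : ℂ → ℂ} (hb : PolyBounded h) :
    ∃ (C : ℝ) (m : ℕ), 0 ≤ C ∧ ∀ z : ℂ, 0 ≤ z.im → ‖h z‖ ≤ C * (1 + ‖z‖) ^ m := by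
  obtain ⟨C, m, hC⟩ := hb
  exact ⟨C, m, by simpa using (norm_nonneg _).trans (hC 0 (by simp)), hC⟩

theorem PolyBounded.add {f g : ℂ → ℂ} (hf : PolyBounded f) (hg : PolyBounded g) :
    PolyBounded fun z => f z + g z := by
  obtain ⟨C, m, hC0, hC⟩ := hf.nonneg_bound
  obtain ⟨D, n, hD0, hD⟩ := hg.nonneg_bound
  refine ⟨C + D, m + n, fun z hz => (norm_add_le _ _).trans ?_⟩
  have h1 : (1 : ℝ) ≤ 1 + ‖z‖ := by linarith [norm_nonneg z]
  rw [add_mul]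
  refine add_le_add ((hC z hz).trans ?_) ((hD z hz).trans ?_)
  · gcongr
    omega
  · gcongr
    omega

theorem PolyBounded.mul {f g : ℂ → ℂ} (hf : PolyBounded f) (hg : PolyBounded g) :
    PolyBounded fun z => f z * g z := by
  obtain ⟨C, m, hC0, hC⟩ := hf.nonneg_bound
  obtain ⟨D, n, hD0, hD⟩ := hg.nonneg_bound
  refine ⟨C * D, m + n, fun z hz => ?_⟩
  calc ‖f z * g z‖ ≤ (C * (1 + ‖z‖) ^ m) * (D * (1 + ‖z‖) ^ n) := by
        rw [norm_mul]; exact mul_le_mul (hC z hz) (hD z hz) (norm_nonneg _) (by positivity)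
    _ = _ := by ring

theorem polyBounded_const (c : ℂ) : PolyBounded fun _ => c := ⟨‖c‖, 0, by simp⟩

theorem polyBounded_id : PolyBounded fun z => z := ⟨1, 1, by simp⟩

theorem PolyBounded.sub {f g : ℂ → ℂ} (hf : PolyBounded f) (hg : PolyBounded g) :
    PolyBounded fun z => f z - g z := by
  simpa [sub_eq_add_neg] using hf.add ((polyBounded_const (-1)).mul hg)

theorem PolyBounded.pow {f : ℂ → ℂ} (hf : PolyBounded f) (n : ℕ) :
    PolyBounded fun z => f z ^ n := by
  induction n with
  | zero => simpa using polyBounded_const 1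
  | succ n ih => simpa [pow_succ] using ih.mul hf

theorem polyBounded_of_bound {f : ℂ → ℂ} (C : ℝ) (h : ∀ z : ℂ, 0 ≤ z.im → ‖f z‖ ≤ C) :
    PolyBounded f := ⟨C, 0, by simpa using h⟩

theorem im_sub_le_norm_sub (z a : ℂ) : z.im - a.im ≤ ‖z - a‖ := by
  have := (le_abs_self _).trans (abs_im_le_norm (z - a))
  simpa using this

theorem polyBounded_inv_sub {a : ℂ} (ha : a.im < 0) : PolyBounded fun z => (z - a)⁻¹ := by
  refine polyBounded_of_bound ((-a.im)⁻¹) fun z hz => ?_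
  rw [norm_inv]
  have := im_sub_le_norm_sub z a
  exact inv_anti₀ (by linarith) (by linarith)

theorem differentiableOn_inv_sub {a : ℂ} {d : ℝ} (ha : a.im ≤ -d) :
    DifferentiableOn ℂ (fun z => (z - a)⁻¹) (aboveLine (-d)) := by
  refine DifferentiableOn.inv (by fun_prop) fun z hz h0 => ?_
  rw [sub_eq_zero] at h0
  rw [mem_aboveLine, h0] at hz
  linarith

/-! ### Integrability on the line and the Poisson kernel. -/

theorem normSq_real_sub (x : ℝ) (z : ℂ) : ‖(x : ℂ) - z‖ ^ 2 = (x - z.re) ^ 2 + z.im ^ 2 := by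
  rw [Complex.sq_norm, Complex.normSq_apply]; simp; ring

theorem real_sub_ne_zero {z : ℂ} (hz : z.im ≠ 0) (x : ℝ) : (x : ℂ) - z ≠ 0 := fun h => by
  apply hz
  rw [sub_eq_zero] at h
  rw [← h]; simp

/-- Comparison of `x - z`, for `z` off the real line, with `1 + |x|`. -/
theorem exists_one_add_abs_le {z : ℂ} (hz : z.im ≠ 0) :
    ∃ C : ℝ, 0 < C ∧ ∀ x : ℝ, 1 + |x| ≤ C * ‖(x : ℂ) - z‖ := by
  refine ⟨1 + (1 + |z.re|) / |z.im|, by positivity, fun x => ?_⟩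
  have h1 : |z.im| ≤ ‖(x : ℂ) - z‖ := by simpa using abs_im_le_norm ((x : ℂ) - z)
  have h2 : |x - z.re| ≤ ‖(x : ℂ) - z‖ := by simpa using abs_re_le_norm ((x : ℂ) - z)
  have h3 : |x| ≤ |x - z.re| + |z.re| := by
    have := abs_add_le (x - z.re) z.re
    simpa using this
  have h4 : 1 + |z.re| ≤ (1 + |z.re|) / |z.im| * ‖(x : ℂ) - z‖ := by
    have h5 : (1 + |z.re|) / |z.im| * |z.im| = 1 + |z.re| := by
      have : |z.im| ≠ 0 := by simpa using hz
      field_simp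
    calc _ = (1 + |z.re|) / |z.im| * |z.im| := h5.symm
      _ ≤ _ := by gcongr
  rw [add_mul, one_mul]
  linarith

theorem integrable_of_norm_le_one_add_sq {f : ℝ → ℂ} (hf : AEStronglyMeasurable f) (C : ℝ)
    (h : ∀ x, ‖f x‖ ≤ C * (1 + x ^ 2)⁻¹) : Integrable f :=
  (integrable_inv_one_add_sq.const_mul C).mono' hf (ae_of_all _ h)

theorem integrable_of_norm_le_sq {f : ℝ → ℂ} (hf : AEStronglyMeasurable f) (C : ℝ)
    (h : ∀ x, ‖f x‖ * (1 + |x|) ^ 2 ≤ C) : Integrable f := by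
  have hC : 0 ≤ C := (by positivity : (0 : ℝ) ≤ ‖f 0‖ * (1 + |0|) ^ 2).trans (h 0)
  refine integrable_of_norm_le_one_add_sq hf C fun x => ?_
  rw [← div_eq_mul_inv, le_div_iff₀ (by positivity)]
  refine le_trans ?_ (h x)
  gcongr
  nlinarith [abs_nonneg x, sq_abs x]

theorem conj_im_neg {z : ℂ} (hz : 0 < z.im) : ((starRingEnd ℂ) z).im < 0 := by simpa using hz

theorem integrable_poisson {z : ℂ} (hz : 0 < z.im) :
    Integrable fun x : ℝ => (z - (starRingEnd ℂ) z) / (((x : ℂ) - (starRingEnd ℂ) z) * (x - z)) := by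
  obtain ⟨C, hC0, hC⟩ := exists_one_add_abs_le hz.ne'
  obtain ⟨D, hD0, hD⟩ := exists_one_add_abs_le (conj_im_neg hz).ne
  refine integrable_of_norm_le_sq (Continuous.aestronglyMeasurable ?_)
    (‖z - (starRingEnd ℂ) z‖ * (C * D)) fun x => ?_
  · exact continuous_const.div (by fun_prop) fun x =>
      mul_ne_zero (real_sub_ne_zero (conj_im_neg hz).ne x) (real_sub_ne_zero hz.ne' x)
  · have h1 : 0 < ‖(x : ℂ) - z‖ := norm_pos_iff.2 (real_sub_ne_zero hz.ne' x)
    have h2 : 0 < ‖(x : ℂ) - (starRingEnd ℂ) z‖ :=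
      norm_pos_iff.2 (real_sub_ne_zero (conj_im_neg hz).ne x)
    rw [norm_div, norm_mul, div_mul_eq_mul_div, div_le_iff₀ (by positivity), mul_assoc]
    gcongr
    calc (1 + |x|) ^ 2 = (1 + |x|) * (1 + |x|) := by ring
      _ ≤ (C * ‖(x : ℂ) - z‖) * (D * ‖(x : ℂ) - (starRingEnd ℂ) z‖) := by
        gcongr
        · exact hC x
        · exact hD x
      _ = _ := by ring

/-- For real x, (x - z̄)(x - z) = |x - z|², so the integrand is 2i Im z / |x - z|², a rescaled and
translated 1/(1+x²). -/
theorem integral_poisson {z : ℂ} (hz : 0 < z.im) :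
    ∫ x : ℝ, (z - (starRingEnd ℂ) z) / (((x : ℂ) - (starRingEnd ℂ) z) * (x - z)) =
      2 * Real.pi * I := by
  have h1 : ∀ x : ℝ, (z - (starRingEnd ℂ) z) / (((x : ℂ) - (starRingEnd ℂ) z) * (x - z)) =
      (((2 / z.im) * (1 + ((x - z.re) / z.im) ^ 2)⁻¹ : ℝ) : ℂ) * I := by
    intro x
    have h2 : ((x : ℂ) - (starRingEnd ℂ) z) * (x - z) = (((x - z.re) ^ 2 + z.im ^ 2 : ℝ) : ℂ) := by
      rw [← normSq_real_sub, ofReal_pow, ← Complex.conj_mul']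
      simp
    have h3 : z - (starRingEnd ℂ) z = 2 * z.im * I := by
      rw [Complex.sub_conj]; push_cast; ring
    have h4 : (x - z.re) ^ 2 + z.im ^ 2 ≠ 0 := by positivity
    have h5 : (2 / z.im) * (1 + ((x - z.re) / z.im) ^ 2)⁻¹ =
        2 * z.im / ((x - z.re) ^ 2 + z.im ^ 2) := by
      have : z.im ≠ 0 := hz.ne'
      have h6 : 1 + ((x - z.re) / z.im) ^ 2 = ((x - z.re) ^ 2 + z.im ^ 2) / z.im ^ 2 := by
        field_simp; ring
      rw [h6, inv_div]
      field_simp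
    rw [h2, h3, h5]
    push_cast
    ring
  simp_rw [h1]
  rw [integral_mul_const, integral_complex_ofReal, integral_const_mul]
  have h6 : ∫ x : ℝ, (1 + ((x - z.re) / z.im) ^ 2)⁻¹ = z.im * Real.pi := by
    rw [integral_sub_right_eq_self (fun x : ℝ => (1 + (x / z.im) ^ 2)⁻¹) z.re,
      Measure.integral_comp_div (fun x : ℝ => (1 + x ^ 2)⁻¹) z.im, integral_univ_inv_one_add_sq,
      abs_of_pos hz, smul_eq_mul]
  rw [h6, ← mul_assoc, div_mul_cancel₀ _ hz.ne']
  push_cast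
  ring

/-- Cauchy's formula on the upper half-plane. -/
theorem integral_div_sub_eq {h : ℂ → ℂ} {d : ℝ} (hd : 0 < d)
    (hh : DifferentiableOn ℂ h (aboveLine (-d))) (hb : PolyBounded h) {z : ℂ} (hz : 0 < z.im)
    (hint : Integrable fun x : ℝ => h x / (x - z)) :
    ∫ x : ℝ, h x / (x - z) = 2 * Real.pi * I * h z := by
  have hzc := conj_im_neg hz
  -- The subtracted term has its pole at z̄, below the line, and agrees with h at z. Hence E(w)/(w -
  -- z) is analytic in the upper half-plane with zero integral, and what was subtracted integrates
  -- as the Poisson kernel.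
  set E : ℂ → ℂ := fun w => h w - h z * (z - (starRingEnd ℂ) z) * (w - (starRingEnd ℂ) z)⁻¹
    with hE
  have hd' : 0 < min d z.im := lt_min hd hz
  have hEd : DifferentiableOn ℂ E (aboveLine (-(min d z.im))) :=
    (hh.mono (aboveLine_anti (neg_le_neg (min_le_left _ _)))).sub
      (DifferentiableOn.const_mul (differentiableOn_inv_sub (by simp)) _)
  have hEb : PolyBounded E := hb.sub ((polyBounded_const _).mul (polyBounded_inv_sub hzc))
  have hzz : z - (starRingEnd ℂ) z ≠ 0 := by
    intro h0
    have : (z - (starRingEnd ℂ) z).im = 0 := by rw [h0]; rfl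
    simp at this; linarith
  have hEz : E z = 0 := by
    simp only [hE]
    rw [mul_assoc, mul_inv_cancel₀ hzz]; ring
  have hfun : ∀ x : ℝ, dslope E z x = h x / (x - z) -
      h z * ((z - (starRingEnd ℂ) z) / (((x : ℂ) - (starRingEnd ℂ) z) * (x - z))) := by
    intro x
    have hne := real_sub_ne_zero hz.ne' x
    rw [dslope_of_ne _ (sub_ne_zero.1 hne), slope_def_field, hEz]
    have := real_sub_ne_zero hzc.ne x
    simp only [hE]
    field_simp
    ring
  have h0 := integral_real_eq_zero hd' ((differentiableOn_dslope ((isOpen_aboveLine _).mem_nhds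
    (by rw [mem_aboveLine]; linarith))).2 hEd) (polyBounded_dslope hd' hEd hEb hz.le)
    (by simp_rw [hfun]; exact hint.sub ((integrable_poisson hz).const_mul _))
  simp_rw [hfun] at h0
  rw [integral_sub hint ((integrable_poisson hz).const_mul _), integral_const_mul,
    integral_poisson hz] at h0
  linear_combination h0

/-! ### Analytic functions with non-negative real part -/

/-- The Carathéodory inequality on the upper half-plane. -/
theorem norm_le_of_re_nonneg {F : ℂ → ℂ} (hF : DifferentiableOn ℂ F upperHalf)
    (hre : ∀ z ∈ upperHalf, 0 ≤ (F z).re) {Y : ℝ} (hY : 0 < Y) {z : ℂ} (hz : 0 < z.im) :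
    ‖F z‖ ≤ ‖F (I * Y)‖ * (‖z + I * Y‖ ^ 2 / (Y * z.im)) := by
  -- The Cayley transform maps the unit disc to the upper half-plane and 0 to iY; below, w is the
  -- preimage of z.
  set c : ℂ → ℂ := fun w => I * Y * ((1 + w) / (1 - w)) with hc
  have hne : ∀ w ∈ Metric.ball (0 : ℂ) 1, 1 - w ≠ 0 := by
    intro w hw h0
    rw [sub_eq_zero] at h0
    simp [← h0] at hw
  have hcU : ∀ w ∈ Metric.ball (0 : ℂ) 1, c w ∈ upperHalf := by
    intro w hw
    have h1 : (c w).im = Y * ((1 - ‖w‖ ^ 2) / ‖1 - w‖ ^ 2) := by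
      simp only [hc]
      rw [mul_assoc, I_mul_im, re_ofReal_mul, div_eq_mul_inv, Complex.inv_def, ← mul_assoc,
        re_mul_ofReal, Complex.sq_norm, Complex.sq_norm, div_eq_mul_inv]
      congr 2
      rw [Complex.normSq_apply]
      simp
      ring
    have hw1 : ‖w‖ < 1 := by simpa using hw
    have h2 : 0 < ‖1 - w‖ := norm_pos_iff.2 (hne w hw)
    have h3 : 0 < 1 - ‖w‖ ^ 2 := by nlinarith [norm_nonneg w]
    change 0 < (c w).im
    rw [h1]
    positivity
  set w : ℂ := (z - I * Y) / (z + I * Y) with hw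
  have hzY : 0 < ‖z + I * Y‖ := by
    have := (le_abs_self _).trans (abs_im_le_norm (z + I * Y))
    simp at this
    linarith
  have hzY' : z + I * Y ≠ 0 := norm_pos_iff.1 hzY
  have hw2 : 1 - ‖w‖ ^ 2 = 4 * (Y * z.im) / ‖z + I * Y‖ ^ 2 := by
    have h1 : ‖z - I * Y‖ ^ 2 = ‖z + I * Y‖ ^ 2 - 4 * (Y * z.im) := by
      rw [Complex.sq_norm, Complex.sq_norm, Complex.normSq_apply, Complex.normSq_apply]
      simp; ring
    rw [hw, norm_div, div_pow, h1]
    field_simp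
    ring
  have hw3 : 0 < 1 - ‖w‖ ^ 2 := by rw [hw2]; positivity
  have hw1 : ‖w‖ < 1 := by nlinarith [norm_nonneg w]
  have hwb : w ∈ Metric.ball (0 : ℂ) 1 := by simpa using hw1
  have hcw : c w = z := by
    have h1 : 1 - w = 2 * (I * Y) / (z + I * Y) := by rw [hw]; field_simp; ring
    have h2 : 1 + w = 2 * z / (z + I * Y) := by rw [hw]; field_simp; ring
    have hY' : (Y : ℂ) ≠ 0 := by exact_mod_cast hY.ne'
    simp only [hc]
    rw [h1, h2]
    field_simp
  have hdiff : DifferentiableOn ℂ (fun w => -F (c w)) (Metric.ball 0 1) := by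
    refine (hF.comp ?_ hcU).neg
    exact DifferentiableOn.const_mul (DifferentiableOn.div (by fun_prop) (by fun_prop) hne) _
  -- Borel-Carathéodory for -F, whose real part is below every M > 0; the term in M disappears as M
  -- → 0.
  have hBC : ∀ M : ℝ, 0 < M → ‖F z‖ ≤ 2 * M * ‖w‖ / (1 - ‖w‖) +
      ‖F (I * Y)‖ * (1 + ‖w‖) / (1 - ‖w‖) := by
    intro M hM
    have := borelCaratheodory hM hdiff (fun v hv => by
      have := hre _ (hcU v hv)
      simp; linarith) one_pos hwb
    have h0 : c 0 = I * Y := by simp [hc]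
    simpa only [norm_neg, hcw, h0] using this
  have hlim : Tendsto (fun M : ℝ => 2 * M * ‖w‖ / (1 - ‖w‖) +
      ‖F (I * Y)‖ * (1 + ‖w‖) / (1 - ‖w‖)) (𝓝[>] 0)
      (𝓝 (‖F (I * Y)‖ * (1 + ‖w‖) / (1 - ‖w‖))) := by
    have : Continuous fun M : ℝ => 2 * M * ‖w‖ / (1 - ‖w‖) +
      ‖F (I * Y)‖ * (1 + ‖w‖) / (1 - ‖w‖) := by fun_prop
    have h2 := this.tendsto 0
    simp only [mul_zero, zero_mul, zero_div, zero_add] at h2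
    exact h2.mono_left nhdsWithin_le_nhds
  have h1 : ‖F z‖ ≤ ‖F (I * Y)‖ * (1 + ‖w‖) / (1 - ‖w‖) :=
    ge_of_tendsto hlim (by filter_upwards [self_mem_nhdsWithin] with M hM using hBC M hM)
  refine h1.trans ?_
  rw [mul_div_assoc]
  refine mul_le_mul_of_nonneg_left ?_ (norm_nonneg _)
  have h2 : ‖z + I * Y‖ ^ 2 / (Y * z.im) = 4 / (1 - ‖w‖ ^ 2) := by
    rw [hw2]
    field_simp
  rw [h2, div_le_div_iff₀ (by linarith) hw3]
  nlinarith [norm_nonneg w, mul_nonneg (norm_nonneg w) (sub_nonneg.2 hw1.le)]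

section Positive

variable {F : ℂ → ℂ} {d : ℝ}

/-- The Carathéodory bound is used for F(z - id) at the point z + id. Its height is at least d, so
the factor 1/Im is bounded and only quadratic growth remains. -/
theorem exists_norm_le_sq_of_re_nonneg (hd : 0 < d) (hF : DifferentiableOn ℂ F (aboveLine (-d)))
    (hre : ∀ z ∈ aboveLine (-d), 0 ≤ (F z).re) :
    ∃ C : ℝ, 0 ≤ C ∧ ∀ z : ℂ, 0 ≤ z.im → ‖F z‖ ≤ C * (1 + ‖z‖) ^ 2 := by
  have hmaps : ∀ z ∈ upperHalf, z - I * d ∈ aboveLine (-d) := fun z hz => by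
    have : 0 < z.im := hz
    simpa [mem_aboveLine] using this
  have hF' : DifferentiableOn ℂ (fun z => F (z - I * d)) upperHalf :=
    hF.comp (by fun_prop) hmaps
  refine ⟨‖F (I * (1 : ℝ) - I * d)‖ * ((2 + d) ^ 2 / d), by positivity, fun z hz => ?_⟩
  have h := norm_le_of_re_nonneg hF' (fun z hz => hre _ (hmaps z hz)) one_pos
    (z := z + I * d) (by simp; linarith)
  simp only [add_sub_cancel_right] at h
  refine h.trans ?_
  rw [mul_assoc]
  gcongr
  have h1 : ‖z + I * d + I * (1 : ℝ)‖ ≤ (2 + d) * (1 + ‖z‖) := by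
    calc ‖z + I * d + I * (1 : ℝ)‖ ≤ ‖z‖ + ‖I * (d : ℂ)‖ + ‖I * ((1 : ℝ) : ℂ)‖ := norm_add₃_le
      _ = ‖z‖ + d + 1 := by simp [abs_of_pos hd]
      _ ≤ _ := by nlinarith [norm_nonneg z]
  have h2 : 1 * (z + I * d).im = z.im + d := by simp
  rw [h2]
  calc ‖z + I * d + I * (1 : ℝ)‖ ^ 2 / (z.im + d)
      ≤ ((2 + d) * (1 + ‖z‖)) ^ 2 / d := by gcongr; linarith
    _ = _ := by ring

theorem polyBounded_of_re_nonneg (hd : 0 < d) (hF : DifferentiableOn ℂ F (aboveLine (-d)))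
    (hre : ∀ z ∈ aboveLine (-d), 0 ≤ (F z).re) : PolyBounded F := by
  obtain ⟨C, -, hC⟩ := exists_norm_le_sq_of_re_nonneg hd hF hre
  exact ⟨C, 2, hC⟩

/-- The Poisson integral at `i` of a bounded function with analytic extension. -/
theorem integral_div_one_add_sq_eq (hd : 0 < d) (hF : DifferentiableOn ℂ F (aboveLine (-d)))
    {B : ℝ} (hB : ∀ z : ℂ, 0 ≤ z.im → ‖F z‖ ≤ B) :
    Integrable (fun x : ℝ => F x / (1 + x ^ 2)) ∧
      ∫ x : ℝ, F x / (1 + x ^ 2) = Real.pi * F I := by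
  have h1 : ∀ x : ℝ, F x * ((x : ℂ) - -I)⁻¹ / (x - I) = F x / (1 + x ^ 2) := by
    intro x
    have ha := real_sub_ne_zero (z := I) (by simp) x
    have hb := real_sub_ne_zero (z := -I) (by simp) x
    have hc : (1 + (x : ℂ) ^ 2) = (x - -I) * (x - I) := by ring_nf; simp; ring
    rw [hc]
    field_simp
  have hint : Integrable (fun x : ℝ => F x / (1 + x ^ 2)) := by
    refine integrable_of_norm_le_one_add_sq (Continuous.aestronglyMeasurable ?_) B fun x => ?_
    · refine (continuous_real_of_differentiableOn hd hF).div (by fun_prop) fun x => ?_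
      have : (1 + x ^ 2 : ℝ) ≠ 0 := by positivity
      exact_mod_cast this
    · have : ‖(1 + (x : ℂ) ^ 2)‖ = 1 + x ^ 2 := by
        have h2 : (1 + (x : ℂ) ^ 2) = ((1 + x ^ 2 : ℝ) : ℂ) := by push_cast; ring
        rw [h2, norm_real, Real.norm_eq_abs, abs_of_pos (by positivity)]
      rw [norm_div, this, div_eq_mul_inv]
      gcongr
      exact hB x (by simp)
  refine ⟨hint, ?_⟩
  have hd' : 0 < min d 1 := lt_min hd one_pos
  have h2 := integral_div_sub_eq (h := fun z => F z * (z - -I)⁻¹) (z := I) hd'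
    ((hF.mono (aboveLine_anti (neg_le_neg (min_le_left _ _)))).mul
      (differentiableOn_inv_sub (by simp)))
    ((polyBounded_of_bound B hB).mul (polyBounded_inv_sub (by simp))) (by simp)
    (by simp_rw [h1]; exact hint)
  simp_rw [h1] at h2
  rw [h2]
  have h3 : (I - -I) = 2 * I := by ring
  rw [h3]
  field_simp

/-- The Poisson formula at i is available for bounded functions only. The approximants F/(1 +
F/(n+1)) are bounded by n+1, keep a non-negative real part and converge to F; Fatou's lemma passes
to the limit, at the price of an inequality. -/
theorem integrable_re_div_one_add_sq (hd : 0 < d) (hF : DifferentiableOn ℂ F (aboveLine (-d)))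
    (hre : ∀ z ∈ aboveLine (-d), 0 ≤ (F z).re) :
    Integrable (fun x : ℝ => (F x).re / (1 + x ^ 2)) ∧
      ∫ x : ℝ, (F x).re / (1 + x ^ 2) ≤ Real.pi * (F I).re := by
  have hreal : ∀ x : ℝ, (x : ℂ) ∈ aboveLine (-d) := fun x => by simpa [mem_aboveLine] using hd
  have hIm : I ∈ aboveLine (-d) := by simp [mem_aboveLine]; linarith
  have hcl : ∀ z : ℂ, 0 ≤ z.im → z ∈ aboveLine (-d) := fun z hz => by
    rw [mem_aboveLine]; linarith
  set G : ℕ → ℂ → ℂ := fun n z => F z / (1 + F z / (n + 1)) with hG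
  have hden : ∀ (n : ℕ) (z : ℂ), z ∈ aboveLine (-d) → 1 ≤ (1 + F z / (n + 1)).re := by
    intro n z hz
    have h1 : (F z / (n + 1)).re = (F z).re / (n + 1) := by
      have := div_ofReal_re (F z) (n + 1)
      simpa using this
    rw [add_re, h1, one_re]
    have := div_nonneg (hre z hz) (by positivity : (0 : ℝ) ≤ n + 1)
    linarith
  have hden0 : ∀ (n : ℕ) (z : ℂ), z ∈ aboveLine (-d) → (1 + F z / (n + 1)) ≠ 0 := by
    intro n z hz h0
    have := hden n z hz
    rw [h0] at this
    simp at this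
    linarith
  have hGd : ∀ n, DifferentiableOn ℂ (G n) (aboveLine (-d)) := fun n =>
    hF.div ((hF.div_const _).const_add _) (hden0 n)
  have hGB : ∀ (n : ℕ) (z : ℂ), 0 ≤ z.im → ‖G n z‖ ≤ n + 1 := by
    intro n z hz
    have h1 := hden n z (hcl z hz)
    have h0 := norm_pos_iff.2 (hden0 n z (hcl z hz))
    simp only [hG]
    rw [norm_div, div_le_iff₀ h0]
    have h2 : ((n : ℝ) + 1) * ‖1 + F z / (n + 1)‖ = ‖(n + 1 : ℂ) + F z‖ := by
      have h3 : ((n : ℂ) + 1) ≠ 0 := by exact_mod_cast Nat.succ_ne_zero n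
      have h4 : (n + 1 : ℂ) + F z = (n + 1) * (1 + F z / (n + 1)) := by field_simp
      rw [h4, norm_mul]
      congr 1
      have : (n + 1 : ℂ) = ((n + 1 : ℝ) : ℂ) := by push_cast; ring
      rw [this, norm_real, Real.norm_eq_abs, abs_of_pos (by positivity)]
    rw [h2]
    refine abs_le_of_sq_le_sq' ?_ (norm_nonneg _) |>.2
    rw [Complex.sq_norm, Complex.sq_norm, normSq_apply, normSq_apply]
    have h5 := hre z (hcl z hz)
    simp
    nlinarith [mul_nonneg h5 (by positivity : (0 : ℝ) ≤ n + 1)]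
  have hGre : ∀ (n : ℕ) (z : ℂ), z ∈ aboveLine (-d) → 0 ≤ (G n z).re := by
    intro n z hz
    simp only [hG]
    have h6 : (F z / (1 + F z / (n + 1))).re =
        ((F z).re + ((F z).re ^ 2 + (F z).im ^ 2) / (n + 1)) / normSq (1 + F z / (n + 1)) := by
      have hr : (F z / (n + 1)).re = (F z).re / (n + 1) := by
        simpa using div_ofReal_re (F z) (n + 1)
      have hi : (F z / (n + 1)).im = (F z).im / (n + 1) := by
        simpa using div_ofReal_im (F z) (n + 1)
      rw [div_re, add_re, add_im, hr, hi, one_re, one_im]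
      ring
    rw [h6]
    have := hre z hz
    have := normSq_nonneg (1 + F z / (n + 1))
    positivity
  have hlimpt : ∀ z : ℂ, Tendsto (fun n => G n z) atTop (𝓝 (F z)) := by
    intro z
    have h1 : Tendsto (fun n : ℕ => 1 + F z * (1 / ((n : ℂ) + 1))) atTop (𝓝 (1 + F z * 0)) :=
      (tendsto_one_div_add_atTop_nhds_zero_nat.const_mul _).const_add _
    have h2 := (tendsto_const_nhds (x := F z)).div h1 (by simp)
    simp only [mul_zero, add_zero, div_one] at h2
    refine h2.congr fun n => ?_
    simp only [hG, Pi.div_apply]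
    congr 2
    ring
  have hGint := fun n => integral_div_one_add_sq_eq hd (hGd n) (hGB n)
  have hdivre : ∀ (w : ℂ) (x : ℝ), (w / (1 + x ^ 2)).re = w.re / (1 + x ^ 2) := by
    intro w x
    have := div_ofReal_re w (1 + x ^ 2)
    push_cast at this
    exact this
  have hGre_int : ∀ n, Integrable fun x : ℝ => (G n x).re / (1 + x ^ 2) := fun n => by
    simpa [hdivre] using (hGint n).1.re
  have hGre_val : ∀ n, ∫ x : ℝ, (G n x).re / (1 + x ^ 2) = Real.pi * (G n I).re := by
    intro n
    have h1 := congrArg Complex.re (hGint n).2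
    have h2 := integral_re (hGint n).1
    simp only [RCLike.re_eq_complex_re] at h2
    rw [← h2] at h1
    simp only [hdivre] at h1
    rw [h1, re_ofReal_mul]
  have hcontF := continuous_real_of_differentiableOn hd hF
  have hcontG := fun n => continuous_real_of_differentiableOn hd (hGd n)
  have hFnn : ∀ x : ℝ, 0 ≤ (F x).re / (1 + x ^ 2) := fun x =>
    div_nonneg (hre _ (hreal x)) (by positivity)
  have hpos : ∀ x : ℝ, (1 + x ^ 2) ≠ 0 := fun x => by positivity
  have hfatou : ∫⁻ x : ℝ, ENNReal.ofReal ((F x).re / (1 + x ^ 2)) ≤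
      ENNReal.ofReal (Real.pi * (F I).re) := by
    have h1 := lintegral_liminf_le (μ := volume) (u := atTop)
      (f := fun (n : ℕ) (x : ℝ) => ENNReal.ofReal ((G n x).re / (1 + x ^ 2))) fun n =>
        (((continuous_re.comp (hcontG n)).div (by fun_prop) hpos).measurable).ennreal_ofReal
    have h2 : ∀ x : ℝ, liminf (fun n => ENNReal.ofReal ((G n x).re / (1 + x ^ 2))) atTop =
        ENNReal.ofReal ((F x).re / (1 + x ^ 2)) := fun x =>
      (ENNReal.tendsto_ofReal
        (((continuous_re.tendsto _).comp (hlimpt x)).div_const _)).liminf_eq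
    have h3 : ∀ n, ∫⁻ x : ℝ, ENNReal.ofReal ((G n x).re / (1 + x ^ 2)) =
        ENNReal.ofReal (Real.pi * (G n I).re) := fun n => by
      rw [← hGre_val n, ofReal_integral_eq_lintegral_ofReal (hGre_int n)]
      exact ae_of_all _ fun x => div_nonneg (hGre n _ (hreal x)) (by positivity)
    simp_rw [h2, h3] at h1
    refine h1.trans (le_of_eq ?_)
    exact (ENNReal.tendsto_ofReal
      (((continuous_re.tendsto _).comp (hlimpt I)).const_mul _)).liminf_eq
  have hmeas : AEStronglyMeasurable (fun x : ℝ => (F x).re / (1 + x ^ 2)) :=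
    ((continuous_re.comp hcontF).div (by fun_prop) hpos).aestronglyMeasurable
  have hint : Integrable (fun x : ℝ => (F x).re / (1 + x ^ 2)) := by
    refine ⟨hmeas, ?_⟩
    rw [hasFiniteIntegral_iff_ofReal (ae_of_all _ hFnn)]
    exact hfatou.trans_lt ENNReal.ofReal_lt_top
  refine ⟨hint, ?_⟩
  rw [← ofReal_integral_eq_lintegral_ofReal hint (ae_of_all _ hFnn)] at hfatou
  exact (ENNReal.ofReal_le_ofReal_iff
    (mul_nonneg Real.pi_pos.le (hre I hIm))).1 hfatou

/-- Re v² ≥ 0 means |Im v| ≤ |Re v|. -/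
theorem norm_le_two_mul_re_sq {w v : ℂ} (hw : 0 ≤ w.re) (hv : v ^ 2 = w) :
    ‖w‖ ≤ 2 * v.re ^ 2 := by
  have h1 : ‖w‖ = v.re ^ 2 + v.im ^ 2 := by
    rw [← hv, norm_pow, Complex.sq_norm, normSq_apply]; ring
  have h2 : w.re = v.re ^ 2 - v.im ^ 2 := by
    rw [← hv, pow_two, mul_re]; ring
  linarith

/-- Re F is Poisson integrable, but Im F need not be. The square root S of F + 1 also has
non-negative real part, so Re S is Poisson integrable; moreover |F| ≤ 2 (Re S)² and S grows at most
linearly, so |F| is at most a multiple of (1+|x|) Re S. Adding 1 keeps the argument of the root off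
the branch cut. -/
theorem integrable_norm_div_of_re_nonneg (hd : 0 < d) (hF : DifferentiableOn ℂ F (aboveLine (-d)))
    (hre : ∀ z ∈ aboveLine (-d), 0 ≤ (F z).re) :
    Integrable fun x : ℝ => ‖F x‖ / ((1 + |x|) * (1 + x ^ 2)) := by
  obtain ⟨C, hC0, hC⟩ := exists_norm_le_sq_of_re_nonneg hd hF hre
  set S : ℂ → ℂ := fun z => (F z + 1) ^ (1 / 2 : ℂ) with hS
  have hpos : ∀ z ∈ aboveLine (-d), 0 < (F z + 1).re := fun z hz => by
    have := hre z hz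
    simp; linarith
  have hSd : DifferentiableOn ℂ S (aboveLine (-d)) :=
    (hF.add_const 1).cpow_const fun z hz => Or.inl (hpos z hz)
  have hSsq : ∀ z, S z ^ 2 = F z + 1 := fun z => by
    simp only [hS]
    rw [← cpow_nat_mul]
    norm_num
  have hSre : ∀ z ∈ aboveLine (-d), 0 ≤ (S z).re := by
    intro z hz
    have h0 : F z + 1 ≠ 0 := fun h => by
      have := hpos z hz
      rw [h] at this
      simp at this
    simp only [hS]
    rw [cpow_def_of_ne_zero h0, exp_re]
    refine mul_nonneg (Real.exp_pos _).le (Real.cos_nonneg_of_mem_Icc ?_)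
    have h1 : (log (F z + 1) * (1 / 2)).im = arg (F z + 1) / 2 := by
      have : (1 / 2 : ℂ) = ((1 / 2 : ℝ) : ℂ) := by push_cast; ring
      rw [this, im_mul_ofReal, log_im]
      ring
    rw [h1]
    have := neg_pi_lt_arg (F z + 1)
    have := arg_le_pi (F z + 1)
    constructor <;> linarith
  have hint := (integrable_re_div_one_add_sq hd hSd hSre).1
  have hcontF := continuous_real_of_differentiableOn hd hF
  refine (hint.const_mul (2 * (C + 1))).mono'
    ((hcontF.norm.div (by fun_prop) fun x => by positivity).aestronglyMeasurable)
    (ae_of_all _ fun x => ?_)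
  have hx : (x : ℂ) ∈ aboveLine (-d) := by simpa [mem_aboveLine] using hd
  have h1 : 0 ≤ (S x).re := hSre _ hx
  have h2 : ‖F x + 1‖ ≤ 2 * (S x).re ^ 2 := norm_le_two_mul_re_sq (hpos _ hx).le (hSsq x)
  have h3 : ‖F x‖ ≤ ‖F x + 1‖ := by
    refine abs_le_of_sq_le_sq' ?_ (norm_nonneg _) |>.2
    rw [Complex.sq_norm, Complex.sq_norm, normSq_apply, normSq_apply]
    have := hre _ hx
    simp
    nlinarith
  have h4 : (S x).re ^ 2 ≤ ((C + 1) * (1 + |x|)) ^ 2 := by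
    calc (S x).re ^ 2 ≤ ‖S x‖ ^ 2 := by
          rw [Complex.sq_norm, normSq_apply]; nlinarith [mul_self_nonneg (S x).im]
      _ = ‖F x + 1‖ := by rw [← norm_pow, hSsq]
      _ ≤ ‖F x‖ + 1 := by simpa using norm_add_le (F x) 1
      _ ≤ C * (1 + |x|) ^ 2 + 1 := by simpa using hC x (by simp)
      _ ≤ _ := by
        rw [mul_pow]
        have : 1 ≤ (1 + |x|) ^ 2 := one_le_pow₀ (by linarith [abs_nonneg x])
        calc C * (1 + |x|) ^ 2 + 1 ≤ (C + 1) * (1 + |x|) ^ 2 := by linarith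
          _ ≤ (C + 1) ^ 2 * (1 + |x|) ^ 2 := by gcongr; nlinarith
  have h5 : (S x).re ≤ (C + 1) * (1 + |x|) := abs_le_of_sq_le_sq' h4 (by positivity) |>.2
  rw [Real.norm_eq_abs, abs_of_nonneg (by positivity), div_le_iff₀ (by positivity)]
  calc ‖F x‖ ≤ 2 * (S x).re ^ 2 := h3.trans h2
    _ = 2 * ((S x).re * (S x).re) := by ring
    _ ≤ 2 * ((S x).re * ((C + 1) * (1 + |x|))) := by gcongr
    _ = _ := by
      have : (1 + x ^ 2) ≠ 0 := by positivity
      field_simp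

end Positive

/-! ### The Herglotz representation -/

theorem one_add_abs_le_two_mul_norm_add_I (x : ℝ) : 1 + |x| ≤ 2 * ‖(x : ℂ) + I‖ := by
  have h1 : |x| ≤ ‖(x : ℂ) + I‖ := by simpa using abs_re_le_norm ((x : ℂ) + I)
  have h2 : 1 ≤ ‖(x : ℂ) + I‖ := by simpa using abs_im_le_norm ((x : ℂ) + I)
  linarith

theorem norm_add_I_sq (x : ℝ) : ‖(x : ℂ) + I‖ ^ 2 = 1 + x ^ 2 := by
  rw [Complex.sq_norm, normSq_apply]; simp; ring

theorem real_add_I_ne_zero (x : ℝ) : (x : ℂ) + I ≠ 0 := by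
  simpa using real_sub_ne_zero (z := -I) (by simp) x

theorem real_sub_ne {z : ℂ} (hz : 0 < z.im) (x : ℝ) : (x : ℂ) - z ≠ 0 :=
  real_sub_ne_zero hz.ne' x

theorem integrable_div_cube_mul {g : ℝ → ℂ} (hg : Continuous g) {C : ℝ} (hC0 : 0 ≤ C)
    (hC : ∀ x, ‖g x‖ ≤ C * (1 + |x|) ^ 2) {a b : ℂ} (ha : a.im ≠ 0) (hb : b.im ≠ 0) :
    Integrable fun x : ℝ => g x / ((x - a) ^ 3 * (x - b)) := by
  obtain ⟨A, hA0, hA⟩ := exists_one_add_abs_le ha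
  obtain ⟨B, hB0, hB⟩ := exists_one_add_abs_le hb
  refine integrable_of_norm_le_sq (hg.div (by fun_prop) fun x => mul_ne_zero
    (pow_ne_zero _ (real_sub_ne_zero ha x)) (real_sub_ne_zero hb x)).aestronglyMeasurable
    (C * (A ^ 3 * B)) fun x => ?_
  have h1 : 0 < ‖(x : ℂ) - a‖ := norm_pos_iff.2 (real_sub_ne_zero ha x)
  have h2 : 0 < ‖(x : ℂ) - b‖ := norm_pos_iff.2 (real_sub_ne_zero hb x)
  rw [norm_div, norm_mul, norm_pow, div_mul_eq_mul_div, div_le_iff₀ (by positivity)]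
  calc ‖g x‖ * (1 + |x|) ^ 2 ≤ C * (1 + |x|) ^ 2 * (1 + |x|) ^ 2 := by gcongr; exact hC x
    _ = C * ((1 + |x|) ^ 3 * (1 + |x|)) := by ring
    _ ≤ C * ((A * ‖(x : ℂ) - a‖) ^ 3 * (B * ‖(x : ℂ) - b‖)) := by
      gcongr
      · exact hA x
      · exact hB x
    _ = _ := by ring

/-- The integral `∫ u(x) (1/(x - z) - 1/(x + i)) dx`. -/
def herglotzIntegral (u : ℝ → ℝ) (z : ℂ) : ℂ :=
  ∫ x : ℝ, u x * ((z + I) / ((x + I) * (x - z)))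

/-! ### Herglotz integrals of a weight u with u/(1+x²) integrable. -/

section Weighted

variable {u : ℝ → ℝ}

theorem integrable_mul_of_weight (hu : Integrable fun x : ℝ => u x / (1 + x ^ 2)) {k : ℝ → ℂ}
    (hk : Continuous k) {B : ℝ} (hB : ∀ x, ‖k x‖ * (1 + x ^ 2) ≤ B) :
    Integrable fun x : ℝ => (u x : ℂ) * k x := by
  have h : (fun x : ℝ => (u x : ℂ) * k x) =
      fun x : ℝ => ((u x / (1 + x ^ 2) : ℝ) : ℂ) * (k x * (1 + x ^ 2 : ℝ)) := by
    ext x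
    have : (1 + x ^ 2) ≠ 0 := by positivity
    have : (1 + (x : ℂ) ^ 2) ≠ 0 := by exact_mod_cast this
    push_cast
    field_simp
  rw [h]
  refine (hu.ofReal (𝕜 := ℂ)).mul_bdd (c := B)
    (hk.mul (by fun_prop)).aestronglyMeasurable (ae_of_all _ fun x => ?_)
  rw [norm_mul, norm_real, Real.norm_eq_abs, abs_of_pos (by positivity)]
  exact hB x

theorem norm_integral_mul_le_of_weight (hu : Integrable fun x : ℝ => u x / (1 + x ^ 2))
    (hu0 : ∀ x, 0 ≤ u x) {k : ℝ → ℂ} {B : ℝ} (hB : ∀ x, ‖k x‖ * (1 + x ^ 2) ≤ B) :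
    ‖∫ x : ℝ, (u x : ℂ) * k x‖ ≤ B * ∫ x : ℝ, u x / (1 + x ^ 2) := by
  rw [← integral_const_mul]
  refine norm_integral_le_of_norm_le (hu.const_mul B) (ae_of_all _ fun x => ?_)
  rw [norm_mul, norm_real, Real.norm_eq_abs, abs_of_nonneg (hu0 x), mul_div_left_comm]
  gcongr
  · exact hu0 x
  · rw [le_div_iff₀ (by positivity)]; exact hB x

theorem exists_herglotz_kernel_bound {z : ℂ} (hz : 0 < z.im) :
    ∃ B : ℝ, ∀ x : ℝ, ‖(z + I) / (((x : ℂ) + I) * (x - z))‖ * (1 + x ^ 2) ≤ B := by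
  obtain ⟨C, hC0, hC⟩ := exists_one_add_abs_le hz.ne'
  refine ⟨‖z + I‖ * (2 * C), fun x => ?_⟩
  have h1 : 0 < ‖(x : ℂ) - z‖ := norm_pos_iff.2 (real_sub_ne hz x)
  have h2 : 0 < ‖(x : ℂ) + I‖ := norm_pos_iff.2 (real_add_I_ne_zero x)
  rw [norm_div, norm_mul, div_mul_eq_mul_div, div_le_iff₀ (by positivity), mul_assoc]
  gcongr
  calc 1 + x ^ 2 ≤ (1 + |x|) * (1 + |x|) := by nlinarith [abs_nonneg x, sq_abs x]
    _ ≤ (2 * ‖(x : ℂ) + I‖) * (C * ‖(x : ℂ) - z‖) := by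
      gcongr
      · exact one_add_abs_le_two_mul_norm_add_I x
      · exact hC x
    _ = _ := by ring

theorem continuous_herglotz_kernel {z : ℂ} (hz : 0 < z.im) :
    Continuous fun x : ℝ => (z + I) / (((x : ℂ) + I) * (x - z)) :=
  continuous_const.div (by fun_prop) fun x =>
    mul_ne_zero (real_add_I_ne_zero x) (real_sub_ne hz x)

theorem integrable_herglotz (hu : Integrable fun x : ℝ => u x / (1 + x ^ 2)) {z : ℂ}
    (hz : 0 < z.im) :
    Integrable fun x : ℝ => (u x : ℂ) * ((z + I) / ((x + I) * (x - z))) := by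
  obtain ⟨B, hB⟩ := exists_herglotz_kernel_bound hz
  exact integrable_mul_of_weight hu (continuous_herglotz_kernel hz) hB

/-- The kernel is 1/(x-z) - 1/(x+i), and both terms contribute non-negatively to its imaginary part,
which division by πi turns into a real part. -/
theorem re_herglotzIntegral_nonneg (hu : Integrable fun x : ℝ => u x / (1 + x ^ 2))
    (hu0 : ∀ x, 0 ≤ u x) {z : ℂ} (hz : 0 < z.im) :
    0 ≤ (herglotzIntegral u z / (Real.pi * I)).re := by
  have h1 : (herglotzIntegral u z / (Real.pi * I)).re = (herglotzIntegral u z).im / Real.pi := by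
    have : herglotzIntegral u z / (Real.pi * I) = -I * (herglotzIntegral u z / (Real.pi : ℝ)) := by
      have : (Real.pi : ℂ) ≠ 0 := by exact_mod_cast Real.pi_ne_zero
      field_simp
      rw [I_sq]; ring
    rw [this, ← div_ofReal_im]
    simp
  rw [h1]
  refine div_nonneg ?_ Real.pi_pos.le
  have h2 := integral_im (integrable_herglotz hu hz)
  simp only [RCLike.im_eq_complex_im] at h2
  rw [herglotzIntegral, ← h2]
  refine integral_nonneg fun x => ?_
  simp only [Pi.zero_apply]
  rw [im_ofReal_mul]
  refine mul_nonneg (hu0 x) ?_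
  have h3 : (z + I) / (((x : ℂ) + I) * (x - z)) = (x - z)⁻¹ - (x + I)⁻¹ := by
    have := real_add_I_ne_zero x
    have := real_sub_ne hz x
    field_simp
    ring
  rw [h3, sub_im, inv_im, inv_im]
  simp only [sub_im, ofReal_im, add_im, I_im, zero_sub, zero_add, neg_neg]
  have := normSq_nonneg ((x : ℂ) - z)
  have := normSq_nonneg ((x : ℂ) + I)
  have h4 : 0 ≤ z.im / normSq ((x : ℂ) - z) := by positivity
  have h5 : 0 ≤ 1 / normSq ((x : ℂ) + I) := by positivity
  rw [neg_div]
  linarith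

/-- The integral is o(r) along every ray in the upper half-plane, by domination with a multiple of
|u|/(1+x²). Growth along rays therefore reads off the polynomial part of a Herglotz formula. -/
theorem tendsto_herglotzIntegral_div (hu : Integrable fun x : ℝ => u x / (1 + x ^ 2))
    {w : ℂ} (hw : 0 < w.im) :
    Tendsto (fun r : ℝ => herglotzIntegral u (r * w) / r) atTop (𝓝 0) := by
  -- The three terms bound 1, the distance |x - rw| itself, and r|w|, each by a multiple of |x - rw|
  -- ≥ r Im w, uniformly in r ≥ 1.
  set A : ℝ := 1 / w.im + 1 + ‖w‖ / w.im with hA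
  have him : ∀ r : ℝ, (r * w : ℂ).im = r * w.im := fun r => im_ofReal_mul _ _
  have hbase : ∀ r : ℝ, 1 ≤ r → ∀ x : ℝ, r * w.im ≤ ‖(x : ℂ) - r * w‖ := by
    intro r hr x
    have h1 := abs_im_le_norm ((x : ℂ) - r * w)
    simp only [sub_im, ofReal_im, him, zero_sub, abs_neg] at h1
    exact (le_abs_self _).trans h1
  have hest : ∀ r : ℝ, 1 ≤ r → ∀ x : ℝ, 1 + |x| ≤ A * ‖(x : ℂ) - r * w‖ := by
    intro r hr x
    have h1 := hbase r hr x
    have h2 : w.im ≤ ‖(x : ℂ) - r * w‖ := by nlinarith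
    have h3 : |x| ≤ ‖(x : ℂ) - r * w‖ + r * ‖w‖ := by
      have := norm_add_le ((x : ℂ) - r * w) (r * w)
      simp only [sub_add_cancel, norm_real, norm_mul, Real.norm_eq_abs,
        abs_of_pos (by linarith : 0 < r)] at this
      exact this
    have h4 : 1 ≤ 1 / w.im * ‖(x : ℂ) - r * w‖ := by
      rw [one_div, ← div_eq_inv_mul, le_div_iff₀ hw]; linarith
    have h5 : r * ‖w‖ ≤ ‖w‖ / w.im * ‖(x : ℂ) - r * w‖ := by
      rw [div_mul_eq_mul_div, le_div_iff₀ hw]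
      calc r * ‖w‖ * w.im = ‖w‖ * (r * w.im) := by ring
        _ ≤ _ := by gcongr
    rw [hA]; linarith
  have hker : ∀ r : ℝ, 1 ≤ r → ∀ x : ℝ,
      ‖(r * w + I) / (((x : ℂ) + I) * (x - r * w)) / r‖ ≤ (‖w‖ + 1) /
        (‖(x : ℂ) + I‖ * ‖(x : ℂ) - r * w‖) := by
    intro r hr x
    have hr0 : 0 < r := by linarith
    rw [div_right_comm, norm_div, norm_mul]
    gcongr
    rw [norm_div, norm_real, Real.norm_eq_abs, abs_of_pos hr0, div_le_iff₀ hr0]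
    calc ‖r * w + I‖ ≤ ‖r * w‖ + ‖I‖ := norm_add_le _ _
      _ = r * ‖w‖ + 1 := by simp [abs_of_pos hr0]
      _ ≤ _ := by nlinarith
  have heq : ∀ r : ℝ, herglotzIntegral u (r * w) / r =
      ∫ x : ℝ, u x * ((r * w + I) / ((x + I) * (x - r * w)) / r) := by
    intro r
    rw [herglotzIntegral, ← integral_div]
    simp_rw [mul_div_assoc]
  simp_rw [heq]
  have h0 : ∫ x : ℝ, ((0 : ℂ)) = 0 := by simp
  rw [← h0]
  refine tendsto_integral_filter_of_dominated_convergence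
    (fun x => (‖w‖ + 1) * (2 * A) * ‖u x / (1 + x ^ 2)‖) ?_ ?_ (hu.norm.const_mul _) ?_
  · filter_upwards [eventually_ge_atTop 1] with r hr
    have hrw : 0 < (r * w : ℂ).im := by rw [him]; positivity
    have := (integrable_herglotz hu hrw).div_const (r : ℂ)
    simp_rw [mul_div_assoc] at this
    simpa only [mul_div_assoc] using this.aestronglyMeasurable
  · filter_upwards [eventually_ge_atTop 1] with r hr
    refine ae_of_all _ fun x => ?_
    have hrw : 0 < (r * w : ℂ).im := by rw [him]; positivity
    have h1 : 0 < ‖(x : ℂ) - r * w‖ := norm_pos_iff.2 (real_sub_ne hrw x)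
    have h2 : 0 < ‖(x : ℂ) + I‖ := norm_pos_iff.2 (real_add_I_ne_zero x)
    have e : ‖u x / (1 + x ^ 2)‖ = ‖u x‖ / (1 + x ^ 2) := by
      rw [norm_div, Real.norm_eq_abs (1 + x ^ 2), abs_of_pos (by positivity)]
    rw [norm_mul, norm_real, e, mul_div_left_comm]
    refine mul_le_mul_of_nonneg_left ((hker r hr x).trans ?_) (norm_nonneg _)
    rw [div_le_div_iff₀ (by positivity) (by positivity), mul_assoc]
    gcongr
    calc 1 + x ^ 2 ≤ (1 + |x|) * (1 + |x|) := by nlinarith [abs_nonneg x, sq_abs x]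
      _ ≤ (2 * ‖(x : ℂ) + I‖) * (A * ‖(x : ℂ) - r * w‖) := by
        have := hest r hr x
        have := one_add_abs_le_two_mul_norm_add_I x
        gcongr
      _ = _ := by ring
  · refine ae_of_all _ fun x => ?_
    have h2 : 0 < ‖(x : ℂ) + I‖ := norm_pos_iff.2 (real_add_I_ne_zero x)
    have h3 : Tendsto (fun r : ℝ => |u x| * ((‖w‖ + 1) / (‖(x : ℂ) + I‖ * (r * w.im))))
        atTop (𝓝 (|u x| * 0)) :=
      (tendsto_const_nhds.div_atTop
        ((tendsto_id.atTop_mul_const hw).const_mul_atTop h2)).const_mul _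
    rw [mul_zero] at h3
    refine squeeze_zero_norm' ?_ h3
    filter_upwards [eventually_ge_atTop 1] with r hr
    rw [norm_mul, norm_real, Real.norm_eq_abs]
    gcongr
    refine (hker r hr x).trans ?_
    have : 0 < r * w.im := by positivity
    gcongr
    exact hbase r hr x

end Weighted

/-! ### Cauchy formulas for F and its conjugate, and Herglotz up to a quadratic. -/

section Positive

variable {F : ℂ → ℂ} {d : ℝ}

theorem sub_mul_dslope (f : ℂ → ℂ) (a b : ℂ) : f b = f a + (b - a) * dslope f a b := by
  have := sub_smul_dslope f a b
  rw [smul_eq_mul] at this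
  rw [this]; ring

/-- Conjugation produces the integral of F(x)/((x-i)³(x-z̄)), whose only pole in the upper
half-plane is i. Subtracting the second-order Taylor polynomial of F at i removes the pole and
leaves zero integral. The polynomial part, conjugated back, is evaluated by Cauchy's formula at z.
-/
theorem integral_conj_div_cube_eq (hd : 0 < d) (hF : DifferentiableOn ℂ F (aboveLine (-d)))
    (hre : ∀ z ∈ aboveLine (-d), 0 ≤ (F z).re) :
    ∃ a₀ a₁ a₂ : ℂ, ∀ z : ℂ, 0 < z.im →
      ∫ x : ℝ, (starRingEnd ℂ) (F x) / ((x + I) ^ 3 * (x - z)) =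
        2 * Real.pi * I * ((a₀ + a₁ * (z + I) + a₂ * (z + I) ^ 2) / (z + I) ^ 3) := by
  obtain ⟨C, hC0, hC⟩ := exists_norm_le_sq_of_re_nonneg hd hF hre
  set h₁ := dslope F I with hh₁
  set h₂ := dslope h₁ I with hh₂
  set h₃ := dslope h₂ I with hh₃
  have hnb : aboveLine (-d) ∈ 𝓝 I :=
    (isOpen_aboveLine _).mem_nhds (by rw [mem_aboveLine]; simp; linarith)
  have hd₁ : DifferentiableOn ℂ h₁ (aboveLine (-d)) := (differentiableOn_dslope hnb).2 hF
  have hd₂ : DifferentiableOn ℂ h₂ (aboveLine (-d)) := (differentiableOn_dslope hnb).2 hd₁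
  have hd₃ : DifferentiableOn ℂ h₃ (aboveLine (-d)) := (differentiableOn_dslope hnb).2 hd₂
  have hb₁ : PolyBounded h₁ :=
    polyBounded_dslope hd hF (polyBounded_of_re_nonneg hd hF hre) (by simp)
  have hb₂ : PolyBounded h₂ := polyBounded_dslope hd hd₁ hb₁ (by simp)
  have hb₃ : PolyBounded h₃ := polyBounded_dslope hd hd₂ hb₂ (by simp)
  set p : ℂ → ℂ := fun z => F I + h₁ I * (z - I) + h₂ I * (z - I) ^ 2 with hp
  have htaylor : ∀ z, F z = p z + (z - I) ^ 3 * h₃ z := by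
    intro z
    have e1 := sub_mul_dslope F I z
    have e2 := sub_mul_dslope h₁ I z
    have e3 := sub_mul_dslope h₂ I z
    rw [e1, ← hh₁, e2, ← hh₂, e3, ← hh₃]
    simp only [hp]
    ring
  set c := starRingEnd ℂ with hc
  refine ⟨c (F I), c (h₁ I), c (h₂ I), fun z hz => ?_⟩
  have hzc := conj_im_neg hz
  have hcontF := continuous_real_of_differentiableOn hd hF
  have hFbd : ∀ x : ℝ, ‖F x‖ ≤ C * (1 + |x|) ^ 2 := fun x => by simpa using hC x (by simp)
  have hpbd : ∀ x : ℝ, ‖p x‖ ≤ (‖F I‖ + ‖h₁ I‖ + ‖h₂ I‖) * (1 + |x|) ^ 2 := by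
    intro x
    have h1 : ‖(x : ℂ) - I‖ ≤ 1 + |x| := by
      have := norm_sub_le (x : ℂ) I
      simp at this; linarith
    have h2 : (1 : ℝ) ≤ 1 + |x| := by linarith [abs_nonneg x]
    calc ‖p x‖ ≤ ‖F I‖ + ‖h₁ I * (x - I)‖ + ‖h₂ I * (x - I) ^ 2‖ := norm_add₃_le
      _ = ‖F I‖ * 1 + ‖h₁ I‖ * ‖(x : ℂ) - I‖ + ‖h₂ I‖ * ‖(x : ℂ) - I‖ ^ 2 := by simp
      _ ≤ ‖F I‖ * (1 + |x|) ^ 2 + ‖h₁ I‖ * (1 + |x|) ^ 2 + ‖h₂ I‖ * (1 + |x|) ^ 2 := by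
        gcongr
        · exact one_le_pow₀ h2
        · nlinarith
      _ = _ := by ring
  have hcontp : Continuous fun x : ℝ => p x := by simp only [hp]; fun_prop
  have hIne : I.im ≠ 0 := by simp
  have hi1 := integrable_div_cube_mul hcontF hC0 hFbd hIne hzc.ne
  have hi2 := integrable_div_cube_mul hcontp (by positivity) hpbd hIne hzc.ne
  have hfun : ∀ x : ℝ, h₃ x * (x - c z)⁻¹ =
      F x / ((x - I) ^ 3 * (x - c z)) - p x / ((x - I) ^ 3 * (x - c z)) := by
    intro x
    have n1 := real_sub_ne_zero hIne x
    have n2 := real_sub_ne_zero hzc.ne x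
    rw [htaylor]
    field_simp
    ring
  have hd' : 0 < min d z.im := lt_min hd hz
  have h0 := integral_real_eq_zero (h := fun w => h₃ w * (w - c z)⁻¹) hd'
    ((hd₃.mono (aboveLine_anti (neg_le_neg (min_le_left _ _)))).mul
      (differentiableOn_inv_sub (by simp [hc])))
    (hb₃.mul (polyBounded_inv_sub hzc)) (by simp_rw [hfun]; exact hi1.sub hi2)
  simp_rw [hfun] at h0
  rw [integral_sub hi1 hi2, sub_eq_zero] at h0
  have hconj : ∀ g : ℝ → ℂ, ∫ x : ℝ, c (g x) / ((x + I) ^ 3 * (x - z)) =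
      c (∫ x : ℝ, g x / ((x - I) ^ 3 * (x - c z))) := by
    intro g
    rw [hc, ← integral_conj]
    congr 1
    ext x
    simp
  rw [hconj fun x => F x, h0, ← hconj fun x => p x]
  set q : ℂ → ℂ := fun w => c (F I) + c (h₁ I) * (w + I) + c (h₂ I) * (w + I) ^ 2 with hq
  have hpq : ∀ x : ℝ, c (p x) / ((x + I) ^ 3 * (x - z)) = q x * ((x : ℂ) - -I)⁻¹ ^ 3 / (x - z) := by
    intro x
    have n1 := real_add_I_ne_zero x
    have n2 := real_sub_ne hz x
    have e1 : c (p x) = q x := by simp [hp, hq, hc]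
    rw [e1, sub_neg_eq_add]
    field_simp
  have hqbd : PolyBounded q :=
    ((polyBounded_const _).add ((polyBounded_const _).mul
      (polyBounded_id.add (polyBounded_const I)))).add
      ((polyBounded_const _).mul ((polyBounded_id.add (polyBounded_const I)).pow 2))
  have hi3 : Integrable fun x : ℝ => c (p x) / ((x + I) ^ 3 * (x - z)) := by
    have := integrable_div_cube_mul (a := -I) (g := fun x => c (p x))
      (C := ‖F I‖ + ‖h₁ I‖ + ‖h₂ I‖) (continuous_conj.comp hcontp) (by positivity)
      (fun x => by rw [hc, RCLike.norm_conj]; exact hpbd x) (by simp) hz.ne'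
    simpa using this
  have h1 := integral_div_sub_eq (h := fun w => q w * (w - -I)⁻¹ ^ 3) one_pos
    (DifferentiableOn.mul (by simp only [hq]; fun_prop)
      ((differentiableOn_inv_sub (by simp)).pow 3))
    (hqbd.mul ((polyBounded_inv_sub (by simp)).pow 3)) hz (by simp_rw [← hpq]; exact hi3)
  simp_rw [hpq]
  rw [h1]
  simp [hq, div_eq_mul_inv]

/-- F grows at most quadratically, so the cube (x+i)³ makes Cauchy's formula converge. Adding the
formula for F to that for its conjugate leaves only 2 Re F under the integral. With s = z+i and t =
x+i, the identity s³/(t³(t-s)) = s/(t(t-s)) - s/t² - s²/t³ gives the Herglotz kernel and moments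
that multiply s and s². -/
theorem exists_herglotz_quadratic (hd : 0 < d) (hF : DifferentiableOn ℂ F (aboveLine (-d)))
    (hre : ∀ z ∈ aboveLine (-d), 0 ≤ (F z).re) :
    ∃ a₀ a₁ a₂ : ℂ, ∀ z : ℂ, 0 < z.im →
      F z = a₀ + a₁ * (z + I) + a₂ * (z + I) ^ 2 +
        herglotzIntegral (fun x => (F x).re) z / (Real.pi * I) := by
  obtain ⟨C, hC0, hC⟩ := exists_norm_le_sq_of_re_nonneg hd hF hre
  obtain ⟨b₀, b₁, b₂, hb⟩ := integral_conj_div_cube_eq hd hF hre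
  obtain ⟨hu, -⟩ := integrable_re_div_one_add_sq hd hF hre
  have hcontF := continuous_real_of_differentiableOn hd hF
  have hFbd : ∀ x : ℝ, ‖F x‖ ≤ C * (1 + |x|) ^ 2 := fun x => by simpa using hC x (by simp)
  set u : ℝ → ℝ := fun x => (F x).re with hu_def
  set m₂ : ℂ := ∫ x : ℝ, u x * (1 / ((x : ℂ) + I) ^ 2)
  set m₃ : ℂ := ∫ x : ℝ, u x * (1 / ((x : ℂ) + I) ^ 3)
  have hpi : (Real.pi : ℂ) ≠ 0 := by exact_mod_cast Real.pi_ne_zero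
  have hk2 : Integrable fun x : ℝ => (u x : ℂ) * (1 / ((x : ℂ) + I) ^ 2) := by
    refine integrable_mul_of_weight hu (B := 1) (continuous_const.div (by fun_prop) fun x =>
      pow_ne_zero _ (real_add_I_ne_zero x)) fun x => ?_
    rw [norm_div, norm_pow, norm_add_I_sq, norm_one, one_div_mul_cancel (by positivity)]
  have hk3 : Integrable fun x : ℝ => (u x : ℂ) * (1 / ((x : ℂ) + I) ^ 3) := by
    refine integrable_mul_of_weight hu (B := 1) (continuous_const.div (by fun_prop) fun x =>
      pow_ne_zero _ (real_add_I_ne_zero x)) fun x => ?_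
    have h1 : 1 ≤ ‖(x : ℂ) + I‖ := by simpa using abs_im_le_norm ((x : ℂ) + I)
    rw [norm_div, norm_pow, norm_one, ← norm_add_I_sq, div_mul_eq_mul_div, one_mul,
      div_le_one (by positivity)]
    exact pow_le_pow_right₀ h1 (by norm_num)
  refine ⟨-b₀, -b₁ - m₂ / (Real.pi * I), -b₂ - m₃ / (Real.pi * I), fun z hz => ?_⟩
  have hs : z + I ≠ 0 := by
    intro h0
    have : (z + I).im = 0 := by rw [h0]; rfl
    simp at this; linarith
  have hd' : 0 < min d 1 := lt_min hd one_pos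
  have hfun : ∀ x : ℝ, F x * ((x : ℂ) - -I)⁻¹ ^ 3 / (x - z) = F x / ((x + I) ^ 3 * (x - z)) := by
    intro x
    have n1 := real_add_I_ne_zero x
    have n2 := real_sub_ne hz x
    rw [sub_neg_eq_add]
    field_simp
  have hi1 : Integrable fun x : ℝ => F x / (((x : ℂ) + I) ^ 3 * (x - z)) := by
    simpa using integrable_div_cube_mul (a := -I) hcontF hC0 hFbd (by simp) hz.ne'
  have hi2 : Integrable fun x : ℝ =>
      (starRingEnd ℂ) (F x) / (((x : ℂ) + I) ^ 3 * (x - z)) := by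
    simpa using integrable_div_cube_mul (a := -I) (g := fun x => (starRingEnd ℂ) (F x))
      (continuous_conj.comp hcontF) hC0
      (fun x => by rw [RCLike.norm_conj]; exact hFbd x) (by simp) hz.ne'
  have h1 := integral_div_sub_eq (h := fun w => F w * (w - -I)⁻¹ ^ 3) hd'
    ((hF.mono (aboveLine_anti (neg_le_neg (min_le_left _ _)))).mul
      ((differentiableOn_inv_sub (by simp)).pow 3))
    ((polyBounded_of_re_nonneg hd hF hre).mul ((polyBounded_inv_sub (by simp)).pow 3)) hz
    (by simp_rw [hfun]; exact hi1)
  simp_rw [hfun] at h1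
  have h2 := hb z hz
  have h3 : ∀ x : ℝ, (F x / (((x : ℂ) + I) ^ 3 * (x - z)) +
      (starRingEnd ℂ) (F x) / (((x : ℂ) + I) ^ 3 * (x - z))) * ((z + I) ^ 3 / 2) =
      u x * ((z + I) / ((x + I) * (x - z))) - (z + I) * (u x * (1 / ((x : ℂ) + I) ^ 2)) -
      (z + I) ^ 2 * (u x * (1 / ((x : ℂ) + I) ^ 3)) := by
    intro x
    have n1 := real_add_I_ne_zero x
    have n2 := real_sub_ne hz x
    have h4 : F x + (starRingEnd ℂ) (F x) = 2 * (u x : ℂ) := by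
      rw [Complex.add_conj]; push_cast; ring
    rw [← add_div, h4]
    field_simp
    ring
  have h5 : ((∫ x : ℝ, F x / (((x : ℂ) + I) ^ 3 * (x - z))) +
      ∫ x : ℝ, (starRingEnd ℂ) (F x) / (((x : ℂ) + I) ^ 3 * (x - z))) * ((z + I) ^ 3 / 2) =
      herglotzIntegral u z - (z + I) * m₂ - (z + I) ^ 2 * m₃ := by
    rw [← integral_add hi1 hi2, ← integral_mul_const]
    simp_rw [h3]
    have i1 : Integrable fun x : ℝ => (u x : ℂ) * ((z + I) / ((x + I) * (x - z))) -
      (z + I) * (u x * (1 / ((x : ℂ) + I) ^ 2)) :=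
      (integrable_herglotz hu hz).sub (hk2.const_mul _)
    rw [integral_sub i1 (hk3.const_mul _),
      integral_sub (integrable_herglotz hu hz) (hk2.const_mul _), integral_const_mul,
      integral_const_mul]
    rfl
  rw [h1, h2, sub_neg_eq_add] at h5
  have h6 : herglotzIntegral u z = Real.pi * I * (F z + (b₀ + b₁ * (z + I) + b₂ * (z + I) ^ 2)) +
      (z + I) * m₂ + (z + I) ^ 2 * m₃ := by
    have h7 : (2 * (Real.pi : ℂ) * I * (F z * (z + I)⁻¹ ^ 3) +
      2 * Real.pi * I * ((b₀ + b₁ * (z + I) + b₂ * (z + I) ^ 2) / (z + I) ^ 3)) *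
      ((z + I) ^ 3 / 2) =
        Real.pi * I * (F z + (b₀ + b₁ * (z + I) + b₂ * (z + I) ^ 2)) := by
      field_simp
    rw [h7] at h5
    linear_combination -h5
  rw [h6]
  field_simp
  ring

end Positive

/-! ### The polynomial part of the Herglotz formula. -/

section Positive

variable {F : ℂ → ℂ} {d : ℝ}

theorem tendsto_quadratic_div {a₀ a₁ a₂ : ℂ} {u : ℝ → ℝ}
    (hu : Integrable fun x : ℝ => u x / (1 + x ^ 2))
    (hF : ∀ z : ℂ, 0 < z.im → F z = a₀ + a₁ * (z + I) + a₂ * (z + I) ^ 2 +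
        herglotzIntegral u z / (Real.pi * I)) {w : ℂ} (hw : 0 < w.im) :
    Tendsto (fun r : ℝ => F (r * w) / (r : ℂ) ^ 2) atTop (𝓝 (a₂ * w ^ 2)) := by
  have hS := tendsto_herglotzIntegral_div hu hw
  have he : Tendsto (fun r : ℝ => ((r : ℂ))⁻¹) atTop (𝓝 0) := by
    have := (Complex.continuous_ofReal.tendsto 0).comp tendsto_inv_atTop_zero
    simpa [Function.comp_def] using this
  have hc : Continuous fun p : ℂ × ℂ => a₀ * p.1 ^ 2 + a₁ * (w + I * p.1) * p.1 +
      a₂ * (w + I * p.1) ^ 2 + p.2 / (Real.pi * I) * p.1 := by fun_prop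
  have h1 := (hc.tendsto (0, 0)).comp (he.prodMk_nhds hS)
  simp only [mul_zero, add_zero, zero_add, ne_eq, OfNat.ofNat_ne_zero, not_false_eq_true, zero_pow]
    at h1
  refine h1.congr' ?_
  filter_upwards [eventually_gt_atTop 0] with r hr
  have hr' : (r : ℂ) ≠ 0 := by exact_mod_cast hr.ne'
  have hpi : (Real.pi : ℂ) ≠ 0 := by exact_mod_cast Real.pi_ne_zero
  simp only [Function.comp_apply]
  rw [hF _ (by rw [im_ofReal_mul]; positivity)]
  field_simp

theorem tendsto_linear_div {a₀ a₁ : ℂ} {u : ℝ → ℝ}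
    (hu : Integrable fun x : ℝ => u x / (1 + x ^ 2))
    (hF : ∀ z : ℂ, 0 < z.im → F z = a₀ + a₁ * (z + I) +
        herglotzIntegral u z / (Real.pi * I)) {w : ℂ} (hw : 0 < w.im) :
    Tendsto (fun r : ℝ => F (r * w) / (r : ℂ)) atTop (𝓝 (a₁ * w)) := by
  have hS := tendsto_herglotzIntegral_div hu hw
  have he : Tendsto (fun r : ℝ => ((r : ℂ))⁻¹) atTop (𝓝 0) := by
    have := (Complex.continuous_ofReal.tendsto 0).comp tendsto_inv_atTop_zero
    simpa [Function.comp_def] using this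
  have hc : Continuous fun p : ℂ × ℂ => a₀ * p.1 + a₁ * (w + I * p.1) +
      p.2 / (Real.pi * I) := by fun_prop
  have h1 := (hc.tendsto (0, 0)).comp (he.prodMk_nhds hS)
  simp only [mul_zero, add_zero, zero_add, zero_div] at h1
  refine h1.congr' ?_
  filter_upwards [eventually_gt_atTop 0] with r hr
  have hr' : (r : ℂ) ≠ 0 := by exact_mod_cast hr.ne'
  have hpi : (Real.pi : ℂ) ≠ 0 := by exact_mod_cast Real.pi_ne_zero
  simp only [Function.comp_apply]
  rw [hF _ (by rw [im_ofReal_mul]; positivity)]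
  field_simp

/-- The Herglotz representation of a function with non-negative real part, analytic in a
neighbourhood of the closed upper half-plane. -/
theorem exists_herglotz (hd : 0 < d) (hF : DifferentiableOn ℂ F (aboveLine (-d)))
    (hre : ∀ z ∈ aboveLine (-d), 0 ≤ (F z).re) :
    ∃ (b : ℝ) (k : ℂ), 0 ≤ b ∧ b ≤ ‖F I‖ ∧ ‖k‖ ≤ 5 * ‖F I‖ ∧ ∀ z : ℂ, 0 < z.im →
      F z = k - I * b * (z + I) + herglotzIntegral (fun x => (F x).re) z / (Real.pi * I) := by
  obtain ⟨a₀, a₁, a₂, ha⟩ := exists_herglotz_quadratic hd hF hre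
  obtain ⟨hu, hule⟩ := integrable_re_div_one_add_sq hd hF hre
  have hUd : upperHalf ⊆ aboveLine (-d) := by
    rw [upperHalf_eq_aboveLine]; exact aboveLine_anti (by linarith)
  have hrmem : ∀ (w : ℂ), 0 < w.im → ∀ r : ℝ, 0 < r → (r * w : ℂ) ∈ aboveLine (-d) :=
    fun w hw r hr => hUd (by change 0 < (r * w : ℂ).im; rw [im_ofReal_mul]; positivity)
  have h2 : ∀ w : ℂ, 0 < w.im → 0 ≤ (a₂ * w ^ 2).re := by
    intro w hw
    refine ge_of_tendsto ((continuous_re.tendsto _).comp (tendsto_quadratic_div hu ha hw)) ?_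
    filter_upwards [eventually_gt_atTop 0] with r hr
    simp only [Function.comp_apply]
    rw [← ofReal_pow, div_ofReal_re]
    exact div_nonneg (hre _ (hrmem w hw r hr)) (by positivity)
  -- The squares of the four test points are -1, 2i, -2i and 3+4i; non-negativity of Re(a₂w²) at all
  -- of them leaves only zero.
  have ha2 : a₂ = 0 := by
    have e1 := h2 I (by simp)
    have e2 := h2 (1 + I) (by simp)
    have e3 := h2 (-1 + I) (by simp)
    have e4 := h2 (2 + I) (by simp)
    simp [pow_two] at e1 e2 e3 e4
    apply Complex.ext <;> simp <;> linarith
  subst ha2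
  have ha' : ∀ z : ℂ, 0 < z.im → F z = a₀ + a₁ * (z + I) +
      herglotzIntegral (fun x => (F x).re) z / (Real.pi * I) := fun z hz => by
    rw [ha z hz]; ring
  have h1 : ∀ w : ℂ, 0 < w.im → 0 ≤ (a₁ * w).re := by
    intro w hw
    refine ge_of_tendsto ((continuous_re.tendsto _).comp (tendsto_linear_div hu ha' hw)) ?_
    filter_upwards [eventually_gt_atTop 0] with r hr
    simp only [Function.comp_apply]
    rw [div_ofReal_re]
    exact div_nonneg (hre _ (hrmem w hw r hr)) hr.le
  have hb0 : a₁.im ≤ 0 := by simpa using h1 I (by simp)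
  -- Otherwise the test point (Im a₁ - 1)/Re a₁ + i would give Re(a₁w) = -1.
  have hbre : a₁.re = 0 := by
    by_contra hne
    have e1 := h1 (((a₁.im - 1) / a₁.re : ℝ) + I) (by simp)
    rw [mul_re] at e1
    simp only [add_re, ofReal_re, I_re, add_im, ofReal_im, I_im, zero_add, add_zero] at e1
    rw [mul_div_cancel₀ _ hne] at e1
    linarith
  have hbeq : a₁ = -I * ((-a₁.im : ℝ) : ℂ) := by
    apply Complex.ext <;> simp [hbre]
  -- Carathéodory between i and ri gives |F(ri)|/r ≤ |F(i)|(1+1/r)², and the left side tends to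
  -- |a₁|.
  have hnorm : ‖a₁‖ ≤ ‖F I‖ := by
    have hlim := (tendsto_linear_div hu ha' (w := I) (by simp)).norm
    have hlim2 : Tendsto (fun r : ℝ => ‖F I‖ * (1 + r⁻¹) ^ 2) atTop (𝓝 (‖F I‖ * (1 + 0) ^ 2)) :=
      ((tendsto_inv_atTop_zero.const_add 1).pow 2).const_mul _
    rw [norm_mul, norm_I, mul_one] at hlim
    simp only [add_zero, one_pow, mul_one] at hlim2
    refine le_of_tendsto_of_tendsto hlim hlim2 ?_
    filter_upwards [eventually_gt_atTop 0] with r hr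
    have h3 := norm_le_of_re_nonneg (hF.mono hUd) (fun z hz => hre z (hUd hz)) one_pos
      (z := r * I) (by simpa using hr)
    simp only [ofReal_one, mul_one, mul_im, ofReal_re, I_im, ofReal_im, I_re, mul_zero, add_zero,
      one_mul] at h3
    have h4 : ‖(r : ℂ) * I + I‖ = r + 1 := by
      have : (r : ℂ) * I + I = ((r + 1 : ℝ) : ℂ) * I := by push_cast; ring
      rw [this, norm_mul, norm_I, mul_one, norm_real, Real.norm_eq_abs, abs_of_pos (by positivity)]
    rw [h4] at h3
    rw [norm_div, norm_real, Real.norm_eq_abs, abs_of_pos hr, div_le_iff₀ hr]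
    refine h3.trans (le_of_eq ?_)
    field_simp
  have hble : -a₁.im ≤ ‖F I‖ := by
    have := (neg_le_abs _).trans (abs_im_le_norm a₁)
    linarith
  refine ⟨-a₁.im, a₀, by linarith, hble, ?_, fun z hz => ?_⟩
  -- Solving the representation at z = i for the constant: F(i) costs 1, the linear term at 2i costs
  -- 2, and the Herglotz integral, by the Poisson bound, costs 2; together 5.
  · have hS : ‖herglotzIntegral (fun x => (F x).re) I‖ ≤ 2 * (Real.pi * (F I).re) := by
      refine (norm_integral_mul_le_of_weight hu (B := 2)
        (fun x => hre x (by simpa [mem_aboveLine] using hd)) fun x => ?_).trans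
        (mul_le_mul_of_nonneg_left hule (by norm_num))
      have e1 : ‖I + I‖ = 2 := by rw [← two_mul]; simp
      have e2 : ‖(x : ℂ) - I‖ = ‖(x : ℂ) + I‖ := by
        have : (x : ℂ) - I = (starRingEnd ℂ) (x + I) := by simp [sub_eq_add_neg]
        rw [this, RCLike.norm_conj]
      rw [norm_div, norm_mul, e1, e2, ← pow_two, norm_add_I_sq, div_mul_cancel₀]
      positivity
    have e3 := ha' I (by simp)
    have e4 : a₀ = F I - a₁ * (I + I) - herglotzIntegral (fun x => (F x).re) I / (Real.pi * I) := by
      linear_combination -e3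
    rw [e4]
    have e5 : ‖herglotzIntegral (fun x => (F x).re) I / (Real.pi * I)‖ ≤ 2 * ‖F I‖ := by
      rw [norm_div, norm_mul, norm_I, mul_one, norm_real, Real.norm_eq_abs,
        abs_of_pos Real.pi_pos, div_le_iff₀ Real.pi_pos]
      refine hS.trans ?_
      have := re_le_norm (F I)
      have := Real.pi_pos
      nlinarith
    have e6 : ‖a₁ * (I + I)‖ ≤ 2 * ‖F I‖ := by
      have e1 : ‖I + I‖ = 2 := by rw [← two_mul]; simp
      rw [norm_mul, e1]; linarith
    calc _ ≤ ‖F I‖ + ‖a₁ * (I + I)‖ +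
          ‖herglotzIntegral (fun x => (F x).re) I / (Real.pi * I)‖ :=
          (norm_sub_le _ _).trans (add_le_add (norm_sub_le _ _) le_rfl)
      _ ≤ _ := by linarith
  · rw [ha' z hz]
    conv_lhs => rw [hbeq]
    ring

end Positive

/-! ### The Laplace transform -/

/-- The Fourier-Laplace transform `∫₀^∞ f(t) exp (i z t) dt`. -/
def laplace (f : ℝ → ℂ) (z : ℂ) : ℂ := ∫ t in Ioi (0 : ℝ), f t * cexp (I * z * t)

theorem norm_cexp_I_mul (z : ℂ) (t : ℝ) : ‖cexp (I * z * t)‖ = Real.exp (-z.im * t) := by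
  simp [Complex.norm_exp]

theorem integral_cexp_I_mul {z : ℂ} (hz : 0 < z.im) :
    ∫ t in Ioi (0 : ℝ), cexp (I * z * t) = I / z := by
  have hz0 : z ≠ 0 := by rintro rfl; simp at hz
  rw [integral_exp_mul_complex_Ioi (by simpa using hz)]
  simp
  field_simp
  simp

theorem integrable_cexp_I_mul {z : ℂ} (hz : 0 < z.im) :
    IntegrableOn (fun t : ℝ => cexp (I * z * t)) (Ioi 0) :=
  integrableOn_exp_mul_complex_Ioi (by simpa using hz) 0

theorem integrable_pow_mul_exp_neg {y : ℝ} (hy : 0 < y) (k : ℕ) :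
    IntegrableOn (fun t : ℝ => (1 + |t|) ^ k * Real.exp (-y * t)) (Ioi 0) := by
  have h1 : ∀ n : ℕ, IntegrableOn (fun t : ℝ => t ^ n * Real.exp (-y * t)) (Ioi 0) := by
    intro n
    have := integrableOn_rpow_mul_exp_neg_mul_rpow (s := n) (p := 1)
      (by have : (0:ℝ) ≤ n := by positivity
          linarith) one_pos hy
    simpa using this
  have h2 : IntegrableOn (fun t : ℝ => ∑ j ∈ Finset.range (k + 1),
      (t ^ j * Real.exp (-y * t)) * (k.choose j : ℝ)) (Ioi 0) :=
    integrable_finsetSum _ fun j _ => (h1 j).mul_const _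
  refine h2.congr_fun (fun t ht => ?_) measurableSet_Ioi
  simp only
  rw [abs_of_pos ht, add_comm (1 : ℝ), add_pow, Finset.sum_mul]
  refine Finset.sum_congr rfl fun j _ => ?_
  simp; ring

theorem integral_mul_cexp_I_mul {z : ℂ} (hz : 0 < z.im) :
    ∫ t in Ioi (0 : ℝ), t * cexp (I * z * t) = -1 / z ^ 2 := by
  have hz0 : z ≠ 0 := by rintro rfl; simp at hz
  have hexp : ∀ t : ℝ, HasDerivAt (fun s : ℝ => cexp (I * z * s)) (cexp (I * z * t) * (I * z)) t := by
    intro t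
    have h0 : HasDerivAt (fun s : ℝ => I * z * (s : ℂ)) (I * z * 1) t :=
      (Complex.ofRealCLM.hasDerivAt (x := t)).const_mul (I * z)
    simpa using h0.cexp
  have hder : ∀ t : ℝ, HasDerivAt
      (fun s : ℝ => s * cexp (I * z * s) / (I * z) - cexp (I * z * s) / (I * z) ^ 2)
      (t * cexp (I * z * t)) t := by
    intro t
    have h1 := (((Complex.ofRealCLM.hasDerivAt (x := t)).mul (hexp t)).div_const (I * z)).sub
      ((hexp t).div_const ((I * z) ^ 2))
    refine h1.congr_deriv ?_
    have : I * z ≠ 0 := mul_ne_zero I_ne_zero hz0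
    simp
    field_simp
    ring
  have hint : IntegrableOn (fun t : ℝ => t * cexp (I * z * t)) (Ioi 0) := by
    refine (integrable_pow_mul_exp_neg hz 1).mono'
      (by fun_prop : Continuous fun t : ℝ => t * cexp (I * z * t)).aestronglyMeasurable
      (ae_of_all _ fun t => ?_)
    rw [norm_mul, norm_cexp_I_mul, norm_real, Real.norm_eq_abs, pow_one]
    gcongr
    linarith
  have hl1 : Tendsto (fun t : ℝ => t * cexp (I * z * t)) atTop (𝓝 0) := by
    rw [tendsto_zero_iff_norm_tendsto_zero]
    refine (tendsto_rpow_mul_exp_neg_mul_atTop_nhds_zero 1 z.im hz).congr' ?_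
    filter_upwards [eventually_gt_atTop 0] with t ht
    rw [norm_mul, norm_cexp_I_mul, norm_real, Real.norm_eq_abs, abs_of_pos ht, Real.rpow_one]
  have hl2 : Tendsto (fun t : ℝ => cexp (I * z * t)) atTop (𝓝 0) := by
    rw [tendsto_zero_iff_norm_tendsto_zero]
    refine (tendsto_rpow_mul_exp_neg_mul_atTop_nhds_zero 0 z.im hz).congr fun t => ?_
    rw [norm_cexp_I_mul, Real.rpow_zero, one_mul]
  have hl := (hl1.div_const (I * z)).sub (hl2.div_const ((I * z) ^ 2))
  rw [integral_Ioi_of_hasDerivAt_of_tendsto (hder 0).continuousAt.continuousWithinAt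
    (fun t _ => hder t) hint hl]
  simp [mul_pow]
  field_simp

/-- The density whose Laplace transform is the Herglotz integral of `u`, divided by
`-(z + i)²`. -/
def herglotzDensity (u : ℝ → ℝ) (t : ℝ) : ℂ :=
  ∫ x : ℝ, u x * ((cexp (-(I * x * t)) - Real.exp (-t)) / ((x : ℂ) + I) ^ 2)

/-! ### The transform of the Herglotz density. -/

section Weighted

variable {u : ℝ → ℝ}

theorem norm_exp_sub_exp_le (x : ℝ) {t : ℝ} (ht : 0 ≤ t) :
    ‖cexp (-(I * x * t)) - Real.exp (-t)‖ ≤ 2 := by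
  refine (norm_sub_le _ _).trans ?_
  have h1 : ‖cexp (-(I * x * t))‖ = 1 := by simp [Complex.norm_exp]
  have h2 : ‖((Real.exp (-t) : ℝ) : ℂ)‖ ≤ 1 := by
    rw [norm_real, Real.norm_eq_abs, abs_of_pos (Real.exp_pos _)]
    exact Real.exp_le_one_iff.2 (by linarith)
  linarith

theorem norm_herglotzDensity_kernel_le (x : ℝ) {t : ℝ} (ht : 0 ≤ t) :
    ‖(cexp (-(I * x * t)) - Real.exp (-t)) / ((x : ℂ) + I) ^ 2‖ * (1 + x ^ 2) ≤ 2 := by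
  rw [norm_div, norm_pow, norm_add_I_sq, div_mul_cancel₀ _ (by positivity)]
  exact norm_exp_sub_exp_le x ht

theorem norm_herglotzDensity_le (hu : Integrable fun x : ℝ => u x / (1 + x ^ 2))
    (hu0 : ∀ x, 0 ≤ u x) {t : ℝ} (ht : 0 ≤ t) :
    ‖herglotzDensity u t‖ ≤ 2 * ∫ x : ℝ, u x / (1 + x ^ 2) :=
  norm_integral_mul_le_of_weight hu hu0 fun x => norm_herglotzDensity_kernel_le x ht

/-- The kernel is bounded only for t ≥ 0. Since the density vanishes at 0, composing with `max t 0`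
is the continuous extension by zero. -/
theorem continuous_herglotzDensity_max (hu : Integrable fun x : ℝ => u x / (1 + x ^ 2)) :
    Continuous fun t : ℝ => herglotzDensity u (max t 0) := by
  refine continuous_of_dominated (bound := fun x => 2 * ‖u x / (1 + x ^ 2)‖) (fun t => ?_)
    (fun t => ae_of_all _ fun x => ?_) (hu.norm.const_mul 2) (ae_of_all _ fun x => ?_)
  · refine (integrable_mul_of_weight hu (B := 2) ?_ fun x =>
      norm_herglotzDensity_kernel_le x (le_max_right t 0)).aestronglyMeasurable
    exact Continuous.div (by fun_prop) (by fun_prop) fun x => pow_ne_zero _ (real_add_I_ne_zero x)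
  · have h1 := norm_herglotzDensity_kernel_le x (le_max_right t 0)
    have e : ‖u x / (1 + x ^ 2)‖ = ‖u x‖ / (1 + x ^ 2) := by
      rw [norm_div, Real.norm_eq_abs (1 + x ^ 2), abs_of_pos (by positivity)]
    rw [norm_mul, norm_real, e, mul_div_left_comm]
    gcongr
    rwa [le_div_iff₀ (by positivity)]
  · fun_prop

/-- The two exponentials transform into i/(z-x) and i/(z+i). Their difference gains a factor x+i,
which cancels one power of the denominator; the subtracted e^{-t} is also what makes the density
vanish at t = 0. -/
theorem laplace_kernel (x : ℝ) {z : ℂ} (hz : 0 < z.im) :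
    ∫ t in Ioi (0 : ℝ), (cexp (-(I * x * t)) - Real.exp (-t)) / ((x : ℂ) + I) ^ 2 *
      cexp (I * z * t) = -I / (z + I) ^ 2 * ((z + I) / ((x + I) * (x - z))) := by
  have e : ∀ t : ℝ, (cexp (-(I * x * t)) - Real.exp (-t)) / ((x : ℂ) + I) ^ 2 *
      cexp (I * z * t) = (1 / ((x : ℂ) + I) ^ 2) *
        (cexp (I * (z - x) * t) - cexp (I * (z + I) * t)) := by
    intro t
    have h1 : cexp (I * (z - x) * t) = cexp (-(I * x * t)) * cexp (I * z * t) := by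
      rw [← Complex.exp_add]; ring_nf
    have h2 : cexp (I * (z + I) * t) = Real.exp (-t) * cexp (I * z * t) := by
      rw [ofReal_exp, ← Complex.exp_add]
      congr 1
      push_cast
      linear_combination (t : ℂ) * I_mul_I
    rw [h1, h2]
    ring
  have z1 : 0 < (z - (x : ℂ)).im := by simpa using hz
  have z2 : 0 < (z + I).im := by simp; linarith
  simp_rw [e]
  rw [integral_const_mul, integral_sub (integrable_cexp_I_mul z1) (integrable_cexp_I_mul z2),
    integral_cexp_I_mul z1, integral_cexp_I_mul z2]
  have n1 := real_add_I_ne_zero x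
  have n2 := real_sub_ne hz x
  have n3 : z - x ≠ 0 := fun h => n2 (by linear_combination -h)
  have n4 : z + I ≠ 0 := fun h => by rw [h] at z2; simp at z2
  field_simp
  ring

theorem laplace_herglotzDensity (hu : Integrable fun x : ℝ => u x / (1 + x ^ 2))
    (hum : Continuous u) {z : ℂ} (hz : 0 < z.im) :
    laplace (herglotzDensity u) z = -I / (z + I) ^ 2 * herglotzIntegral u z := by
  have hI : Integrable (Function.uncurry fun (t x : ℝ) =>
      u x * ((cexp (-(I * x * t)) - Real.exp (-t)) / ((x : ℂ) + I) ^ 2) * cexp (I * z * t))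
      ((volume.restrict (Ioi 0)).prod volume) := by
    have h1 := Integrable.mul_prod (exp_neg_integrableOn_Ioi 0 hz) hu.norm
    refine (h1.const_mul 2).mono' ?_ ?_
    · refine Continuous.aestronglyMeasurable ?_
      simp only [Function.uncurry_def]
      refine Continuous.mul (Continuous.mul (by fun_prop) (Continuous.div (by fun_prop)
        (by fun_prop) fun p => pow_ne_zero _ (real_add_I_ne_zero p.2))) (by fun_prop)
    · have h2 : ∀ᵐ p : ℝ × ℝ ∂((volume.restrict (Ioi 0)).prod volume), p.1 ∈ Ioi (0 : ℝ) :=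
        Measure.quasiMeasurePreserving_fst.ae (ae_restrict_mem measurableSet_Ioi)
      filter_upwards [h2] with p hp
      have h3 := norm_herglotzDensity_kernel_le p.2 (le_of_lt hp)
      have e : ‖u p.2 / (1 + p.2 ^ 2)‖ = ‖u p.2‖ / (1 + p.2 ^ 2) := by
        rw [norm_div, Real.norm_eq_abs (1 + p.2 ^ 2), abs_of_pos (by positivity)]
      simp only [Function.uncurry_def]
      rw [norm_mul, norm_cexp_I_mul, norm_mul, norm_real, e]
      rw [← le_div_iff₀ (by positivity)] at h3
      calc _ ≤ ‖u p.2‖ * (2 / (1 + p.2 ^ 2)) * Real.exp (-z.im * p.1) := by gcongr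
        _ = _ := by ring
  have h1 : laplace (herglotzDensity u) z = ∫ t in Ioi (0 : ℝ), ∫ x : ℝ,
      u x * ((cexp (-(I * x * t)) - Real.exp (-t)) / ((x : ℂ) + I) ^ 2) * cexp (I * z * t) := by
    rw [laplace]
    simp_rw [herglotzDensity, ← integral_mul_const]
  rw [h1, integral_integral_swap hI, herglotzIntegral, ← integral_const_mul]
  congr 1
  ext x
  simp_rw [mul_assoc (u x : ℂ)]
  rw [integral_const_mul, laplace_kernel x hz]
  ring

end Weighted

section Positive

variable {F : ℂ → ℂ} {d : ℝ}

/-- A function with non-negative real part, analytic in a neighbourhood of the closed upper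
half-plane, is the sum of a linear term and of `-(z + i)²` times a Laplace transform. -/
theorem exists_laplace_of_re_nonneg (hd : 0 < d) (hF : DifferentiableOn ℂ F (aboveLine (-d)))
    (hre : ∀ z ∈ aboveLine (-d), 0 ≤ (F z).re) :
    ∃ (b k : ℝ) (g : ℝ → ℂ), 0 ≤ b ∧ Continuous g ∧ (∀ t ≤ 0, g t = 0) ∧
      (∀ t, ‖g t‖ ≤ 7 * ‖F I‖ * (1 + |t|)) ∧
      ∀ z : ℂ, 0 < z.im → F z = -I * b * (z + I) - (z + I) ^ 2 * laplace g z ∧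
        k ≤ (F z + I * b * z).re := by
  obtain ⟨b, k, hb0, hb, hk, hrep⟩ := exists_herglotz hd hF hre
  obtain ⟨hu, hule⟩ := integrable_re_div_one_add_sq hd hF hre
  set u : ℝ → ℝ := fun x => (F x).re with hu_def
  have hu0 : ∀ x, 0 ≤ u x := fun x => hre x (by simpa [mem_aboveLine] using hd)
  have hum : Continuous u := continuous_re.comp (continuous_real_of_differentiableOn hd hF)
  have hpi : (Real.pi : ℂ) ≠ 0 := by exact_mod_cast Real.pi_ne_zero
  -- The transform of t e^{-t} is -1/(z+i)², so the first summand produces the constant k and the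
  -- second the Herglotz integral. Their bounds 5 and 2 add up to the 7 in the growth estimate.
  set g : ℝ → ℂ := fun t => k * ((max t 0 : ℝ) * Real.exp (-max t 0)) -
    1 / Real.pi * herglotzDensity u (max t 0) with hg
  have hgpos : ∀ t ∈ Ioi (0 : ℝ), g t = k * (t * Real.exp (-t)) -
      1 / Real.pi * herglotzDensity u t := fun t ht => by
    simp only [hg, max_eq_left (le_of_lt (mem_Ioi.1 ht))]
  have hcD := continuous_herglotzDensity_max hu
  refine ⟨b, (k + b).re, g, hb0, by simp only [hg]; fun_prop, fun t ht => ?_, fun t => ?_,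
    fun z hz => ⟨?_, ?_⟩⟩
  · simp [hg, max_eq_right ht, herglotzDensity]
  · have h1 : 0 ≤ max t 0 := le_max_right _ _
    have h2 := (norm_herglotzDensity_le hu hu0 h1).trans
      (mul_le_mul_of_nonneg_left hule zero_le_two)
    have h3 : max t 0 ≤ |t| := max_le (le_abs_self t) (abs_nonneg t)
    have h4 : ‖(1 / Real.pi : ℂ) * herglotzDensity u (max t 0)‖ ≤ 2 * ‖F I‖ := by
      rw [norm_mul, norm_div, norm_one, norm_real, Real.norm_eq_abs, abs_of_pos Real.pi_pos,
        one_div, ← div_eq_inv_mul, div_le_iff₀ Real.pi_pos]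
      have := re_le_norm (F I)
      have := Real.pi_pos
      nlinarith
    have h5 : ‖k * ((max t 0 : ℝ) * Real.exp (-max t 0))‖ ≤ 5 * ‖F I‖ * |t| := by
      rw [norm_mul, norm_mul, norm_real, norm_real, Real.norm_eq_abs, Real.norm_eq_abs,
        abs_of_nonneg h1, abs_of_pos (Real.exp_pos _)]
      have : Real.exp (-max t 0) ≤ 1 := Real.exp_le_one_iff.2 (by linarith)
      calc ‖k‖ * (max t 0 * Real.exp (-max t 0)) ≤ (5 * ‖F I‖) * (|t| * 1) := by gcongr
        _ = _ := by ring
    refine (norm_sub_le _ _).trans ((add_le_add h5 h4).trans ?_)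
    nlinarith [norm_nonneg (F I), abs_nonneg t, mul_nonneg (norm_nonneg (F I)) (abs_nonneg t)]
  · have z2 : 0 < (z + I).im := by simp; linarith
    have n4 : z + I ≠ 0 := fun h => by rw [h] at z2; simp at z2
    have hexp : ∀ t : ℝ, (t : ℂ) * Real.exp (-t) * cexp (I * z * t) =
        t * cexp (I * (z + I) * t) := by
      intro t
      rw [mul_assoc, ofReal_exp, ← Complex.exp_add]
      congr 2
      push_cast
      linear_combination -(t : ℂ) * I_mul_I
    have hi1 : IntegrableOn (fun t : ℝ => t * cexp (I * (z + I) * t)) (Ioi 0) := by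
      refine (integrable_pow_mul_exp_neg z2 1).mono'
        (by fun_prop : Continuous fun t : ℝ => t * cexp (I * (z + I) * t)).aestronglyMeasurable
        (ae_of_all _ fun t => ?_)
      rw [norm_mul, norm_cexp_I_mul, norm_real, Real.norm_eq_abs, pow_one]
      gcongr
      linarith
    have hi2 : IntegrableOn (fun t : ℝ => herglotzDensity u t * cexp (I * z * t)) (Ioi 0) := by
      have hi3 : IntegrableOn (fun t : ℝ => herglotzDensity u (max t 0) * cexp (I * z * t))
          (Ioi 0) := by
        refine ((exp_neg_integrableOn_Ioi 0 hz).const_mul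
          (2 * ∫ x : ℝ, u x / (1 + x ^ 2))).mono'
          (hcD.mul (by fun_prop)).aestronglyMeasurable (ae_of_all _ fun t => ?_)
        rw [norm_mul, norm_cexp_I_mul]
        gcongr
        exact norm_herglotzDensity_le hu hu0 (le_max_right _ _)
      refine hi3.congr_fun (fun t ht => ?_) measurableSet_Ioi
      simp only [max_eq_left (le_of_lt (mem_Ioi.1 ht))]
    have hL : laplace g z = k * (-1 / (z + I) ^ 2) -
        1 / Real.pi * laplace (herglotzDensity u) z := by
      rw [← integral_mul_cexp_I_mul z2, laplace, laplace, ← integral_const_mul,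
        ← integral_const_mul, ← integral_sub (hi1.const_mul _) (hi2.const_mul _)]
      refine setIntegral_congr_fun measurableSet_Ioi fun t ht => ?_
      rw [hgpos t ht, ← hexp]
      ring
    rw [hL, laplace_herglotzDensity hu hum hz, hrep z hz]
    field_simp
    linear_combination herglotzIntegral u z * I_mul_I
  -- Since -ib(z+i) = -ibz + b, removing the linear term leaves k + b plus a Herglotz term of
  -- non-negative real part.
  · rw [hrep z hz]
    have h1 := re_herglotzIntegral_nonneg hu hu0 hz
    have h2 : k - I * b * (z + I) + herglotzIntegral u z / (Real.pi * I) + I * b * z =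
        (k + b) + herglotzIntegral u z / (Real.pi * I) := by
      linear_combination -(b : ℂ) * I_mul_I
    rw [h2, add_re (k + b)]
    linarith

end Positive

/-! ### Uniqueness of Laplace transforms -/

/-- On the line Im z = c the transform is, up to scaling, the Fourier transform of h(t) e^{-ct} on t
> 0; Fourier inversion applies at points of continuity. -/
theorem laplace_injective {h : ℝ → ℂ} {c : ℝ}
    (hi : IntegrableOn (fun t : ℝ => h t * Real.exp (-c * t)) (Ioi 0))
    (h0 : ∀ x : ℝ, laplace h (x + I * c) = 0) {t : ℝ} (ht : 0 < t) (hc : ContinuousAt h t) :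
    h t = 0 := by
  set k : ℝ → ℂ := indicator (Ioi 0) fun t => h t * Real.exp (-c * t) with hk
  have hki : Integrable k := (integrable_indicator_iff measurableSet_Ioi).2 hi
  have hF : FourierTransform.fourier k = fun _ => 0 := by
    ext w
    rw [Real.fourier_real_eq_integral_exp_smul, ← h0 (-2 * Real.pi * w), laplace,
      ← integral_indicator measurableSet_Ioi]
    congr 1
    ext s
    by_cases hs : s ∈ Ioi (0 : ℝ)
    · simp only [hk, indicator_of_mem hs, smul_eq_mul]
      rw [mul_left_comm, ofReal_exp, ← Complex.exp_add]
      congr 2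
      push_cast
      linear_combination -(c * s : ℂ) * I_mul_I
    · simp [hk, indicator_of_notMem hs]
  have hkc : ContinuousAt k t := by
    have h1 : ContinuousAt (fun t => h t * (Real.exp (-c * t) : ℂ)) t :=
      hc.mul (by fun_prop)
    refine h1.congr ?_
    filter_upwards [Ioi_mem_nhds ht] with s hs
    rw [hk, indicator_of_mem hs]
  have h1 := hki.fourierInv_fourier_eq (by rw [hF]; exact integrable_zero _ _ _) hkc
  rw [hF, Real.fourierInv_eq'] at h1
  simp only [smul_zero, integral_zero] at h1
  have h2 : k t = h t * Real.exp (-c * t) := by rw [hk, indicator_of_mem (mem_Ioi.2 ht)]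
  rw [h2] at h1
  have h3 : ((Real.exp (-c * t) : ℝ) : ℂ) ≠ 0 := by exact_mod_cast (Real.exp_pos _).ne'
  exact (mul_eq_zero.1 h1.symm).resolve_right h3

theorem integrableOn_laplace {f : ℝ → ℂ} (hf : AEStronglyMeasurable f) {K c : ℝ} {k : ℕ}
    (hb : ∀ t, ‖f t‖ ≤ K * (1 + |t|) ^ k * Real.exp (c * t)) {z : ℂ} (hz : c < z.im) :
    IntegrableOn (fun t : ℝ => f t * cexp (I * z * t)) (Ioi 0) := by
  refine ((integrable_pow_mul_exp_neg (sub_pos.2 hz) k).const_mul K).mono'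
    (hf.restrict.mul (Continuous.aestronglyMeasurable (by fun_prop))) (ae_of_all _ fun t => ?_)
  rw [norm_mul, norm_cexp_I_mul]
  calc ‖f t‖ * Real.exp (-z.im * t)
      ≤ K * (1 + |t|) ^ k * Real.exp (c * t) * Real.exp (-z.im * t) := by gcongr; exact hb t
    _ = K * ((1 + |t|) ^ k * (Real.exp (c * t) * Real.exp (-z.im * t))) := by ring
    _ = _ := by rw [← Real.exp_add]; ring_nf

/-- Since iz = z²·(i/z) and i/z is the transform of 1, the equality says that f - g - (a-b) has zero
transform. So f - g is the constant a - b on t > 0, and continuity with value 0 at the origin makes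
this constant zero. -/
theorem laplace_rep_unique {f g : ℝ → ℂ} (hf : Continuous f) (hg : Continuous g)
    (hf0 : ∀ t ≤ 0, f t = 0) (hg0 : ∀ t ≤ 0, g t = 0) {K K' c : ℝ} {k k' : ℕ} (hc0 : 0 < c)
    (hfb : ∀ t, ‖f t‖ ≤ K * (1 + |t|) ^ k * Real.exp (c * t))
    (hgb : ∀ t, ‖g t‖ ≤ K' * (1 + |t|) ^ k' * Real.exp (c * t)) {a b : ℝ}
    (h : ∀ z : ℂ, c < z.im → I * a * z - z ^ 2 * laplace f z = I * b * z - z ^ 2 * laplace g z) :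
    a = b ∧ f = g := by
  have hz : ∀ x : ℝ, ((x : ℂ) + I * ((c + 1 : ℝ) : ℂ)).im = c + 1 := fun x => by simp
  have hker : ∀ (z : ℂ), c < z.im →
      laplace (fun t => f t - g t - (a - b : ℝ)) z = 0 ∧
      IntegrableOn (fun t : ℝ => (f t - g t - (a - b : ℝ)) * cexp (I * z * t)) (Ioi 0) := by
    intro z hzc
    have i1 := integrableOn_laplace hf.aestronglyMeasurable hfb hzc
    have i2 := integrableOn_laplace hg.aestronglyMeasurable hgb hzc
    have hz0 : 0 < z.im := hc0.trans hzc
    have i3 := (integrable_cexp_I_mul hz0).const_mul ((a - b : ℝ) : ℂ)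
    have hzn : z ≠ 0 := by rintro rfl; simp at hz0
    have e1 : (fun t : ℝ => (f t - g t - (a - b : ℝ)) * cexp (I * z * t)) = fun t : ℝ =>
        f t * cexp (I * z * t) - g t * cexp (I * z * t) - (a - b : ℝ) * cexp (I * z * t) := by
      ext t; ring
    constructor
    · have i12 : IntegrableOn (fun t : ℝ => f t * cexp (I * z * t) - g t * cexp (I * z * t))
        (Ioi 0) := i1.sub i2
      rw [laplace, e1, integral_sub i12 i3, integral_sub i1 i2, integral_const_mul,
        integral_cexp_I_mul hz0]
      change laplace f z - laplace g z - _ = 0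
      have h1 := h z hzc
      have h2 : z ^ 2 * (laplace f z - laplace g z - ((a - b : ℝ) : ℂ) * (I / z)) = 0 := by
        field_simp
        push_cast
        linear_combination -h1
      exact (mul_eq_zero.1 h2).resolve_left (pow_ne_zero _ hzn)
    · rw [e1]
      exact (i1.sub i2).sub i3
  have hpos : ∀ t : ℝ, 0 < t → f t - g t = (a - b : ℝ) := by
    intro t ht
    refine sub_eq_zero.1 (laplace_injective (h := fun t => f t - g t - (a - b : ℝ)) (c := c + 1)
      ?_ (fun x => (hker _ (by rw [hz]; linarith)).1) ht (by fun_prop))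
    refine (hker (((0 : ℝ) : ℂ) + I * ((c + 1 : ℝ) : ℂ)) (by rw [hz]; linarith)).2.congr_fun
      (fun t _ => ?_) measurableSet_Ioi
    simp only
    rw [ofReal_exp]
    congr 2
    push_cast
    linear_combination ((c : ℂ) + 1) * t * I_mul_I
  have hab : ((a - b : ℝ) : ℂ) = 0 := by
    have h1 : Tendsto (fun t => f t - g t) (𝓝[>] 0) (𝓝 (f 0 - g 0)) :=
      ((hf.sub hg).tendsto 0).mono_left nhdsWithin_le_nhds
    rw [hf0 0 le_rfl, hg0 0 le_rfl, sub_zero] at h1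
    refine tendsto_nhds_unique (tendsto_const_nhds.congr' ?_) h1
    filter_upwards [self_mem_nhdsWithin] with t ht
    exact (hpos t ht).symm
  refine ⟨by
    have : a - b = 0 := by exact_mod_cast hab
    linarith, funext fun t => ?_⟩
  rcases le_or_gt t 0 with ht | ht
  · rw [hf0 t ht, hg0 t ht]
  · rw [← sub_eq_zero, hpos t ht, hab]

/-! ### Functions with a logarithmic majorant -/

/-- An analytic function with real part `K + N log |z + i|`. -/
def logMajorant (K N : ℝ) (z : ℂ) : ℂ := K + N * log (1 - I * z)

theorem one_half_le_norm_add_I {z : ℂ} (hz : z ∈ aboveLine (-(1 / 2))) : 1 / 2 ≤ ‖z + I‖ := by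
  have h1 := (le_abs_self _).trans (abs_im_le_norm (z + I))
  rw [mem_aboveLine] at hz
  simp at h1
  linarith

theorem one_sub_I_mul_mem_slitPlane {z : ℂ} (hz : z ∈ aboveLine (-(1 / 2))) :
    1 - I * z ∈ slitPlane := by
  left
  rw [mem_aboveLine] at hz
  simp
  linarith

theorem norm_one_sub_I_mul (z : ℂ) : ‖1 - I * z‖ = ‖z + I‖ := by
  have : z + I = I * (1 - I * z) := by linear_combination z * I_mul_I
  rw [this, norm_mul, norm_I, one_mul]

theorem differentiableOn_logMajorant (K N : ℝ) :
    DifferentiableOn ℂ (logMajorant K N) (aboveLine (-(1 / 2))) := by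
  refine DifferentiableOn.const_add _ (DifferentiableOn.const_mul (DifferentiableOn.clog
    (by fun_prop) fun z hz => one_sub_I_mul_mem_slitPlane hz) _)

theorem re_logMajorant (K N : ℝ) (z : ℂ) :
    (logMajorant K N z).re = K + N * Real.log ‖z + I‖ := by
  rw [logMajorant, add_re, ofReal_re, re_ofReal_mul, log_re, norm_one_sub_I_mul]

theorem re_logMajorant_nonneg {K N : ℝ} (hN : 0 ≤ N) (hK : N * Real.log 2 ≤ K) {z : ℂ}
    (hz : z ∈ aboveLine (-(1 / 2))) : 0 ≤ (logMajorant K N z).re := by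
  rw [re_logMajorant]
  have h1 := Real.log_le_log (by norm_num) (one_half_le_norm_add_I hz)
  rw [one_div, Real.log_inv] at h1
  nlinarith

/-- An analytic function bounded above by a multiple of the logarithm, near the closed upper
half-plane. -/
structure HasLogMajorant (G : ℂ → ℂ) (d K N : ℝ) : Prop where
  pos : 0 < d
  le_half : d ≤ 1 / 2
  differentiableOn : DifferentiableOn ℂ G (aboveLine (-d))
  nonneg : 0 ≤ N
  le_const : N * Real.log 2 ≤ K
  re_le : ∀ z ∈ aboveLine (-d), (G z).re ≤ K + N * Real.log ‖z + I‖

namespace HasLogMajorant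

variable {G : ℂ → ℂ} {d K N : ℝ}

theorem differentiableOn_majorant (h : HasLogMajorant G d K N) :
    DifferentiableOn ℂ (logMajorant K N) (aboveLine (-d)) :=
  (differentiableOn_logMajorant K N).mono (aboveLine_anti (neg_le_neg h.le_half))

theorem re_majorant_nonneg (h : HasLogMajorant G d K N) :
    ∀ z ∈ aboveLine (-d), 0 ≤ (logMajorant K N z).re := fun _ hz =>
  re_logMajorant_nonneg h.nonneg h.le_const (aboveLine_anti (neg_le_neg h.le_half) hz)

theorem differentiableOn_sub (h : HasLogMajorant G d K N) :
    DifferentiableOn ℂ (fun z => logMajorant K N z - G z) (aboveLine (-d)) :=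
  h.differentiableOn_majorant.sub h.differentiableOn

theorem re_sub_nonneg (h : HasLogMajorant G d K N) :
    ∀ z ∈ aboveLine (-d), 0 ≤ (logMajorant K N z - G z).re := fun z hz => by
  have := h.re_le z hz
  rw [sub_re, re_logMajorant]
  linarith

theorem exists_norm_le (h : HasLogMajorant G d K N) :
    ∃ C : ℝ, ∀ z : ℂ, 0 ≤ z.im → ‖G z‖ ≤ C * (1 + ‖z‖) ^ 2 := by
  obtain ⟨C, -, hC⟩ := exists_norm_le_sq_of_re_nonneg h.pos h.differentiableOn_majorant
    h.re_majorant_nonneg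
  obtain ⟨D, -, hD⟩ := exists_norm_le_sq_of_re_nonneg h.pos h.differentiableOn_sub h.re_sub_nonneg
  refine ⟨C + D, fun z hz => ?_⟩
  have h1 : G z = logMajorant K N z - (logMajorant K N z - G z) := by ring
  rw [h1, add_mul]
  exact (norm_sub_le _ _).trans (add_le_add (hC z hz) (hD z hz))

theorem integrable_norm_div (h : HasLogMajorant G d K N) :
    Integrable fun x : ℝ => ‖G x‖ / ((1 + |x|) * (1 + x ^ 2)) := by
  have i1 := integrable_norm_div_of_re_nonneg h.pos h.differentiableOn_majorant
    h.re_majorant_nonneg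
  have i2 := integrable_norm_div_of_re_nonneg h.pos h.differentiableOn_sub h.re_sub_nonneg
  refine (i1.add i2).mono' (((continuous_real_of_differentiableOn h.pos
    h.differentiableOn).norm.div (by fun_prop)
      fun x => by positivity).aestronglyMeasurable) (ae_of_all _ fun x => ?_)
  rw [Pi.add_apply, ← add_div, Real.norm_eq_abs, abs_of_nonneg (by positivity)]
  gcongr
  have h1 : G x = logMajorant K N x - (logMajorant K N x - G x) := by ring
  conv_lhs => rw [h1]
  exact norm_sub_le _ _

/-- With p the majorant, G = p - (p - G), and each term has non-negative real part. For the upper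
bound on Re, the lower bound of the representation is used for p - G, while the linear term of p
only contributes -b₁ Im z ≤ 0. -/
theorem exists_laplace (h : HasLogMajorant G d K N) :
    ∃ (a k : ℝ) (g : ℝ → ℂ), Continuous g ∧ (∀ t ≤ 0, g t = 0) ∧
      (∀ t, ‖g t‖ ≤ 7 * (‖logMajorant K N I‖ + ‖logMajorant K N I - G I‖) * (1 + |t|)) ∧
      ∀ z : ℂ, 0 < z.im → G z = I * a * (z + I) - (z + I) ^ 2 * laplace g z ∧
        (G z - I * a * z).re ≤ k + N * Real.log ‖z + I‖ := by
  obtain ⟨b₁, k₁, g₁, hb₁, hc₁, h0₁, hbd₁, hr₁⟩ := exists_laplace_of_re_nonneg h.pos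
    h.differentiableOn_majorant h.re_majorant_nonneg
  obtain ⟨b₂, k₂, g₂, hb₂, hc₂, h0₂, hbd₂, hr₂⟩ := exists_laplace_of_re_nonneg h.pos
    h.differentiableOn_sub h.re_sub_nonneg
  refine ⟨b₂ - b₁, K - k₂, fun t => g₁ t - g₂ t, hc₁.sub hc₂, fun t ht => ?_, fun t => ?_,
    fun z hz => ⟨?_, ?_⟩⟩
  · simp [h0₁ t ht, h0₂ t ht]
  · refine (norm_sub_le _ _).trans ((add_le_add (hbd₁ t) (hbd₂ t)).trans (le_of_eq ?_))
    ring
  · have i1 := integrableOn_laplace (c := 0) (k := 1) hc₁.aestronglyMeasurable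
      (fun t => by simpa using hbd₁ t) hz
    have i2 := integrableOn_laplace (c := 0) (k := 1) hc₂.aestronglyMeasurable
      (fun t => by simpa using hbd₂ t) hz
    have h1 : laplace (fun t => g₁ t - g₂ t) z = laplace g₁ z - laplace g₂ z := by
      rw [laplace, laplace, laplace, ← integral_sub i1 i2]
      congr 1
      ext t
      ring
    rw [h1]
    have e1 := (hr₁ z hz).1
    have e2 := (hr₂ z hz).1
    push_cast
    linear_combination e1 - e2
  · have e2 := (hr₂ z hz).2
    have e3 : (I * b₁ * z).re = -(b₁ * z.im) := by simp [mul_assoc]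
    have e4 : G z - I * (b₂ - b₁ : ℝ) * z =
        logMajorant K N z - (logMajorant K N z - G z + I * b₂ * z) + I * b₁ * z := by
      push_cast; ring
    rw [e4, add_re, sub_re, e3, re_logMajorant]
    nlinarith [mul_nonneg hb₁ hz.le]

end HasLogMajorant

/-- An analytic function on the upper half-plane whose real part is bounded above
logarithmically, at infinity and at the real axis. -/
structure IsLogBounded (W : ℂ → ℂ) (A N M : ℝ) : Prop where
  differentiableOn : DifferentiableOn ℂ W upperHalf
  nonneg₀ : 0 ≤ A
  nonneg₁ : 0 ≤ N
  nonneg₂ : 0 ≤ M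
  re_le : ∀ z ∈ upperHalf, (W z).re ≤ A + N * Real.log (1 + ‖z‖) + M * Real.log (1 + 1 / z.im)

namespace IsLogBounded

variable {W : ℂ → ℂ} {A N M : ℝ}

/-- The map z ↦ c(z+i) sends Im z > -1/2 into Im > c/2, where the singular term is at most
log(1+2/c). The constant 2 + c comes from 1 + c|z+i| ≤ (2+c)|z+i|, as |z+i| ≥ 1/2. -/
theorem scaled (h : IsLogBounded W A N M) {c : ℝ} (hc : 0 < c) :
    HasLogMajorant (fun z => W (c * (z + I))) (1 / 2)
      (A + N * Real.log (2 + c) + M * Real.log (1 + 2 / c)) N := by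
  have him : ∀ z ∈ aboveLine (-(1 / 2)), c / 2 < ((c : ℂ) * (z + I)).im := by
    intro z hz
    rw [mem_aboveLine] at hz
    rw [im_ofReal_mul]
    simp only [add_im, I_im]
    nlinarith
  have hmaps : ∀ z ∈ aboveLine (-(1 / 2)), (c : ℂ) * (z + I) ∈ upperHalf := fun z hz =>
    lt_trans (by positivity) (him z hz)
  have h2c : 0 ≤ Real.log (1 + 2 / c) := Real.log_nonneg (by
    have : 0 < 2 / c := by positivity
    linarith)
  refine ⟨by norm_num, le_rfl, h.differentiableOn.comp (by fun_prop) hmaps, h.nonneg₁, ?_,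
    fun z hz => ?_⟩
  · have h1 : Real.log 2 ≤ Real.log (2 + c) := Real.log_le_log (by norm_num) (by linarith)
    have := mul_le_mul_of_nonneg_left h1 h.nonneg₁
    have := mul_nonneg h.nonneg₂ h2c
    have := h.nonneg₀
    linarith
  · have h0 := one_half_le_norm_add_I hz
    refine (h.re_le _ (hmaps z hz)).trans ?_
    have h1 : Real.log (1 + ‖(c : ℂ) * (z + I)‖) ≤ Real.log (2 + c) + Real.log ‖z + I‖ := by
      rw [← Real.log_mul (by positivity) (by linarith)]
      refine Real.log_le_log (by positivity) ?_
      rw [norm_mul, norm_real, Real.norm_eq_abs, abs_of_pos hc]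
      nlinarith
    have h2 : Real.log (1 + 1 / ((c : ℂ) * (z + I)).im) ≤ Real.log (1 + 2 / c) := by
      have h3 := him z hz
      have h4 : 0 < ((c : ℂ) * (z + I)).im := hmaps z hz
      refine Real.log_le_log (by positivity) ?_
      have : 1 / ((c : ℂ) * (z + I)).im ≤ 1 / (c / 2) :=
        one_div_le_one_div_of_le (by positivity) h3.le
      rw [one_div_div] at this
      linarith
    have := mul_le_mul_of_nonneg_left h1 h.nonneg₁
    have := mul_le_mul_of_nonneg_left h2 h.nonneg₂
    linarith

/-- The translated version, suited to a fixed horizontal line. From |z+ic| ≤ |z+i| + 1 + c and |z+i|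
≥ 1/2 follows 1 + |z+ic| ≤ (5+2c)|z+i|. -/
theorem shifted (h : IsLogBounded W A N M) {c : ℝ} (hc : 0 < c) :
    HasLogMajorant (fun z => W (z + c * I)) (min (c / 2) (1 / 2))
      (A + N * Real.log (5 + 2 * c) + M * Real.log (1 + 2 / c)) N := by
  have him : ∀ z ∈ aboveLine (-(min (c / 2) (1 / 2))), c / 2 < (z + c * I).im := by
    intro z hz
    rw [mem_aboveLine] at hz
    have := min_le_left (c / 2) (1 / 2)
    simp
    linarith
  have hmaps : ∀ z ∈ aboveLine (-(min (c / 2) (1 / 2))), z + c * I ∈ upperHalf := fun z hz =>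
    lt_trans (by positivity) (him z hz)
  have h2c : 0 ≤ Real.log (1 + 2 / c) := Real.log_nonneg (by
    have : 0 < 2 / c := by positivity
    linarith)
  refine ⟨lt_min (by positivity) (by norm_num), min_le_right _ _,
    h.differentiableOn.comp (by fun_prop) hmaps, h.nonneg₁, ?_, fun z hz => ?_⟩
  · have h1 : Real.log 2 ≤ Real.log (5 + 2 * c) := Real.log_le_log (by norm_num) (by linarith)
    have := mul_le_mul_of_nonneg_left h1 h.nonneg₁
    have := mul_nonneg h.nonneg₂ h2c
    have := h.nonneg₀
    linarith
  · have h0 := one_half_le_norm_add_I (aboveLine_anti (neg_le_neg (min_le_right _ _)) hz)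
    refine (h.re_le _ (hmaps z hz)).trans ?_
    have h1 : Real.log (1 + ‖z + c * I‖) ≤ Real.log (5 + 2 * c) + Real.log ‖z + I‖ := by
      rw [← Real.log_mul (by positivity) (by linarith)]
      refine Real.log_le_log (by positivity) ?_
      have h3 : ‖z + c * I‖ ≤ ‖z + I‖ + (1 + c) := by
        have e : z + c * I = (z + I) + (-I + c * I) := by ring
        rw [e]
        refine (norm_add_le _ _).trans (add_le_add_right ((norm_add_le _ _).trans ?_) _)
        simp [abs_of_pos hc]
      nlinarith
    have h2 : Real.log (1 + 1 / (z + c * I).im) ≤ Real.log (1 + 2 / c) := by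
      have h3 := him z hz
      have h4 : 0 < (z + c * I).im := hmaps z hz
      refine Real.log_le_log (by positivity) ?_
      have : 1 / (z + c * I).im ≤ 1 / (c / 2) :=
        one_div_le_one_div_of_le (by positivity) h3.le
      rw [one_div_div] at this
      linarith
    have := mul_le_mul_of_nonneg_left h1 h.nonneg₁
    have := mul_le_mul_of_nonneg_left h2 h.nonneg₂
    linarith

theorem laplace_scale {g : ℝ → ℂ} {c : ℝ} (hc : 0 < c) (z : ℂ) :
    laplace (fun t => 1 / c * g (c * t) * Real.exp (c * t)) z =
      1 / c ^ 2 * laplace g (z / c - I) := by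
  have hc' : (c : ℂ) ≠ 0 := by exact_mod_cast hc.ne'
  have h1 := integral_comp_mul_left_Ioi (fun t : ℝ => g t * cexp (I * (z / c - I) * t)) 0 hc
  rw [mul_zero] at h1
  have h2 : laplace g (z / c - I) =
      c * ∫ t in Ioi (0 : ℝ), g (c * t) * cexp (I * (z / c - I) * ((c * t : ℝ) : ℂ)) := by
    rw [h1, laplace, Complex.real_smul, ← mul_assoc]
    push_cast
    rw [mul_inv_cancel₀ hc', one_mul]
  rw [h2, laplace, ← integral_const_mul, ← integral_const_mul]
  congr 1
  ext t
  have h3 : cexp (I * (z / c - I) * ((c * t : ℝ) : ℂ)) = Real.exp (c * t) * cexp (I * z * t) := by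
    rw [ofReal_exp, ← Complex.exp_add]
    congr 1
    push_cast
    field_simp
    linear_combination -((c : ℂ) * t) * I_mul_I
  rw [h3]
  field_simp

/-- The constant in the growth estimate of the density, at scale `c`. -/
def scaleConst (W : ℂ → ℂ) (A N M c : ℝ) : ℝ :=
  ‖logMajorant (A + N * Real.log (2 + c) + M * Real.log (1 + 2 / c)) N I‖ +
    ‖logMajorant (A + N * Real.log (2 + c) + M * Real.log (1 + 2 / c)) N I - W (c * (I + I))‖

/-- The representation of W(c(z+i)) is read at the point z/c - i. The shift by i is what produces
the factor e^{ct} and the restriction Im z > c; both are later removed by varying c. -/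
theorem exists_laplace_scale (h : IsLogBounded W A N M) {c : ℝ} (hc : 0 < c) :
    ∃ (a k : ℝ) (f : ℝ → ℂ), Continuous f ∧ (∀ t ≤ 0, f t = 0) ∧
      (∀ t, ‖f t‖ ≤ 1 / c * (7 * scaleConst W A N M c) * (1 + |c * t|) * Real.exp (c * t)) ∧
      ∀ z : ℂ, c < z.im → W z = I * a * z - z ^ 2 * laplace f z ∧
        (W z - I * a * z).re ≤ k + N * Real.log ‖z / c‖ := by
  have hc' : (c : ℂ) ≠ 0 := by exact_mod_cast hc.ne'
  obtain ⟨a, k, g, hg, hg0, hgb, hrep⟩ := (h.scaled hc).exists_laplace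
  refine ⟨a / c, k + a, fun t => 1 / c * g (c * t) * Real.exp (c * t), by fun_prop,
    fun t ht => ?_, fun t => ?_, fun z hz => ?_⟩
  · change 1 / (c : ℂ) * g (c * t) * _ = 0
    rw [hg0 _ (mul_nonpos_of_nonneg_of_nonpos hc.le ht)]; simp
  · rw [norm_mul, norm_mul, norm_div, norm_one, norm_real, norm_real, Real.norm_eq_abs,
      Real.norm_eq_abs, abs_of_pos hc, abs_of_pos (Real.exp_pos _)]
    refine mul_le_mul_of_nonneg_right ?_ (Real.exp_pos _).le
    rw [mul_assoc (1 / c)]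
    gcongr
    exact hgb _
  · have hz' : 0 < (z / c - I).im := by
      rw [sub_im, div_ofReal_im, I_im, sub_pos, one_lt_div hc]; exact hz
    obtain ⟨h1, h2⟩ := hrep _ hz'
    have e : (c : ℂ) * (z / c - I + I) = z := by field_simp; ring
    rw [e] at h1 h2
    have e2 : z / c - I + I = z / c := by ring
    rw [e2] at h1 h2
    refine ⟨?_, ?_⟩
    · rw [laplace_scale hc, h1]
      push_cast
      field_simp
    · have e3 : W z - I * (a / c : ℝ) * z = (W z - I * a * (z / c - I)) + a := by
        push_cast
        linear_combination -(a : ℂ) * I_mul_I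
      rw [e3, add_re, ofReal_re]
      linarith

/-- The issue is the size of W(2ic) as c → 0. Carathéodory compares the points i and iY in the
rescaled variable, and Y = 1/c - 1 is chosen so that c(iY+i) = i: only the fixed value W(i) enters.
The majorant and the Carathéodory factor each cost one power of 1/c. -/
theorem scaleConst_le (h : IsLogBounded W A N M) :
    ∃ B : ℝ, 0 ≤ B ∧ ∀ c : ℝ, 0 < c → c ≤ 1 / 2 → scaleConst W A N M c ≤ B / c ^ 2 := by
  refine ⟨(A + 2 * N + 2 * M + N) + 4 * (A + 2 * N + 2 * M + N + ‖W I‖), ?_, fun c hc hc2 => ?_⟩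
  · have := h.nonneg₀; have := h.nonneg₁; have := h.nonneg₂
    positivity
  have hA := h.nonneg₀
  have hN := h.nonneg₁
  have hM := h.nonneg₂
  set K : ℝ := A + N * Real.log (2 + c) + M * Real.log (1 + 2 / c) with hK
  have hcinv : 2 ≤ 1 / c := by rw [le_div_iff₀ hc]; linarith
  have hlog1 : Real.log (2 + c) ≤ 2 := by
    have := Real.log_le_sub_one_of_pos (by positivity : 0 < 2 + c)
    linarith
  have hlog2 : Real.log (1 + 2 / c) ≤ 2 * (1 / c) := by
    have := Real.log_le_sub_one_of_pos (by positivity : 0 < 1 + 2 / c)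
    rw [mul_one_div]; linarith
  have hlog1' : 0 ≤ Real.log (2 + c) := Real.log_nonneg (by linarith)
  have hlog2' : 0 ≤ Real.log (1 + 2 / c) := Real.log_nonneg (by
    have : 0 < 2 / c := by positivity
    linarith)
  have hK0 : 0 ≤ K := by positivity
  have hKle : K ≤ (A + 2 * N + 2 * M) * (1 / c) := by
    have e1 : A ≤ A * (1 / c) := le_mul_of_one_le_right hA (by linarith)
    have e2 : N * Real.log (2 + c) ≤ 2 * N * (1 / c) := by
      calc N * Real.log (2 + c) ≤ N * 2 := by gcongr
        _ = 2 * N * 1 := by ring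
        _ ≤ 2 * N * (1 / c) := by gcongr; linarith
    have e3 : M * Real.log (1 + 2 / c) ≤ 2 * M * (1 / c) := by
      calc M * Real.log (1 + 2 / c) ≤ M * (2 * (1 / c)) := by gcongr
        _ = _ := by ring
    rw [hK]; linarith
  have hmaj : ∀ Y : ℝ, 0 < 1 + Y → ‖logMajorant K N (I * Y)‖ ≤ K + N * |Real.log (1 + Y)| := by
    intro Y hY
    have e : 1 - I * (I * Y) = ((1 + Y : ℝ) : ℂ) := by
      push_cast; linear_combination -(Y : ℂ) * I_mul_I
    rw [logMajorant, e, ← ofReal_log hY.le]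
    refine (norm_add_le _ _).trans ?_
    rw [norm_mul, norm_real, norm_real, norm_real, Real.norm_eq_abs, Real.norm_eq_abs,
      Real.norm_eq_abs, abs_of_nonneg hK0, abs_of_nonneg hN]
  have hp1 : ‖logMajorant K N I‖ ≤ (A + 2 * N + 2 * M + N) * (1 / c) := by
    have h1 := hmaj 1 (by norm_num)
    simp only [ofReal_one, mul_one] at h1
    have h2 : |Real.log (1 + 1)| ≤ 1 / c := by
      rw [abs_of_nonneg (Real.log_nonneg (by norm_num))]
      exact (Real.log_le_sub_one_of_pos (by norm_num)).trans (by linarith)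
    calc _ ≤ K + N * |Real.log (1 + 1)| := h1
      _ ≤ (A + 2 * N + 2 * M) * (1 / c) + N * (1 / c) := by gcongr
      _ = _ := by ring
  set Y : ℝ := 1 / c - 1 with hY
  have hY1 : 1 ≤ Y := by rw [hY]; linarith
  have hs := h.scaled hc
  have hUd : upperHalf ⊆ aboveLine (-(1 / 2)) := by
    rw [upperHalf_eq_aboveLine]; exact aboveLine_anti (by norm_num)
  have hcar := norm_le_of_re_nonneg (hs.differentiableOn_sub.mono hUd)
    (fun z hz => hs.re_sub_nonneg z (hUd hz)) (by linarith : 0 < Y) (z := I) (by simp)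
  have e1 : (c : ℂ) * (I * Y + I) = I := by
    rw [hY]
    have hc' : (c : ℂ) ≠ 0 := by exact_mod_cast hc.ne'
    push_cast
    field_simp
    ring
  simp only [e1, I_im, mul_one] at hcar
  have hpY : ‖logMajorant K N (I * Y) - W I‖ ≤ (A + 2 * N + 2 * M + N + ‖W I‖) * (1 / c) := by
    have h1 := hmaj Y (by linarith)
    have h2 : |Real.log (1 + Y)| ≤ 1 / c := by
      rw [abs_of_nonneg (Real.log_nonneg (by linarith))]
      have := Real.log_le_sub_one_of_pos (by linarith : (0 : ℝ) < 1 + Y)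
      rw [hY] at this ⊢
      linarith
    have h3 : ‖W I‖ ≤ ‖W I‖ * (1 / c) := le_mul_of_one_le_right (norm_nonneg _) (by linarith)
    have h4 : N * |Real.log (1 + Y)| ≤ N * (1 / c) := by gcongr
    refine (norm_sub_le _ _).trans ?_
    linarith
  have e2 : ‖I + I * Y‖ ^ 2 / Y ≤ 4 * (1 / c) := by
    have e3 : I + I * Y = ((1 + Y : ℝ) : ℂ) * I := by push_cast; ring
    rw [e3, norm_mul, norm_I, mul_one, norm_real, Real.norm_eq_abs, abs_of_pos (by linarith),
      div_le_iff₀ (by linarith)]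
    have : 1 / c = 1 + Y := by rw [hY]; ring
    rw [this]
    nlinarith
  have hc2' : 1 / c ≤ 1 / c ^ 2 := by
    apply one_div_le_one_div_of_le (by positivity); nlinarith
  have hF : ‖logMajorant K N I - W (c * (I + I))‖ ≤
      4 * (A + 2 * N + 2 * M + N + ‖W I‖) * (1 / c ^ 2) := by
    calc _ ≤ _ := hcar
      _ ≤ (A + 2 * N + 2 * M + N + ‖W I‖) * (1 / c) * (4 * (1 / c)) := by gcongr
      _ = _ := by field_simp
  have hp1' : ‖logMajorant K N I‖ ≤ (A + 2 * N + 2 * M + N) * (1 / c ^ 2) :=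
    hp1.trans (by gcongr)
  exact (add_le_add hp1' hF).trans (le_of_eq (by ring))

/-- The representation of a logarithmically bounded function by a linear term and the Laplace
transform of the second derivative of a causal continuous function of polynomial growth. -/
theorem exists_rep (h : IsLogBounded W A N M) :
    ∃ (a : ℝ) (f : ℝ → ℂ), Continuous f ∧ (∀ t ≤ 0, f t = 0) ∧
      (∃ C : ℝ, ∀ t, ‖f t‖ ≤ C * (1 + |t|) ^ 4) ∧
      (∀ z : ℂ, 0 < z.im → W z = I * a * z - z ^ 2 * laplace f z) ∧
      ∃ k : ℝ, ∀ z : ℂ, 1 < z.im → (W z - I * a * z).re ≤ k + N * Real.log ‖z‖ := by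
  obtain ⟨B, hB0, hB⟩ := h.scaleConst_le
  have hN := h.nonneg₁
  choose! a k f hf hf0 hfb hrep using fun (c : ℝ) (hc : 0 < c) => h.exists_laplace_scale hc
  have hbd : ∀ c : ℝ, 0 < c → ∀ t, ‖f c t‖ ≤
      (1 / c * (7 * scaleConst W A N M c) * (1 + c)) * (1 + |t|) ^ 1 * Real.exp (c * t) := by
    intro c hc t
    refine (hfb c hc t).trans ?_
    have h0 : 0 ≤ scaleConst W A N M c := add_nonneg (norm_nonneg _) (norm_nonneg _)
    rw [mul_assoc (1 / c * (7 * scaleConst W A N M c)) (1 + c), pow_one]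
    refine mul_le_mul_of_nonneg_right (mul_le_mul_of_nonneg_left ?_ (by positivity))
      (Real.exp_pos _).le
    rw [abs_mul, abs_of_pos hc]
    nlinarith [abs_nonneg t]
  -- All representations with c ≤ 1 are valid on Im z > 1 with exponential growth at most e^t, hence
  -- they coincide.
  have huniq : ∀ c : ℝ, 0 < c → c ≤ 1 → a c = a 1 ∧ f c = f 1 := by
    intro c hc hc1
    refine laplace_rep_unique (hf c hc) (hf 1 one_pos) (hf0 c hc) (hf0 1 one_pos) one_pos
      (K := 1 / c * (7 * scaleConst W A N M c) * (1 + c)) (k := 1)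
      (fun t => ?_) (hbd 1 one_pos) fun z hz => ?_
    · rcases le_or_gt t 0 with ht | ht
      · rw [hf0 c hc t ht, norm_zero]
        have h0 : 0 ≤ scaleConst W A N M c := add_nonneg (norm_nonneg _) (norm_nonneg _)
        positivity
      · refine (hbd c hc t).trans ?_
        have h0 : 0 ≤ scaleConst W A N M c := add_nonneg (norm_nonneg _) (norm_nonneg _)
        gcongr
    · rw [← (hrep c hc z (by linarith)).1, ← (hrep 1 one_pos z hz).1]
  refine ⟨a 1, f 1, hf 1 one_pos, hf0 1 one_pos, ⟨7 * B * 8 * Real.exp 1, fun t => ?_⟩,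
    fun z hz => ?_, ⟨k 1, fun z hz => ?_⟩⟩
  -- This scale keeps e^{ct} ≤ e, while 1/c³ = (2+|t|)³ ≤ 8(1+|t|)³; with the linear factor 1 + |ct|
  -- this gives the exponent 4.
  · set c : ℝ := 1 / (2 + |t|) with hc_def
    have ht0 := abs_nonneg t
    have hc : 0 < c := by positivity
    have hc2 : c ≤ 1 / 2 := one_div_le_one_div_of_le (by norm_num) (by linarith)
    have hct : |c * t| ≤ 1 := by
      rw [abs_mul, abs_of_pos hc, hc_def, one_div, inv_mul_le_iff₀ (by positivity)]
      linarith
    rw [← (huniq c hc (by linarith)).2]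
    have h0 : 0 ≤ scaleConst W A N M c := add_nonneg (norm_nonneg _) (norm_nonneg _)
    have hci : 1 / c = 2 + |t| := by rw [hc_def, one_div_one_div]
    have h1 : 1 + |c * t| ≤ 1 + |t| := by
      rw [abs_mul, abs_of_pos hc]
      nlinarith
    have h2 : Real.exp (c * t) ≤ Real.exp 1 := Real.exp_le_exp.2 ((le_abs_self _).trans hct)
    have h3 := hB c hc hc2
    calc ‖f c t‖ ≤ _ := hfb c hc t
      _ ≤ 1 / c * (7 * (B / c ^ 2)) * (1 + |t|) * Real.exp 1 :=
        mul_le_mul (mul_le_mul (by gcongr) h1 (by positivity) (by positivity)) h2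
          (Real.exp_pos _).le (by positivity)
      _ = 7 * B * (1 / c) ^ 3 * (1 + |t|) * Real.exp 1 := by field_simp
      _ ≤ 7 * B * (2 * (1 + |t|)) ^ 3 * (1 + |t|) * Real.exp 1 := by
        rw [hci]
        gcongr
        linarith
      _ = _ := by ring
  -- Any scale below Im z represents W at z, and it yields the same a and f.
  · set c : ℝ := min 1 (z.im / 2)
    have hc : 0 < c := lt_min one_pos (by positivity)
    have hcz : c < z.im := (min_le_right _ _).trans_lt (by linarith)
    obtain ⟨e1, e2⟩ := huniq c hc (min_le_left _ _)
    rw [← e1, ← e2]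
    exact (hrep c hc z hcz).1
  · simpa using (hrep 1 one_pos z hz).2

end IsLogBounded

/-! ### Principal values and the dispersion relations on horizontal lines -/

theorem measurableSet_lt_abs_sub (ε w : ℝ) : MeasurableSet {x : ℝ | ε < |x - w|} :=
  (isOpen_lt continuous_const (by fun_prop)).measurableSet

theorem aecover_lt_abs_sub (w : ℝ) :
    AECover volume (𝓝[>] (0 : ℝ)) fun ε : ℝ => {x : ℝ | ε < |x - w|} where
  ae_eventually_mem := by
    filter_upwards [compl_mem_ae_iff.2 (measure_singleton (μ := volume) w)] with x hx
    have : 0 < |x - w| := abs_pos.2 (sub_ne_zero.2 hx)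
    exact mem_nhdsWithin_of_mem_nhds (Iio_mem_nhds this)
  measurableSet ε := measurableSet_lt_abs_sub ε w

theorem integrableOn_div_sub {Q : ℝ → ℂ} (hQ : Continuous Q)
    (hint : Integrable fun x : ℝ => ‖Q x‖ / (1 + |x|)) (w : ℝ) {ε : ℝ} (hε : 0 < ε) :
    IntegrableOn (fun x : ℝ => Q x / (x - w)) {x | ε < |x - w|} := by
  refine Integrable.mono' (hint.const_mul (1 + (1 + |w|) / ε)).integrableOn
    (hQ.measurable.div (by fun_prop)).aestronglyMeasurable ?_
  filter_upwards [ae_restrict_mem (measurableSet_lt_abs_sub ε w)] with x hx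
  have hx' : ε < |x - w| := hx
  have h0 : 0 < |x - w| := hε.trans hx'
  rw [norm_div, ← ofReal_sub, norm_real, Real.norm_eq_abs, mul_div_assoc', mul_comm,
    div_le_div_iff₀ h0 (by positivity), mul_assoc]
  refine mul_le_mul_of_nonneg_left ?_ (norm_nonneg _)
  have h1 : |x| ≤ |x - w| + |w| := by simpa using abs_add_le (x - w) w
  have h2 : 1 + |w| ≤ (1 + |w|) / ε * |x - w| := by
    rw [div_mul_eq_mul_div, le_div_iff₀ hε]
    gcongr
  linarith

theorem integrable_norm_inv_div (w : ℝ) :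
    Integrable fun x : ℝ => ‖I * ((x : ℂ) - (w - I))⁻¹‖ / (1 + |x|) := by
  have him : ((w : ℂ) - I).im ≠ 0 := by simp
  obtain ⟨C, hC0, hC⟩ := exists_one_add_abs_le him
  refine (integrable_inv_one_add_sq.const_mul C).mono' (Continuous.aestronglyMeasurable ?_)
    (ae_of_all _ fun x => ?_)
  · exact (continuous_const.mul (Continuous.inv₀ (by fun_prop)
      fun x => real_sub_ne_zero him x)).norm.div (by fun_prop) fun x => by positivity
  · have h1 := hC x
    have h2 : 0 < ‖(x : ℂ) - (w - I)‖ := norm_pos_iff.2 (real_sub_ne_zero him x)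
    rw [Real.norm_eq_abs, abs_of_nonneg (by positivity), norm_mul, norm_I, one_mul, norm_inv,
      ← div_eq_mul_inv, div_le_div_iff₀ (by positivity) (by positivity), inv_mul_le_iff₀ h2]
    have h3 : (1 + x ^ 2) ≤ (1 + |x|) * (1 + |x|) := by nlinarith [abs_nonneg x, sq_abs x]
    nlinarith [abs_nonneg x]

theorem setIntegral_odd_eq_zero (w ε : ℝ) :
    ∫ x in {x : ℝ | ε < |x - w|}, (((x - w) * ((x - w) ^ 2 + 1))⁻¹ : ℂ) = 0 := by
  rw [← integral_indicator (measurableSet_lt_abs_sub ε w)]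
  set f : ℝ → ℂ := {x : ℝ | ε < |x - w|}.indicator
    fun x => (((x - w) * ((x - w) ^ 2 + 1))⁻¹ : ℂ) with hf
  have h : ∀ x, f (2 * w - x) = -f x := by
    intro x
    have e : |2 * w - x - w| = |x - w| := by rw [← abs_neg]; congr 1; ring
    simp only [hf, Set.indicator, mem_ofPred_eq, e]
    split_ifs
    · rw [← inv_neg]
      congr 1
      push_cast
      ring
    · simp
  have h2 := integral_sub_left_eq_self f volume (2 * w)
  simp_rw [h, integral_neg] at h2
  exact self_eq_neg.1 h2.symm

/-- The model case. With s = x - w, i/(s(s+i)) = i/(1+s²) + 1/(s(s²+1)); the second term is odd and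
drops out of the symmetric truncation, the first integrates to πi. -/
theorem tendsto_setIntegral_inv (w : ℝ) :
    Tendsto (fun ε : ℝ => ∫ x in {x : ℝ | ε < |x - w|},
      I * ((x : ℂ) - (w - I))⁻¹ / (x - w)) (𝓝[>] 0) (𝓝 (Real.pi * I)) := by
  have hi : Integrable fun x : ℝ => I * (((1 + (x - w) ^ 2)⁻¹ : ℝ) : ℂ) :=
    (integrable_inv_one_add_sq.comp_sub_right w).ofReal.const_mul I
  have hlim := (aecover_lt_abs_sub w).integral_tendsto_of_countably_generated hi
  have hval : ∫ x : ℝ, I * (((1 + (x - w) ^ 2)⁻¹ : ℝ) : ℂ) = Real.pi * I := by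
    rw [integral_const_mul, integral_complex_ofReal,
      integral_sub_right_eq_self (fun x : ℝ => (1 + x ^ 2)⁻¹) w, integral_univ_inv_one_add_sq,
      mul_comm]
  rw [hval] at hlim
  refine hlim.congr' ?_
  filter_upwards [self_mem_nhdsWithin] with ε hε
  have him : ((w : ℂ) - I).im ≠ 0 := by simp
  have h1 := integrableOn_div_sub (Q := fun x : ℝ => I * ((x : ℂ) - (w - I))⁻¹)
    (continuous_const.mul (Continuous.inv₀ (by fun_prop) fun x => real_sub_ne_zero him x))
    (integrable_norm_inv_div w) w (mem_Ioi.1 hε)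
  have h2 := setIntegral_odd_eq_zero w ε
  have h3 : ∀ x ∈ {x : ℝ | ε < |x - w|}, (((x - w) * ((x - w) ^ 2 + 1))⁻¹ : ℂ) =
      I * ((x : ℂ) - (w - I))⁻¹ / (x - w) - I * (((1 + (x - w) ^ 2)⁻¹ : ℝ) : ℂ) := by
    intro x hx
    have h4 : (x : ℂ) - w ≠ 0 := by
      rw [← ofReal_sub, ofReal_ne_zero]
      exact abs_pos.1 ((mem_Ioi.1 hε).trans hx)
    have h5 := real_sub_ne_zero him x
    have h6 : (1 : ℂ) + (x - w) ^ 2 ≠ 0 := by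
      have : (0 : ℝ) < 1 + (x - w) ^ 2 := by positivity
      exact_mod_cast this.ne'
    have h7 : (1 : ℂ) + (x - w) ^ 2 = (x - (w - I)) * (x - w - I) := by
      linear_combination I_mul_I
    have h8 : (x : ℂ) - w - I ≠ 0 := fun h => h6 (by rw [h7, h, mul_zero])
    push_cast
    rw [add_comm ((((x : ℂ) - w)) ^ 2), h7]
    field_simp
    linear_combination I_mul_I
  rw [setIntegral_congr_fun (measurableSet_lt_abs_sub ε w) h3,
    integral_sub h1 hi.integrableOn, sub_eq_zero] at h2
  exact h2.symm

/-- The principal value of the Cauchy integral of a function analytic near the closed upper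
half-plane. -/
theorem tendsto_setIntegral_div_sub {Q : ℂ → ℂ} {d : ℝ} (hd : 0 < d)
    (hQ : DifferentiableOn ℂ Q (aboveLine (-d))) (hb : PolyBounded Q)
    (hint : Integrable fun x : ℝ => ‖Q x‖ / (1 + |x|)) (w : ℝ) :
    Tendsto (fun ε : ℝ => ∫ x in {x : ℝ | ε < |x - w|}, Q x / (x - w)) (𝓝[>] 0)
      (𝓝 (Real.pi * I * Q w)) := by
  have him : ((w : ℂ) - I).im ≠ 0 := by simp
  have hcontQ := continuous_real_of_differentiableOn hd hQ
  have hcontP : Continuous fun x : ℝ => I * ((x : ℂ) - (w - I))⁻¹ :=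
    continuous_const.mul (Continuous.inv₀ (by fun_prop) fun x => real_sub_ne_zero him x)
  set d' := min d 1
  have hd' : 0 < d' := lt_min hd one_pos
  -- The function i/(z-w+i) equals 1 at w and has its pole below the line. So E vanishes at w,
  -- E(z)/(z-w) has zero integral, and the principal value reduces to the model case times Q(w).
  set E : ℂ → ℂ := fun z => Q z - Q w * (I * (z - (w - I))⁻¹) with hE
  have hEd : DifferentiableOn ℂ E (aboveLine (-d')) :=
    (hQ.mono (aboveLine_anti (neg_le_neg (min_le_left _ _)))).sub
      (((differentiableOn_inv_sub (by simp)).const_mul I).const_mul _)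
  have hEb : PolyBounded E := hb.sub ((polyBounded_const _).mul ((polyBounded_const _).mul
    (polyBounded_inv_sub (by simp))))
  have hEw : E w = 0 := by
    simp only [hE, sub_sub_cancel]
    rw [mul_inv_cancel₀ I_ne_zero]; ring
  have hEdd := (differentiableOn_dslope ((isOpen_aboveLine (-d')).mem_nhds (by
    rw [mem_aboveLine]; simpa using hd') : aboveLine (-d') ∈ 𝓝 (w : ℂ))).2 hEd
  have hfun : ∀ x : ℝ, x ≠ w → dslope E w x =
      Q x / (x - w) - Q w * (I * ((x : ℂ) - (w - I))⁻¹ / (x - w)) := by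
    intro x hx
    rw [dslope_of_ne _ (by exact_mod_cast hx), slope_def_field, hEw]
    simp only [hE]
    ring
  have hintOn : ∀ ε : ℝ, 0 < ε → IntegrableOn (fun x : ℝ => Q x / (x - w)) {x | ε < |x - w|} ∧
      IntegrableOn (fun x : ℝ => I * ((x : ℂ) - (w - I))⁻¹ / (x - w)) {x | ε < |x - w|} :=
    fun ε hε => ⟨integrableOn_div_sub hcontQ hint w hε,
      integrableOn_div_sub hcontP (integrable_norm_inv_div w) w hε⟩
  have hne : ∀ ε : ℝ, 0 < ε → ∀ x ∈ {x : ℝ | ε < |x - w|}, x ≠ w := by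
    intro ε hε x hx h
    have : ε < |x - w| := hx
    rw [h, sub_self, abs_zero] at this
    exact lt_asymm hε this
  have hEint : Integrable fun x : ℝ => dslope E w x := by
    rw [← integrableOn_univ]
    have hu : (univ : Set ℝ) = Icc (w - 1) (w + 1) ∪ {x | 1 < |x - w|} := by
      ext x
      simp only [mem_univ, mem_union, mem_Icc, mem_ofPred_eq, true_iff]
      by_cases h : 1 < |x - w|
      · exact Or.inr h
      · have := abs_le.1 (not_lt.1 h)
        exact Or.inl ⟨by linarith, by linarith⟩
    rw [hu]
    refine IntegrableOn.union
      (continuous_real_of_differentiableOn hd' hEdd).continuousOn.integrableOn_Icc ?_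
    refine IntegrableOn.congr_fun ((hintOn 1 one_pos).1.sub ((hintOn 1 one_pos).2.const_mul (Q w)))
      (fun x hx => (hfun x (hne 1 one_pos x hx)).symm) (measurableSet_lt_abs_sub 1 w)
  have h0 := integral_real_eq_zero hd' hEdd (polyBounded_dslope hd' hEd hEb (by simp)) hEint
  have hlim := (aecover_lt_abs_sub w).integral_tendsto_of_countably_generated hEint
  rw [h0] at hlim
  have := hlim.add ((tendsto_setIntegral_inv w).const_mul (Q w))
  rw [zero_add, mul_comm (Q w)] at this
  refine this.congr' ?_
  filter_upwards [self_mem_nhdsWithin] with ε hε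
  rw [setIntegral_congr_fun (measurableSet_lt_abs_sub ε w)
    (fun x hx => hfun x (hne ε hε x hx)),
    integral_sub (hintOn ε hε).1 ((hintOn ε hε).2.const_mul (Q w)), integral_const_mul]
  ring

theorem hasPrincipalValue_re {F : ℝ → ℂ} {w : ℝ} {J : ℂ}
    (h1 : ∀ ε : ℝ, 0 < ε → IntegrableOn F {x | ε < |x - w|})
    (h2 : Tendsto (fun ε : ℝ => ∫ x in {x | ε < |x - w|}, F x) (𝓝[>] 0) (𝓝 J)) :
    HasPrincipalValue (fun x => (F x).re) w J.re ∧ HasPrincipalValue (fun x => (F x).im) w J.im := by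
  refine ⟨⟨fun ε hε => (h1 ε hε).re, ?_⟩, ⟨fun ε hε => (h1 ε hε).im, ?_⟩⟩
  · refine ((continuous_re.tendsto J).comp h2).congr' ?_
    filter_upwards [self_mem_nhdsWithin] with ε hε
    exact (integral_re (h1 ε hε)).symm
  · refine ((continuous_im.tendsto J).comp h2).congr' ?_
    filter_upwards [self_mem_nhdsWithin] with ε hε
    exact (integral_im (h1 ε hε)).symm

theorem HasPrincipalValue.congr_ae {F G : ℝ → ℝ} {a J : ℝ} (h : HasPrincipalValue F a J)
    (hFG : F =ᵐ[volume] G) : HasPrincipalValue G a J := by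
  refine ⟨fun ε hε => (h.1 ε hε).congr (ae_restrict_of_ae hFG), h.2.congr fun ε => ?_⟩
  exact integral_congr_ae (ae_restrict_of_ae hFG)

theorem dslope_dslope_of_ne {G : ℂ → ℂ} {a z : ℂ} (h : z ≠ a) :
    dslope (dslope G a) a z = (G z - G a - (z - a) * deriv G a) / (z - a) ^ 2 := by
  have h' := sub_ne_zero.2 h
  rw [dslope_of_ne _ h, slope_def_field, dslope_same, dslope_of_ne _ h, slope_def_field]
  field_simp

/-- Near a the integrand is continuous. Far from a it is G minus a linear function, divided by
(x-a)²: the two subtractions account exactly for the factor 1+x² in the assumed weight. -/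
theorem integrable_norm_dslope_dslope {G : ℂ → ℂ} {d : ℝ} (hd : 0 < d)
    (hG : DifferentiableOn ℂ G (aboveLine (-d)))
    (hint : Integrable fun x : ℝ => ‖G x‖ / ((1 + |x|) * (1 + x ^ 2))) (a : ℝ) :
    Integrable fun x : ℝ => ‖dslope (dslope G a) a x‖ / (1 + |x|) := by
  have hnhds : aboveLine (-d) ∈ 𝓝 (a : ℂ) := (isOpen_aboveLine _).mem_nhds (by
    rw [mem_aboveLine]; simpa using hd)
  have hcont := continuous_real_of_differentiableOn hd
    ((differentiableOn_dslope hnhds).2 ((differentiableOn_dslope hnhds).2 hG))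
  have hcont' : Continuous fun x : ℝ => ‖dslope (dslope G a) a x‖ / (1 + |x|) :=
    hcont.norm.div (by fun_prop) fun x => by positivity
  rw [← integrableOn_univ]
  have hu : (univ : Set ℝ) = Icc (a - 1) (a + 1) ∪ {x | 1 < |x - a|} := by
    ext x
    simp only [mem_univ, mem_union, mem_Icc, mem_ofPred_eq, true_iff]
    by_cases h : 1 < |x - a|
    · exact Or.inr h
    · have := abs_le.1 (not_lt.1 h)
      exact Or.inl ⟨by linarith, by linarith⟩
  rw [hu]
  refine hcont'.continuousOn.integrableOn_Icc.union ?_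
  refine Integrable.mono' ((hint.const_mul (2 * (2 + |a|) ^ 2)).add
    (integrable_inv_one_add_sq.const_mul ((‖G a‖ + ‖deriv G a‖) * (2 * (2 + |a|) ^ 2)))).integrableOn
    hcont'.aestronglyMeasurable ?_
  filter_upwards [ae_restrict_mem (measurableSet_lt_abs_sub 1 a)] with x hx
  have hx' : 1 < |x - a| := hx
  have hne : (x : ℂ) ≠ a := by
    intro h
    rw [show x = a by exact_mod_cast h] at hx'
    simp at hx'
    linarith
  have h1 : |x| ≤ |x - a| + |a| := by simpa using abs_add_le (x - a) a
  have h2 : 1 + |x| ≤ (2 + |a|) * |x - a| := by nlinarith [abs_nonneg a]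
  have h0 : 0 < |x - a| := by linarith
  have hP : 1 ≤ 1 + |x| := by linarith [abs_nonneg x]
  have hq : 1 + x ^ 2 ≤ (1 + |x|) ^ 2 := by nlinarith [abs_nonneg x, sq_abs x]
  have hA : 2 ≤ 2 + |a| := by linarith [abs_nonneg a]
  have hK : 2 + |a| ≤ 2 * (2 + |a|) ^ 2 := by nlinarith
  have h3 : 1 + x ^ 2 ≤ 2 * (2 + |a|) ^ 2 * |x - a| ^ 2 := by
    have : (1 + |x|) ^ 2 ≤ ((2 + |a|) * |x - a|) ^ 2 := by gcongr
    rw [mul_pow] at this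
    nlinarith [sq_nonneg ((2 + |a|) * |x - a|)]
  have h4 : 1 / |x - a| ^ 2 ≤ 2 * (2 + |a|) ^ 2 / (1 + x ^ 2) := by
    rw [div_le_div_iff₀ (by positivity) (by positivity)]; linarith
  have h5 : 1 / (|x - a| * (1 + |x|)) ≤ 2 * (2 + |a|) ^ 2 / (1 + x ^ 2) := by
    rw [div_le_div_iff₀ (by positivity) (by positivity)]
    calc 1 * (1 + x ^ 2) ≤ (1 + |x|) * (1 + |x|) := by linarith
      _ ≤ ((2 + |a|) * |x - a|) * (1 + |x|) := by gcongr
      _ ≤ (2 * (2 + |a|) ^ 2 * |x - a|) * (1 + |x|) := by gcongr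
      _ = _ := by ring
  have h6 : ‖G x - G a - (x - a) * deriv G a‖ ≤ ‖G x‖ + ‖G a‖ + |x - a| * ‖deriv G a‖ := by
    refine (norm_sub_le _ _).trans (add_le_add (norm_sub_le _ _) ?_)
    rw [norm_mul, ← ofReal_sub, norm_real, Real.norm_eq_abs]
  have h7 : ‖(x : ℂ) - a‖ = |x - a| := by rw [← ofReal_sub, norm_real, Real.norm_eq_abs]
  rw [Real.norm_eq_abs, abs_of_nonneg (by positivity), dslope_dslope_of_ne hne, norm_div,
    norm_pow, h7, Pi.add_apply]
  calc ‖G x - G a - (x - a) * deriv G a‖ / |x - a| ^ 2 / (1 + |x|)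
      ≤ (‖G x‖ + ‖G a‖ + |x - a| * ‖deriv G a‖) / |x - a| ^ 2 / (1 + |x|) := by gcongr
    _ = ‖G x‖ / (1 + |x|) * (1 / |x - a| ^ 2) + ‖G a‖ / (1 + |x|) * (1 / |x - a| ^ 2) +
        ‖deriv G a‖ * (1 / (|x - a| * (1 + |x|))) := by field_simp
    _ ≤ ‖G x‖ / (1 + |x|) * (2 * (2 + |a|) ^ 2 / (1 + x ^ 2)) +
        ‖G a‖ * (2 * (2 + |a|) ^ 2 / (1 + x ^ 2)) +
        ‖deriv G a‖ * (2 * (2 + |a|) ^ 2 / (1 + x ^ 2)) := by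
      gcongr
      exact div_le_self (norm_nonneg _) hP
    _ = _ := by field_simp; ring

/-- The dispersion relations with two subtractions for a function analytic near the closed upper
half-plane. -/
theorem twiceSubtracted_of_differentiableOn {G : ℂ → ℂ} {d : ℝ} (hd : 0 < d)
    (hG : DifferentiableOn ℂ G (aboveLine (-d))) (hb : PolyBounded G)
    (hint : Integrable fun x : ℝ => ‖G x‖ / ((1 + |x|) * (1 + x ^ 2))) {w₀ w : ℝ} (hw : w ≠ w₀) :
    TwiceSubtracted 1 (fun x => (G x).re) (fun x => (G x).im)
      w₀ (deriv G w₀).re (deriv G w₀).im w ∧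
    TwiceSubtracted (-1) (fun x => (G x).im) (fun x => (G x).re)
      w₀ (deriv G w₀).im (deriv G w₀).re w := by
  have hnhds : aboveLine (-d) ∈ 𝓝 (w₀ : ℂ) := (isOpen_aboveLine _).mem_nhds (by
    rw [mem_aboveLine]; simpa using hd)
  have hd1 := (differentiableOn_dslope hnhds).2 hG
  have hd2 := (differentiableOn_dslope hnhds).2 hd1
  have hb2 := polyBounded_dslope hd hd1 (polyBounded_dslope hd hG hb (a := w₀) (by simp))
    (a := w₀) (by simp)
  have hi2 := integrable_norm_dslope_dslope hd hG hint w₀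
  -- With Q the second divided difference at w₀, the principal value of Q/(x-w) is πiQ(w). Its
  -- imaginary part π Re Q(w) gives the first relation, and its real part -π Im Q(w) the second,
  -- with its minus sign.
  obtain ⟨hre, him⟩ := hasPrincipalValue_re
    (fun ε hε => integrableOn_div_sub (continuous_real_of_differentiableOn hd hd2) hi2 w hε)
    (tendsto_setIntegral_div_sub hd hd2 hb2 hi2 w)
  have hform : ∀ x : ℝ, x ≠ w₀ → dslope (dslope G w₀) w₀ x / (x - w) =
      (G x - G w₀ - (x - w₀) * deriv G w₀) / (((x - w₀) ^ 2 * (x - w) : ℝ) : ℂ) := by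
    intro x hx
    rw [dslope_dslope_of_ne (by exact_mod_cast hx), div_div]
    push_cast
    rfl
  have hae : ∀ᵐ x : ℝ, x ≠ w₀ := compl_mem_ae_iff.2 (measure_singleton (μ := volume) w₀)
  have hr : ∀ x : ℝ, (G x - G w₀ - (x - w₀) * deriv G w₀).re =
      (G x).re - (G w₀).re - (x - w₀) * (deriv G w₀).re := fun x => by
    rw [← ofReal_sub, sub_re, sub_re, re_ofReal_mul]
  have hi : ∀ x : ℝ, (G x - G w₀ - (x - w₀) * deriv G w₀).im =
      (G x).im - (G w₀).im - (x - w₀) * (deriv G w₀).im := fun x => by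
    rw [← ofReal_sub, sub_im, sub_im, im_ofReal_mul]
  have hw' : (w : ℂ) - w₀ ≠ 0 := by exact_mod_cast sub_ne_zero.2 hw
  have hw2 : (w - w₀) ≠ 0 := sub_ne_zero.2 hw
  have hval := dslope_dslope_of_ne (G := G) (show (w : ℂ) ≠ w₀ by exact_mod_cast hw)
  have hQ : G w - G w₀ - (w - w₀) * deriv G w₀ =
      ((w - w₀) ^ 2 : ℝ) * dslope (dslope G w₀) w₀ w := by
    rw [hval]; push_cast; field_simp
  have hJ : (Real.pi : ℂ) * I * dslope (dslope G w₀) w₀ w =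
      Real.pi * (I * dslope (dslope G w₀) w₀ w) := by ring
  refine ⟨⟨_, him.congr_ae ?_, ?_⟩, ⟨_, hre.congr_ae ?_, ?_⟩⟩
  · filter_upwards [hae] with x hx
    rw [hform x hx, div_ofReal_im, hi]
  · rw [← hr, hQ, re_ofReal_mul, hJ, im_ofReal_mul]
    simp
    field_simp
  · filter_upwards [hae] with x hx
    rw [hform x hx, div_ofReal_re, hr]
  · rw [← hi, hQ, im_ofReal_mul, hJ, re_ofReal_mul]
    simp
    field_simp

/-- The dispersion relations with two subtractions, on every horizontal line, for a function
that is logarithmically bounded up to a linear term. -/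
theorem IsLogBounded.kkOnLine {W L : ℂ → ℂ} {A N M : ℝ} (h : IsLogBounded W A N M) (s : ℂ)
    (hL : ∀ z, L z = W z + s * z) {c : ℝ} (hc : 0 < c) : KKOnLine L c := by
  intro w₀ w hw
  have hs := h.shifted hc
  have hGd := hs.differentiableOn.add ((differentiableOn_id.add_const (c * I)).const_mul s)
  have hderiv : deriv L (w₀ + c * I) =
      deriv (fun z => W (z + c * I) + s * (z + c * I)) (w₀ : ℂ) := by
    rw [show L = fun z => W z + s * z from funext hL]
    exact (deriv_comp_add_const (fun z => W z + s * z) (c * I) (w₀ : ℂ)).symm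
  have := twiceSubtracted_of_differentiableOn (G := fun z => W (z + c * I) + s * (z + c * I))
    hs.pos hGd ?_ ?_ hw
  · rw [hderiv]
    simp only [hL]
    exact this
  · obtain ⟨C, hC⟩ := hs.exists_norm_le
    exact PolyBounded.add ⟨C, 2, hC⟩ ((polyBounded_const _).mul
      (polyBounded_id.add (polyBounded_const _)))
  · refine ((hs.integrable_norm_div).add (integrable_inv_one_add_sq.const_mul
      (‖s‖ * (1 + c)))).mono' ?_ (ae_of_all _ fun x => ?_)
    · exact ((continuous_real_of_differentiableOn hs.pos hGd).norm.div (by fun_prop)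
        fun x => by positivity).aestronglyMeasurable
    · rw [Real.norm_eq_abs, abs_of_nonneg (by positivity), Pi.add_apply]
      have h1 : ‖s * ((x : ℂ) + c * I)‖ ≤ ‖s‖ * (1 + c) * (1 + |x|) := by
        rw [norm_mul, mul_assoc]
        gcongr
        refine (norm_add_le _ _).trans ?_
        rw [norm_mul, norm_I, norm_real, norm_real, Real.norm_eq_abs, Real.norm_eq_abs,
          abs_of_pos hc]
        nlinarith [abs_nonneg x]
      calc _ ≤ (‖W (x + c * I)‖ + ‖s‖ * (1 + c) * (1 + |x|)) / ((1 + |x|) * (1 + x ^ 2)) := by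
            gcongr
            exact (norm_add_le _ _).trans (by gcongr)
        _ = _ := by field_simp

/-! ### Estimates for tempered distributions on cut-off exponentials -/

theorem one_add_pow_mul_exp_neg_le (b : ℕ) {y u : ℝ} (hy : 0 < y) (hu : 0 ≤ u) :
    (1 + u) ^ b * Real.exp (-(y * u)) ≤ 2 ^ b * (1 + (b.factorial : ℝ)) * (1 + 1 / y) ^ b := by
  have h1 : (1 + u) ^ b ≤ 2 ^ b * (1 + u ^ b) := by
    rcases le_total u 1 with h | h
    · calc (1 + u) ^ b ≤ 2 ^ b := by gcongr; linarith
        _ ≤ 2 ^ b * (1 + u ^ b) := le_mul_of_one_le_right (by positivity) (by simp; positivity)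
    · calc (1 + u) ^ b ≤ (2 * u) ^ b := by gcongr; linarith
        _ = 2 ^ b * u ^ b := mul_pow _ _ _
        _ ≤ _ := by gcongr; linarith
  have h2 : u ^ b * Real.exp (-(y * u)) ≤ b.factorial * (1 / y) ^ b := by
    have := Real.pow_div_factorial_le_exp (y * u) (by positivity) b
    rw [mul_pow, div_le_iff₀ (by positivity)] at this
    rw [Real.exp_neg, ← div_eq_mul_inv, div_le_iff₀ (Real.exp_pos _), one_div, inv_pow,
      mul_right_comm, ← div_eq_mul_inv, le_div_iff₀ (by positivity)]
    linarith
  have h3 : Real.exp (-(y * u)) ≤ 1 := Real.exp_le_one_iff.2 (by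
    have : 0 ≤ y * u := by positivity
    linarith)
  have hy1 : 0 < 1 / y := by positivity
  have h4 : (1 : ℝ) ≤ (1 + 1 / y) ^ b := one_le_pow₀ (by linarith)
  have h5 : (1 / y) ^ b ≤ (1 + 1 / y) ^ b := by gcongr; linarith
  calc (1 + u) ^ b * Real.exp (-(y * u)) ≤ 2 ^ b * (1 + u ^ b) * Real.exp (-(y * u)) := by gcongr
    _ = 2 ^ b * (Real.exp (-(y * u)) + u ^ b * Real.exp (-(y * u))) := by ring
    _ ≤ 2 ^ b * ((1 + 1 / y) ^ b + b.factorial * (1 + 1 / y) ^ b) := by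
      have h6 : (b.factorial : ℝ) * (1 / y) ^ b ≤ b.factorial * (1 + 1 / y) ^ b := by gcongr
      exact mul_le_mul_of_nonneg_left (by linarith) (by positivity)
    _ = _ := by ring

/-- Leibniz' rule: the derivatives of χ grow polynomially and g decays like e^{-yt} from s on.
Writing t = s + u isolates e^{-ys}, and a power of 1+u against e^{-yu} costs a power of 1+1/y. The
constants do not depend on y or M. The factor 1+|t| allows g to be a difference of exponentials. -/
theorem exists_seminorm_le {χ : ℝ → ℂ} (hχ : χ.HasTemperateGrowth) {s : ℝ}
    (hχ0 : ∀ t < s, χ t = 0) (K N : ℕ) :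
    ∃ (C : ℝ) (b : ℕ), 0 ≤ C ∧ ∀ (φ : 𝓢(ℝ, ℂ)) (g : ℝ → ℂ) (y M : ℝ), 0 < y → 0 ≤ M →
      ContDiff ℝ ∞ g → (∀ t, φ t = χ t * g t) →
      (∀ n ≤ N, ∀ t, s ≤ t →
        ‖iteratedDeriv n g t‖ ≤ M * (1 + |t|) * Real.exp (-(y * t))) →
      ∀ k ≤ K, ∀ n ≤ N, SchwartzMap.seminorm ℂ k n φ ≤
        C * M * Real.exp (-(y * s)) * (1 + 1 / y) ^ b := by
  obtain ⟨m, D, hD0, hD⟩ := hχ.norm_iteratedFDeriv_le_uniform N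
  set b := K + m + 1
  refine ⟨2 ^ N * D * ((1 + |s|) ^ b * (2 ^ b * (1 + (b.factorial : ℝ)))), b, by positivity,
    fun φ g y M hy hM hg hφ hgb k hk n hn => ?_⟩
  refine SchwartzMap.seminorm_le_bound ℂ k n φ (by positivity) fun t => ?_
  have hφ' : (φ : ℝ → ℂ) = fun t => χ t * g t := funext hφ
  rcases lt_or_ge t s with ht | ht
  · have hz0 : iteratedFDeriv ℝ n φ t = 0 := by
      have hev : (φ : ℝ → ℂ) =ᶠ[𝓝 t] fun _ => (0 : ℂ) := by
        filter_upwards [Iio_mem_nhds ht] with r hr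
        rw [hφ, hχ0 r hr, zero_mul]
      rw [(hev.iteratedFDeriv ℝ n).eq_of_nhds]
      simp
    rw [hz0, norm_zero, mul_zero]
    positivity
  · have h1 : ‖iteratedFDeriv ℝ n φ t‖ ≤
        2 ^ N * (D * (1 + |t|) ^ m * (M * (1 + |t|) * Real.exp (-(y * t)))) := by
      rw [hφ']
      refine (norm_iteratedFDeriv_mul_le hχ.1 hg t (n := n) (by exact_mod_cast le_top)).trans ?_
      have hsum : ∑ i ∈ Finset.range (n + 1), (n.choose i : ℝ) = 2 ^ n := by
        exact_mod_cast Nat.sum_range_choose n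
      calc _ ≤ ∑ i ∈ Finset.range (n + 1), (n.choose i : ℝ) *
            (D * (1 + |t|) ^ m * (M * (1 + |t|) * Real.exp (-(y * t)))) := by
            refine Finset.sum_le_sum fun i hi => ?_
            have hi' : i ≤ n := Nat.lt_succ_iff.1 (Finset.mem_range.1 hi)
            rw [mul_assoc]
            refine mul_le_mul_of_nonneg_left (mul_le_mul ?_ ?_ (norm_nonneg _) (by positivity))
              (by positivity)
            · simpa using hD i (hi'.trans hn) t
            · rw [norm_iteratedFDeriv_eq_norm_iteratedDeriv]
              exact hgb _ ((Nat.sub_le _ _).trans hn) t ht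
        _ = 2 ^ n * (D * (1 + |t|) ^ m * (M * (1 + |t|) * Real.exp (-(y * t)))) := by
            rw [← Finset.sum_mul, hsum]
        _ ≤ _ := by
            gcongr
            norm_num
    have h2 : ‖t‖ ^ k ≤ (1 + |t|) ^ K := by
      rw [Real.norm_eq_abs]
      calc |t| ^ k ≤ (1 + |t|) ^ k := by gcongr; linarith
        _ ≤ (1 + |t|) ^ K := pow_le_pow_right₀ (by linarith [abs_nonneg t]) hk
    have hu : 0 ≤ t - s := by linarith
    have h3 : 1 + |t| ≤ (1 + |s|) * (1 + (t - s)) := by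
      have : |t| ≤ |t - s| + |s| := by simpa using abs_add_le (t - s) s
      rw [abs_of_nonneg hu] at this
      nlinarith [mul_nonneg (abs_nonneg s) hu]
    have h4 := one_add_pow_mul_exp_neg_le b hy hu
    have h5 : Real.exp (-(y * t)) = Real.exp (-(y * (t - s))) * Real.exp (-(y * s)) := by
      rw [← Real.exp_add]; congr 1; ring
    calc ‖t‖ ^ k * ‖iteratedFDeriv ℝ n φ t‖ ≤ (1 + |t|) ^ K *
          (2 ^ N * (D * (1 + |t|) ^ m * (M * (1 + |t|) * Real.exp (-(y * t))))) :=
          mul_le_mul h2 h1 (norm_nonneg _) (by positivity)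
      _ = 2 ^ N * D * M * (1 + |t|) ^ b * Real.exp (-(y * t)) := by
          simp only [b, pow_add, pow_one]; ring
      _ ≤ 2 ^ N * D * M * ((1 + |s|) * (1 + (t - s))) ^ b * Real.exp (-(y * t)) := by gcongr
      _ = 2 ^ N * D * M * (1 + |s|) ^ b * ((1 + (t - s)) ^ b * Real.exp (-(y * (t - s)))) *
          Real.exp (-(y * s)) := by rw [h5, mul_pow]; ring
      _ ≤ 2 ^ N * D * M * (1 + |s|) ^ b * (2 ^ b * (1 + (b.factorial : ℝ)) * (1 + 1 / y) ^ b) *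
          Real.exp (-(y * s)) := by gcongr
      _ = _ := by ring

theorem exists_norm_apply_le (T : 𝓢'(ℝ, ℂ)) :
    ∃ (s : Finset (ℕ × ℕ)) (C : ℝ), 0 ≤ C ∧ ∀ φ : 𝓢(ℝ, ℂ),
      ∀ M : ℝ, 0 ≤ M → (∀ i ∈ s, SchwartzMap.seminorm ℂ i.1 i.2 φ ≤ M) → ‖T φ‖ ≤ C * M := by
  obtain ⟨s, C, -, h⟩ := Seminorm.bound_of_continuous (schwartz_withSeminorms ℂ ℝ ℂ)
    ((normSeminorm ℂ ℂ).comp (T : 𝓢(ℝ, ℂ) →ₗ[ℂ] ℂ)) (by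
      exact continuous_norm.comp (map_continuous T))
  refine ⟨s, C, C.2, fun φ M hM hφ => (h φ).trans ?_⟩
  rw [smul_apply, NNReal.smul_def, smul_eq_mul]
  exact mul_le_mul_of_nonneg_left (Seminorm.finset_sup_apply_le hM hφ) C.2

/-- The continuity of a distribution on the cut-offs of exponentially decreasing functions. -/
theorem exists_norm_apply_cutoff_le (T : 𝓢'(ℝ, ℂ)) {χ : ℝ → ℂ} (hχ : χ.HasTemperateGrowth) {s : ℝ}
    (hχ0 : ∀ t < s, χ t = 0) :
    ∃ (C : ℝ) (N b : ℕ), 0 ≤ C ∧ ∀ (φ : 𝓢(ℝ, ℂ)) (g : ℝ → ℂ) (y M : ℝ), 0 < y → 0 ≤ M →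
      ContDiff ℝ ∞ g → (∀ t, φ t = χ t * g t) →
      (∀ n ≤ N, ∀ t, s ≤ t →
        ‖iteratedDeriv n g t‖ ≤ M * (1 + |t|) * Real.exp (-(y * t))) →
      ‖T φ‖ ≤ C * M * Real.exp (-(y * s)) * (1 + 1 / y) ^ b := by
  obtain ⟨S, C, hC, hT⟩ := exists_norm_apply_le T
  set K := S.sup Prod.fst
  set N := S.sup Prod.snd
  obtain ⟨D, b, hD, h⟩ := exists_seminorm_le hχ hχ0 K N
  refine ⟨C * D, N, b, by positivity, fun φ g y M hy hM hg hφ hgb => ?_⟩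
  refine (hT φ _ (by positivity) fun i hi => h φ g y M hy hM hg hφ hgb i.1
    (Finset.le_sup (f := Prod.fst) hi) i.2 (Finset.le_sup (f := Prod.snd) hi)).trans
    (le_of_eq ?_)
  ring

/-! ### Smooth steps and the growth of the transform. -/

theorem norm_iteratedDeriv_cexp_le {z : ℂ} {n N : ℕ} (hn : n ≤ N) (t : ℝ) :
    ‖iteratedDeriv n (fun t : ℝ => cexp (I * z * t)) t‖ ≤
      (1 + ‖z‖) ^ N * (1 + |t|) * Real.exp (-(z.im * t)) := by
  rw [iteratedDeriv_cexp_line, norm_mul, norm_pow, norm_mul, norm_I, one_mul, norm_cexp_I_mul,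
    neg_mul]
  have h1 : ‖z‖ ^ n ≤ (1 + ‖z‖) ^ N := by
    calc ‖z‖ ^ n ≤ (1 + ‖z‖) ^ n := by gcongr; linarith
      _ ≤ (1 + ‖z‖) ^ N := pow_le_pow_right₀ (by linarith [norm_nonneg z]) hn
  gcongr
  calc ‖z‖ ^ n ≤ (1 + ‖z‖) ^ N * 1 := by simpa using h1
    _ ≤ _ := by gcongr; linarith [abs_nonneg t]

theorem expTest_eq {z : ℂ} (hz : 0 < z.im) (t : ℝ) :
    expTest z t = cutoff t * cexp (I * z * t) := by
  rw [expTest, dif_pos hz]; rfl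

/-- A smooth step from `0` to `1` on the interval `[a, b]`. -/
def smoothStep (a b t : ℝ) : ℂ := cutoff ((t - a) / (b - a) - 2)

theorem smoothStep_temperate (a b : ℝ) : (smoothStep a b).HasTemperateGrowth := by
  refine Function.HasTemperateGrowth.comp cutoff_temperate (f := fun t => (t - a) / (b - a) - 2) ?_
  have h1 : (fun t : ℝ => (t - a) / (b - a) - 2) =
      (fun t : ℝ => (b - a)⁻¹ • t) - fun _ => a * (b - a)⁻¹ + 2 := by
    ext t; simp only [Pi.sub_apply, smul_eq_mul]; ring
  rw [h1]
  exact (((b - a)⁻¹ • ContinuousLinearMap.id ℝ ℝ).hasTemperateGrowth).sub (.const _)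

theorem smoothStep_eq_zero {a b t : ℝ} (hab : a < b) (ht : t ≤ a) : smoothStep a b t = 0 :=
  cutoff_eq_zero (by
    have : (t - a) / (b - a) ≤ 0 := div_nonpos_of_nonpos_of_nonneg (by linarith) (by linarith)
    linarith)

theorem smoothStep_eq_one {a b t : ℝ} (hab : a < b) (ht : b ≤ t) : smoothStep a b t = 1 :=
  cutoff_eq_one (by
    have : 1 ≤ (t - a) / (b - a) := (one_le_div (by linarith)).2 (by linarith)
    linarith)

/-- The difference φ - χφ is supported in (-∞, b], where T vanishes. -/
theorem apply_smulLeft_eq {T : 𝓢'(ℝ, ℂ)} {s b : ℝ} (hT : Distribution.IsVanishingOn T (Iio s))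
    (hb : b < s) {χ : ℝ → ℂ} (hχ : χ.HasTemperateGrowth) (hχ1 : ∀ t, b ≤ t → χ t = 1)
    (φ : 𝓢(ℝ, ℂ)) : T (SchwartzMap.smulLeftCLM ℂ χ φ) = T φ := by
  rw [← sub_eq_zero, ← map_sub]
  refine hT _ ((closure_minimal (fun t ht => ?_) isClosed_Iic).trans (Iic_subset_Iio.2 hb))
  by_contra h
  refine ht ?_
  rw [sub_apply, SchwartzMap.smulLeftCLM_apply_apply hχ, hχ1 t (not_le.1 h).le,
    one_smul, sub_self]

/-- The growth of the Fourier transform of a distribution supported in `[s, ∞)`. -/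
theorem exists_norm_fourierHat_le {T : 𝓢'(ℝ, ℂ)} {s a : ℝ}
    (hT : Distribution.IsVanishingOn T (Iio s)) (ha : -1 ≤ a) (has : a < s) :
    ∃ (C : ℝ) (N b : ℕ), 0 ≤ C ∧ ∀ z ∈ upperHalf, ‖fourierHat T z‖ ≤
      C * (1 + ‖z‖) ^ N * Real.exp (-(z.im * a)) * (1 + 1 / z.im) ^ b := by
  -- A step rising between a and (a+s)/2 < s does not change the value of T, but makes the test
  -- function start at a, which yields e^{-a Im z}. The condition a ≥ -1 keeps the start within the
  -- range where the test function is the pure exponential.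
  have hab : a < (a + s) / 2 := by linarith
  have hχ := smoothStep_temperate a ((a + s) / 2)
  have hχ0 : ∀ t < a, smoothStep a ((a + s) / 2) t = 0 := fun t ht => smoothStep_eq_zero hab ht.le
  obtain ⟨C, N, b, hC, h⟩ := exists_norm_apply_cutoff_le T hχ hχ0
  refine ⟨C, N, b, hC, fun z hz => ?_⟩
  rw [fourierHat, ← apply_smulLeft_eq hT (by linarith : (a + s) / 2 < s) hχ
    fun t ht => smoothStep_eq_one hab ht]
  refine h _ (fun t => cexp (I * z * t)) z.im _ hz (by positivity) (cexp_contDiff z) (fun t => ?_)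
    fun n hn t _ => norm_iteratedDeriv_cexp_le hn t
  rw [SchwartzMap.smulLeftCLM_apply_apply hχ, smul_eq_mul]
  rcases lt_or_ge t (-1) with ht | ht
  · rw [hχ0 t (by linarith), zero_mul, zero_mul]
  · rw [expTest_apply hz ht]

/-! ### Tempered distributions commute with integrals -/

theorem derivCLM_pow_apply (n : ℕ) (φ : 𝓢(ℝ, ℂ)) (t : ℝ) :
    (SchwartzMap.derivCLM ℂ ℂ ^ n) φ t = iteratedDeriv n φ t := by
  induction n generalizing t with
  | zero => simp
  | succ n ih =>
    rw [pow_succ', mul_apply_eq_comp, SchwartzMap.derivCLM_apply, iteratedDeriv_succ]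
    congr 1
    exact funext ih

/-- The function `t ↦ t ^ k * φ⁽ⁿ⁾ t`, as a bounded continuous function. -/
def weightedDerivCLM (k n : ℕ) : 𝓢(ℝ, ℂ) →L[ℂ] BoundedContinuousFunction ℝ ℂ :=
  (SchwartzMap.toBoundedContinuousFunctionCLM ℂ ℝ ℂ).comp
    ((SchwartzMap.smulLeftCLM ℂ (fun t : ℝ => (t : ℂ) ^ k)).comp (SchwartzMap.derivCLM ℂ ℂ ^ n))

theorem ofReal_pow_temperate (k : ℕ) : (fun t : ℝ => (t : ℂ) ^ k).HasTemperateGrowth :=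
  Function.HasTemperateGrowth.pow Function.Complex.hasTemperateGrowth_ofReal k

theorem weightedDerivCLM_apply (k n : ℕ) (φ : 𝓢(ℝ, ℂ)) (t : ℝ) :
    weightedDerivCLM k n φ t = (t : ℂ) ^ k * iteratedDeriv n φ t := by
  rw [weightedDerivCLM, ContinuousLinearMap.comp_apply, ContinuousLinearMap.comp_apply,
    SchwartzMap.toBoundedContinuousFunctionCLM_apply,
    SchwartzMap.smulLeftCLM_apply_apply (ofReal_pow_temperate k), derivCLM_pow_apply, smul_eq_mul]

theorem seminorm_le_norm_weightedDerivCLM (k n : ℕ) (φ : 𝓢(ℝ, ℂ)) :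
    SchwartzMap.seminorm ℂ k n φ ≤ ‖weightedDerivCLM k n φ‖ := by
  refine SchwartzMap.seminorm_le_bound' ℂ k n φ (norm_nonneg _) fun t => ?_
  have := (weightedDerivCLM k n φ).norm_coe_le_norm t
  rwa [weightedDerivCLM_apply, norm_mul, norm_pow, norm_real, Real.norm_eq_abs] at this

theorem norm_weightedDerivCLM_le (k n : ℕ) (φ : 𝓢(ℝ, ℂ)) :
    ‖weightedDerivCLM k n φ‖ ≤ SchwartzMap.seminorm ℂ k n φ := by
  refine (BoundedContinuousFunction.norm_le (apply_nonneg _ _)).2 fun t => ?_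
  rw [weightedDerivCLM_apply, norm_mul, norm_pow, norm_real, Real.norm_eq_abs]
  exact SchwartzMap.le_seminorm' ℂ k n φ t

/-- A tempered distribution factors through finitely many weighted derivatives. -/
theorem exists_factorization (T : 𝓢'(ℝ, ℂ)) :
    ∃ (s : Finset (ℕ × ℕ)) (Λ : (s → BoundedContinuousFunction ℝ ℂ) →L[ℂ] ℂ), ∀ φ : 𝓢(ℝ, ℂ),
      T φ = Λ fun i => weightedDerivCLM i.1.1 i.1.2 φ := by
  obtain ⟨s₀, C, hC, hT⟩ := exists_norm_apply_le T
  -- The index (0, 0) makes φ recoverable from its image, so that T descends to a bounded functional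
  -- on the range of J; Hahn-Banach then extends it to the whole product.
  set s := insert (0, 0) s₀
  let J : 𝓢(ℝ, ℂ) →L[ℂ] (s → BoundedContinuousFunction ℝ ℂ) :=
    ContinuousLinearMap.pi fun i => weightedDerivCLM i.1.1 i.1.2
  have hJ : Function.Injective (J : 𝓢(ℝ, ℂ) →ₗ[ℂ] (s → BoundedContinuousFunction ℝ ℂ)) := by
    intro φ ψ h
    ext t
    have h1 := congrFun h ⟨(0, 0), Finset.mem_insert_self _ _⟩
    have h2 : weightedDerivCLM 0 0 φ t = weightedDerivCLM 0 0 ψ t := by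
      exact congrArg (fun f : BoundedContinuousFunction ℝ ℂ => f t) h1
    simpa [weightedDerivCLM_apply] using h2
  let eq := LinearEquiv.ofInjective _ hJ
  let f₀ : LinearMap.range (J : 𝓢(ℝ, ℂ) →ₗ[ℂ] (s → BoundedContinuousFunction ℝ ℂ)) →ₗ[ℂ] ℂ :=
    (T : 𝓢(ℝ, ℂ) →ₗ[ℂ] ℂ).comp (eq.symm : _ →ₗ[ℂ] 𝓢(ℝ, ℂ))
  have hf₀ : ∀ φ, f₀ (eq φ) = T φ := fun φ => by
    simp [f₀]
  have hbound : ∀ x, ‖f₀ x‖ ≤ C * ‖x‖ := by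
    intro x
    obtain ⟨φ, rfl⟩ := eq.surjective x
    rw [hf₀]
    refine hT φ _ (norm_nonneg _) fun i hi => ?_
    refine (seminorm_le_norm_weightedDerivCLM i.1 i.2 φ).trans ?_
    exact norm_le_pi_norm (J φ) ⟨i, Finset.mem_insert_of_mem hi⟩
  obtain ⟨Λ, hΛ, -⟩ := exists_extension_norm_eq _ (f₀.mkContinuous C hbound)
  refine ⟨s, Λ, fun φ => ?_⟩
  have := hΛ (eq φ)
  rw [LinearMap.mkContinuous_apply, hf₀] at this
  exact this.symm

theorem iteratedDeriv_eq_integral {e : ℝ → 𝓢(ℝ, ℂ)} (he : Continuous e)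
    (hint : ∀ k n, Integrable fun x => SchwartzMap.seminorm ℂ k n (e x)) {Φ : 𝓢(ℝ, ℂ)}
    (hΦ : ∀ t, Φ t = ∫ x, e x t) (n : ℕ) (t : ℝ) :
    iteratedDeriv n Φ t = ∫ x, iteratedDeriv n (e x) t := by
  have hcont : ∀ (n : ℕ) (t : ℝ), Continuous fun x => iteratedDeriv n (e x) t := by
    intro n t
    have h1 : Continuous fun x => weightedDerivCLM 0 n (e x) := (map_continuous _).comp he
    have h2 := (BoundedContinuousFunction.evalCLM ℂ t).continuous.comp h1
    refine h2.congr fun x => ?_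
    simp [weightedDerivCLM_apply]
  have hle : ∀ n t x, ‖iteratedDeriv n (e x) t‖ ≤ SchwartzMap.seminorm ℂ 0 n (e x) := by
    intro n t x
    simpa using SchwartzMap.le_seminorm' ℂ 0 n (e x) t
  induction n generalizing t with
  | zero => simpa using hΦ t
  | succ n ih =>
    rw [iteratedDeriv_succ, show iteratedDeriv n Φ = fun t => ∫ x, iteratedDeriv n (e x) t from
      funext ih]
    refine (hasDerivAt_integral_of_dominated_loc_of_deriv_le (s := univ) univ_mem
      (Eventually.of_forall fun t => (hcont n t).aestronglyMeasurable)
      ((hint 0 n).mono' (hcont n t).aestronglyMeasurable (ae_of_all _ (hle n t)))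
      (F' := fun t x => iteratedDeriv (n + 1) (e x) t) (hcont (n + 1) t).aestronglyMeasurable
      (ae_of_all _ fun x t _ => hle (n + 1) t x) (hint 0 (n + 1))
      (ae_of_all _ fun x t _ => ?_)).2.deriv
    have h1 : iteratedDeriv n (e x) = (SchwartzMap.derivCLM ℂ ℂ ^ n) (e x) :=
      funext fun t => (derivCLM_pow_apply n (e x) t).symm
    rw [iteratedDeriv_succ, h1]
    exact (SchwartzMap.hasDerivAt _ t)

/-- A tempered distribution commutes with the integral of a continuous family of Schwartz
functions. -/
theorem apply_eq_integral (T : 𝓢'(ℝ, ℂ)) {e : ℝ → 𝓢(ℝ, ℂ)} (he : Continuous e)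
    (hint : ∀ k n, Integrable fun x => SchwartzMap.seminorm ℂ k n (e x)) {Φ : 𝓢(ℝ, ℂ)}
    (hΦ : ∀ t, Φ t = ∫ x, e x t) : T Φ = ∫ x, T (e x) := by
  obtain ⟨s, Λ, hΛ⟩ := exists_factorization T
  have hi : ∀ k n, Integrable fun x => weightedDerivCLM k n (e x) := fun k n =>
    (hint k n).mono' ((map_continuous _).comp he).aestronglyMeasurable
      (ae_of_all _ fun x => norm_weightedDerivCLM_le k n (e x))
  -- The Bochner integral is taken in a finite product of Banach spaces, through which T factors,
  -- instead of in the Schwartz space.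
  have hi' : Integrable fun x => fun i : s => weightedDerivCLM i.1.1 i.1.2 (e x) :=
    Integrable.of_eval fun i => hi _ _
  have h0 : ∫ x, T (e x) = Λ (∫ x, fun i : s => weightedDerivCLM i.1.1 i.1.2 (e x)) := by
    rw [← Λ.integral_comp_comm hi']
    exact integral_congr_ae (ae_of_all _ fun x => hΛ (e x))
  rw [h0, hΛ]
  congr 1
  ext i t
  have h2 := (ContinuousLinearMap.proj (R := ℂ)
    (φ := fun _ : s => BoundedContinuousFunction ℝ ℂ) i).integral_comp_comm hi'
  have h1 := (BoundedContinuousFunction.evalCLM ℂ t).integral_comp_comm (hi i.1.1 i.1.2)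
  simp only [BoundedContinuousFunction.evalCLM_apply] at h1
  simp only [ContinuousLinearMap.proj_apply] at h2
  rw [← h2, ← h1, weightedDerivCLM_apply, iteratedDeriv_eq_integral he hint hΦ,
    ← integral_const_mul]
  exact integral_congr_ae (ae_of_all _ fun x => (weightedDerivCLM_apply _ _ _ _).symm)

/-! ### The Paley-Wiener theorem for the support -/

theorem cutoff_eq_zero' : ∀ t < (-2 : ℝ), cutoff t = 0 := fun _ ht => cutoff_eq_zero ht.le

theorem hasDerivAt_pow_mul_cexp (c t : ℝ) (n : ℕ) (r : ℝ) :
    HasDerivAt (fun r : ℝ => (I * (r + c * I)) ^ n * cexp (I * (r + c * I) * t))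
      (n * (I * (r + c * I)) ^ (n - 1) * I * cexp (I * (r + c * I) * t) +
        (I * (r + c * I)) ^ n * (cexp (I * (r + c * I) * t) * (I * t))) r := by
  have h0 : HasDerivAt (fun r : ℝ => I * ((r : ℂ) + c * I)) I r := by
    simpa using ((Complex.ofRealCLM.hasDerivAt (x := r)).add_const ((c : ℂ) * I)).const_mul I
  have h1 := (h0.fun_pow n).mul ((h0.mul_const (t : ℂ)).cexp)
  exact h1

/-- Every seminorm is Lipschitz near x₀: the mean value inequality in x bounds the differences of
the t-derivatives (iz)^j e^{izt}, and differentiating in x costs a factor t, which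
`exists_seminorm_le` admits. -/
theorem continuous_expTest {c : ℝ} (hc : 0 < c) : Continuous fun x : ℝ => expTest (x + c * I) := by
  have him : ∀ x : ℝ, 0 < ((x : ℂ) + c * I).im := fun x => by simpa using hc
  rw [continuous_iff_continuousAt]
  intro x₀
  refine ((schwartz_withSeminorms ℂ ℝ ℂ).tendsto_nhds _ _).2 fun ⟨k, n⟩ ε hε => ?_
  obtain ⟨C, b, hC, h⟩ := exists_seminorm_le cutoff_temperate cutoff_eq_zero' k n
  set R := 1 + (|x₀| + 1 + c)
  have hR : 1 ≤ R := by
    have := abs_nonneg x₀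
    simp only [R]; linarith
  set B := C * ((n + 1) * R ^ n) * Real.exp (-(c * -2)) * (1 + 1 / c) ^ b
  have hB : 0 ≤ B := by positivity
  have key : ∀ x : ℝ, |x - x₀| ≤ 1 →
      SchwartzMap.seminorm ℂ k n (expTest (x + c * I) - expTest (x₀ + c * I)) ≤
        B * |x - x₀| := by
    intro x hx
    refine (h _ (fun t => cexp (I * (x + c * I) * t) - cexp (I * (x₀ + c * I) * t)) c
      ((n + 1) * R ^ n * |x - x₀|) hc (by positivity)
      ((cexp_contDiff _).sub (cexp_contDiff _)) (fun t => ?_) (fun j hj t _ => ?_) k le_rfl n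
      le_rfl).trans (le_of_eq ?_)
    · rw [sub_apply, expTest_eq (him x), expTest_eq (him x₀), mul_sub]
    · rw [iteratedDeriv_fun_sub ((cexp_contDiff _).contDiffAt.of_le (by exact_mod_cast le_top))
        ((cexp_contDiff _).contDiffAt.of_le (by exact_mod_cast le_top)), iteratedDeriv_cexp_line, iteratedDeriv_cexp_line]
      have h1 := Convex.norm_image_sub_le_of_norm_hasDerivWithin_le (s := uIcc x₀ x)
        (C := (n + 1) * R ^ n * (1 + |t|) * Real.exp (-(c * t)))
        (fun r _ => (hasDerivAt_pow_mul_cexp c t j r).hasDerivWithinAt) (fun r hr => ?_)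
        (convex_uIcc _ _) left_mem_uIcc right_mem_uIcc
      · refine h1.trans (le_of_eq ?_)
        rw [Real.norm_eq_abs]; ring
      · have hr1 : |r| ≤ |x₀| + 1 := by
          have h2 := abs_sub_left_of_mem_uIcc hr
          have h3 : |r| ≤ |r - x₀| + |x₀| := by simpa using abs_add_le (r - x₀) x₀
          linarith
        have hz : ‖I * ((r : ℂ) + c * I)‖ ≤ R := by
          rw [norm_mul, norm_I, one_mul]
          refine (norm_add_le _ _).trans ?_
          rw [norm_mul, norm_I, norm_real, norm_real, Real.norm_eq_abs, Real.norm_eq_abs,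
            abs_of_pos hc]
          simp only [R]; linarith
        have hp : ∀ i ≤ n, ‖I * ((r : ℂ) + c * I)‖ ^ i ≤ R ^ n := fun i hi =>
          (pow_le_pow_left₀ (norm_nonneg _) hz i).trans (pow_le_pow_right₀ hR hi)
        have he : ‖cexp (I * ((r : ℂ) + c * I) * t)‖ = Real.exp (-(c * t)) := by
          rw [norm_cexp_I_mul]; simp
        refine (norm_add_le _ _).trans ?_
        simp only [norm_mul, norm_pow, he, norm_I, norm_real, Real.norm_eq_abs, mul_one, one_mul]
        have e1 := hp (j - 1) (by omega)
        have e2 := hp j hj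
        rw [norm_mul, norm_I, one_mul] at e1 e2
        have e3 : ‖(j : ℂ)‖ ≤ n := by simpa using hj
        calc _ ≤ (n : ℝ) * R ^ n * Real.exp (-(c * t)) +
              R ^ n * (Real.exp (-(c * t)) * |t|) := by gcongr
          _ = R ^ n * Real.exp (-(c * t)) * (n + |t|) := by ring
          _ ≤ R ^ n * Real.exp (-(c * t)) * ((n + 1) * (1 + |t|)) := by
            gcongr
            nlinarith [abs_nonneg t, (Nat.cast_nonneg n : (0 : ℝ) ≤ n),
              mul_nonneg (Nat.cast_nonneg n : (0 : ℝ) ≤ n) (abs_nonneg t)]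
          _ = _ := by ring
    · simp only [B]; ring
  have hlim : Tendsto (fun x => B * |x - x₀|) (𝓝 x₀) (𝓝 0) := by
    have : Continuous fun x => B * |x - x₀| := by fun_prop
    simpa using this.tendsto x₀
  filter_upwards [hlim.eventually (gt_mem_nhds hε), Metric.closedBall_mem_nhds x₀ one_pos]
    with x hx1 hx2
  exact (key x (by simpa [Real.dist_eq] using hx2)).trans_lt hx1

/-! ### Fourier inversion on horizontal lines. -/

theorem integral_deriv_mul_cexp {φ : 𝓢(ℝ, ℂ)} (hφ : HasCompactSupport φ) (z : ℂ) :
    ∫ t : ℝ, SchwartzMap.derivCLM ℂ ℂ φ t * cexp (-I * z * t) =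
      I * z * ∫ t : ℝ, φ t * cexp (-I * z * t) := by
  have hc : Continuous fun t : ℝ => cexp (-I * z * t) := by fun_prop
  have hφ' : HasCompactSupport (SchwartzMap.derivCLM ℂ ℂ φ) :=
    hφ.of_isClosed_subset (isClosed_tsupport _) (SchwartzMap.tsupport_derivCLM_subset ℂ φ)
  have hv : ∀ t : ℝ, HasDerivAt (fun t : ℝ => cexp (-I * z * t))
      (-I * z * cexp (-I * z * t)) t := by
    intro t
    have h0 : HasDerivAt (fun s : ℝ => -I * z * (s : ℂ)) (-I * z * 1) t :=
      (Complex.ofRealCLM.hasDerivAt (x := t)).const_mul (-I * z)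
    exact h0.cexp.congr_deriv (by ring)
  have h := integral_mul_deriv_eq_deriv_mul_of_integrable (fun t _ => φ.hasDerivAt t)
    (fun t _ => hv t)
    ((φ.continuous.mul (continuous_const.mul hc)).integrable_of_hasCompactSupport hφ.mul_right)
    (((SchwartzMap.derivCLM ℂ ℂ φ).continuous.mul hc).integrable_of_hasCompactSupport
      hφ'.mul_right)
    ((φ.continuous.mul hc).integrable_of_hasCompactSupport hφ.mul_right)
  have h2 : ∫ t : ℝ, φ t * (-I * z * cexp (-I * z * t)) =
      -(I * z) * ∫ t : ℝ, φ t * cexp (-I * z * t) := by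
    rw [← integral_const_mul]
    congr 1; ext t; ring
  rw [h2] at h
  simp only [SchwartzMap.derivCLM_apply]
  linear_combination h

theorem integral_derivCLM_pow_mul_cexp {φ : 𝓢(ℝ, ℂ)} (hφ : HasCompactSupport φ) (z : ℂ) (n : ℕ) :
    tsupport ((SchwartzMap.derivCLM ℂ ℂ ^ n) φ) ⊆ tsupport φ ∧
    ∫ t : ℝ, (SchwartzMap.derivCLM ℂ ℂ ^ n) φ t * cexp (-I * z * t) =
      (I * z) ^ n * ∫ t : ℝ, φ t * cexp (-I * z * t) := by
  induction n with
  | zero => simp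
  | succ n ih =>
    simp only [pow_succ', mul_apply_eq_comp]
    refine ⟨(SchwartzMap.tsupport_derivCLM_subset ℂ _).trans ih.1, ?_⟩
    rw [integral_deriv_mul_cexp (hφ.of_isClosed_subset (isClosed_tsupport _) ih.1), ih.2]
    ring

/-- Each integration by parts produces a factor iz, and |e^{-izt}| ≤ e^{b Im z} on the support. -/
theorem exists_norm_pow_mul_integral_le {φ : 𝓢(ℝ, ℂ)} (hφ : HasCompactSupport φ) {b : ℝ}
    (hb : tsupport φ ⊆ Iic b) (n : ℕ) :
    ∃ D : ℝ, 0 ≤ D ∧ ∀ z : ℂ, 0 ≤ z.im →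
      ‖z‖ ^ n * ‖∫ t : ℝ, φ t * cexp (-I * z * t)‖ ≤ D * Real.exp (b * z.im) := by
  refine ⟨∫ t : ℝ, ‖(SchwartzMap.derivCLM ℂ ℂ ^ n) φ t‖, integral_nonneg fun _ => norm_nonneg _,
    fun z hz => ?_⟩
  obtain ⟨h1, h2⟩ := integral_derivCLM_pow_mul_cexp hφ z n
  have h3 : ‖z‖ ^ n * ‖∫ t : ℝ, φ t * cexp (-I * z * t)‖ =
      ‖∫ t : ℝ, (SchwartzMap.derivCLM ℂ ℂ ^ n) φ t * cexp (-I * z * t)‖ := by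
    rw [h2, norm_mul, norm_pow, norm_mul, norm_I, one_mul]
  rw [h3, ← integral_mul_const]
  refine norm_integral_le_of_norm_le
    (((SchwartzMap.derivCLM ℂ ℂ ^ n) φ).integrable.norm.mul_const _) (ae_of_all _ fun t => ?_)
  by_cases ht : t ∈ tsupport ((SchwartzMap.derivCLM ℂ ℂ ^ n) φ)
  · have htb : t ≤ b := hb (h1 ht)
    have he : ‖cexp (-I * z * t)‖ = Real.exp (z.im * t) := by
      rw [Complex.norm_exp]; congr 1; simp
    rw [norm_mul, he]
    refine mul_le_mul_of_nonneg_left (Real.exp_le_exp.2 ?_) (norm_nonneg _)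
    rw [mul_comm]
    exact mul_le_mul_of_nonneg_right htb hz
  · rw [image_eq_zero_of_notMem_tsupport ht]; simp

/-- Fourier inversion for the test function φ(t) e^{ct}, with the frequency rescaled by 2π. -/
theorem two_pi_mul_eq_integral {φ : 𝓢(ℝ, ℂ)} (hφ : HasCompactSupport φ) (c : ℝ) :
    (Continuous fun x : ℝ => ∫ t : ℝ, φ t * cexp (-I * (x + c * I) * t)) ∧
    ∀ t : ℝ, 2 * Real.pi * φ t = ∫ x : ℝ, (∫ r : ℝ, φ r * cexp (-I * (x + c * I) * r)) *
      cexp (I * (x + c * I) * t) := by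
  have hk1 : HasCompactSupport fun t : ℝ => φ t * cexp (c * t) := hφ.mul_right
  have hk2 : ContDiff ℝ ∞ fun t : ℝ => φ t * cexp (c * t) :=
    (φ.smooth ⊤).mul (contDiff_const.mul Complex.ofRealCLM.contDiff).cexp
  set k : 𝓢(ℝ, ℂ) := hk1.toSchwartzMap hk2
  have hk : ∀ t : ℝ, k t = φ t * cexp (c * t) := fun t => rfl
  have hP : ∀ x : ℝ, ∫ t : ℝ, φ t * cexp (-I * (x + c * I) * t) =
      FourierTransform.fourier k (x / (2 * Real.pi)) := by
    intro x
    rw [SchwartzMap.fourier_coe, Real.fourier_real_eq_integral_exp_smul]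
    congr 1
    ext t
    rw [hk, smul_eq_mul, mul_left_comm, ← Complex.exp_add]
    congr 2
    have hpi : (Real.pi : ℂ) ≠ 0 := by exact_mod_cast Real.pi_ne_zero
    push_cast
    field_simp
    linear_combination -(c * t : ℂ) * I_mul_I
  refine ⟨?_, fun t => ?_⟩
  · simp_rw [hP]
    exact (FourierTransform.fourier k).continuous.comp (by fun_prop)
  · have h1 : FourierTransformInv.fourierInv (FourierTransform.fourier k) t = k t := by
      rw [FourierTransform.fourierInv_fourier_eq]
    rw [SchwartzMap.fourierInv_coe, Real.fourierInv_eq'] at h1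
    have h2 := Measure.integral_comp_div (fun w : ℝ => cexp ((2 * Real.pi * (w * t) : ℝ) * I) *
      FourierTransform.fourier k w) (2 * Real.pi)
    have h3 : ∫ w : ℝ, cexp ((2 * Real.pi * (w * t) : ℝ) * I) * FourierTransform.fourier k w =
        k t := by
      rw [← h1]
      congr 1
      ext w
      simp [mul_comm]
    rw [h3, abs_of_pos (by positivity), Complex.real_smul, hk] at h2
    have h4 : ∀ x : ℝ, (∫ r : ℝ, φ r * cexp (-I * (x + c * I) * r)) * cexp (I * (x + c * I) * t) =
        cexp ((2 * Real.pi * (x / (2 * Real.pi) * t) : ℝ) * I) *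
          FourierTransform.fourier k (x / (2 * Real.pi)) * cexp (-(c * t)) := by
      intro x
      rw [hP, mul_comm, mul_right_comm _ _ (cexp (-(c * t))), ← Complex.exp_add]
      congr 2
      have hpi : (Real.pi : ℂ) ≠ 0 := by exact_mod_cast Real.pi_ne_zero
      push_cast
      field_simp
      linear_combination (c * t : ℂ) * I_mul_I
    simp_rw [h4]
    rw [integral_mul_const, h2, Complex.exp_neg]
    have := Complex.exp_ne_zero (c * t)
    push_cast
    field_simp

/-- The value of a causal distribution on a test function, from its Fourier transform on a
horizontal line. -/
theorem two_pi_mul_apply_eq_integral (T : 𝓢'(ℝ, ℂ)) {φ : 𝓢(ℝ, ℂ)} (hφ : HasCompactSupport φ)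
    {c : ℝ} (hc : 0 < c) :
    2 * Real.pi * T (SchwartzMap.smulLeftCLM ℂ cutoff φ) =
      ∫ x : ℝ, (∫ t : ℝ, φ t * cexp (-I * (x + c * I) * t)) * fourierHat T (x + c * I) := by
  obtain ⟨hcont, hinv⟩ := two_pi_mul_eq_integral hφ c
  set P : ℝ → ℂ := fun x => ∫ t : ℝ, φ t * cexp (-I * (x + c * I) * t)
  have him : ∀ x : ℝ, ((x : ℂ) + c * I).im = c := fun x => by simp
  have hmem : ∀ x : ℝ, 0 < ((x : ℂ) + c * I).im := fun x => by rwa [him]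
  obtain ⟨b, hb⟩ : ∃ b, tsupport φ ⊆ Iic b := by
    obtain ⟨b, hb⟩ := hφ.isCompact.bddAbove
    exact ⟨b, fun t ht => hb ht⟩
  have he : Continuous fun x : ℝ => P x • expTest (x + c * I) := hcont.smul (continuous_expTest hc)
  have h := apply_eq_integral T (e := fun x : ℝ => P x • expTest (x + c * I)) he (fun k n => ?_)
    (Φ := (2 * Real.pi : ℂ) • SchwartzMap.smulLeftCLM ℂ cutoff φ) (fun t => ?_)
  · rw [map_smul, smul_eq_mul] at h
    rw [h]
    simp only [map_smul, smul_eq_mul, fourierHat, P]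
  · obtain ⟨C, m, hC, hm⟩ := exists_seminorm_le cutoff_temperate cutoff_eq_zero' k n
    obtain ⟨D₀, hD₀, h₀⟩ := exists_norm_pow_mul_integral_le hφ hb 0
    obtain ⟨D, hD, h₁⟩ := exists_norm_pow_mul_integral_le hφ hb (n + 2)
    set B := C * Real.exp (-(c * -2)) * (1 + 1 / c) ^ m with hB
    have hB0 : 0 ≤ B := by positivity
    have hsemi : ∀ x : ℝ, SchwartzMap.seminorm ℂ k n (expTest (x + c * I)) ≤
        B * (1 + ‖(x : ℂ) + c * I‖) ^ n := by
      intro x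
      refine (hm _ (fun t => cexp (I * (x + c * I) * t)) c ((1 + ‖(x : ℂ) + c * I‖) ^ n) hc
        (by positivity) (cexp_contDiff _) (fun t => expTest_eq (hmem x) t)
        (fun j hj t _ => ?_) k le_rfl n le_rfl).trans (le_of_eq ?_)
      · simpa [him] using norm_iteratedDeriv_cexp_le (z := x + c * I) hj t
      · rw [hB]; ring
    have hcontS : Continuous fun x : ℝ =>
        SchwartzMap.seminorm ℂ k n (P x • expTest (x + c * I)) :=
      ((schwartz_withSeminorms ℂ ℝ ℂ).continuous_seminorm (k, n)).comp he
    refine (integrable_inv_one_add_sq.const_mul (B * (2 ^ (n + 2) *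
      (D₀ * Real.exp (b * c) + D * Real.exp (b * c))))).mono' hcontS.aestronglyMeasurable
      (ae_of_all _ fun x => ?_)
    have h2 := h₀ (x + c * I) (hmem x).le
    have h3 := h₁ (x + c * I) (hmem x).le
    rw [pow_zero, one_mul, him] at h2
    rw [him] at h3
    have h4 : (1 + ‖(x : ℂ) + c * I‖) ^ (n + 2) ≤ 2 ^ (n + 2) * (1 + ‖(x : ℂ) + c * I‖ ^ (n + 2)) := by
      set u := ‖(x : ℂ) + c * I‖
      have hu : 0 ≤ u := norm_nonneg _
      rcases le_total u 1 with h | h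
      · calc (1 + u) ^ (n + 2) ≤ 2 ^ (n + 2) := by gcongr; linarith
          _ ≤ _ := le_mul_of_one_le_right (by positivity) (by simp; positivity)
      · calc (1 + u) ^ (n + 2) ≤ (2 * u) ^ (n + 2) := by gcongr; linarith
          _ = 2 ^ (n + 2) * u ^ (n + 2) := mul_pow _ _ _
          _ ≤ _ := by gcongr; linarith
    have h5 : 1 + x ^ 2 ≤ (1 + ‖(x : ℂ) + c * I‖) ^ 2 := by
      have : |x| ≤ ‖(x : ℂ) + c * I‖ := by simpa using abs_re_le_norm ((x : ℂ) + c * I)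
      nlinarith [abs_nonneg x, sq_abs x]
    rw [Real.norm_eq_abs, abs_of_nonneg (apply_nonneg _ _), map_smul_eq_mul, ← div_eq_mul_inv,
      le_div_iff₀ (by positivity)]
    calc ‖P x‖ * SchwartzMap.seminorm ℂ k n (expTest (x + c * I)) * (1 + x ^ 2)
        ≤ ‖P x‖ * (B * (1 + ‖(x : ℂ) + c * I‖) ^ n) * (1 + ‖(x : ℂ) + c * I‖) ^ 2 := by
          gcongr
          exact hsemi x
      _ = B * (‖P x‖ * (1 + ‖(x : ℂ) + c * I‖) ^ (n + 2)) := by ring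
      _ ≤ B * (‖P x‖ * (2 ^ (n + 2) * (1 + ‖(x : ℂ) + c * I‖ ^ (n + 2)))) := by gcongr
      _ = B * (2 ^ (n + 2) * (‖P x‖ + ‖(x : ℂ) + c * I‖ ^ (n + 2) * ‖P x‖)) := by ring
      _ ≤ _ := by gcongr
  · rw [smul_apply, SchwartzMap.smulLeftCLM_apply_apply cutoff_temperate, smul_eq_mul, smul_eq_mul,
      mul_left_comm, hinv t, ← integral_const_mul]
    congr 1
    ext x
    rw [smul_apply, smul_eq_mul, expTest_eq (hmem x)]
    ring

/-- The Paley-Wiener theorem for the lower end of the support. -/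
theorem isVanishingOn_of_norm_fourierHat_le {T : 𝓢'(ℝ, ℂ)} (hT : IsCausal T) {a C : ℝ} {m : ℕ}
    (hC : ∀ z : ℂ, 1 < z.im → ‖fourierHat T z‖ ≤ C * ‖z‖ ^ m * Real.exp (-(a * z.im))) :
    Distribution.IsVanishingOn T (Iio a) := by
  intro φ hφ
  have hcut : ∀ t : ℝ, -1 ≤ t → cutoff t = 1 := fun t => cutoff_eq_one
  set ψ := SchwartzMap.smulLeftCLM ℂ cutoff φ
  have hψ : T (SchwartzMap.smulLeftCLM ℂ cutoff ψ) = T φ := by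
    rw [apply_smulLeft_eq hT (by norm_num) cutoff_temperate hcut,
      apply_smulLeft_eq hT (by norm_num) cutoff_temperate hcut]
  have hψφ : tsupport ψ ⊆ tsupport φ := (SchwartzMap.tsupport_smulLeftCLM_subset _ _).trans
    inter_subset_left
  have hψ2 : tsupport ψ ⊆ Ici (-2) := by
    refine closure_minimal (fun t ht => ?_) isClosed_Ici
    by_contra h
    refine ht ?_
    rw [SchwartzMap.smulLeftCLM_apply_apply cutoff_temperate, cutoff_eq_zero (not_le.1 h).le,
      zero_smul]
  have hcomp : HasCompactSupport ψ := (isCompact_Icc (a := -2) (b := a)).of_isClosed_subset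
    (isClosed_tsupport _) fun t ht => ⟨hψ2 ht, (hφ (hψφ ht)).le⟩
  -- A compact support inside the open half-line ends strictly before a. The gap a - b provides the
  -- factor e^{-(a-b)c} that makes the integral vanish as the line is moved to infinity.
  obtain ⟨b, hba, hb⟩ : ∃ b < a, tsupport ψ ⊆ Iic b := by
    rcases (tsupport ψ).eq_empty_or_nonempty with h | h
    · exact ⟨a - 1, by linarith, by simp [h]⟩
    · obtain ⟨b, hb, hmax⟩ := hcomp.isCompact.exists_isMaxOn h continuous_id.continuousOn
      exact ⟨b, hφ (hψφ hb), fun t ht => hmax ht⟩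
  -- m powers absorb the growth of T̂, and two more make the integrand at most a multiple of
  -- 1/(1+x²).
  obtain ⟨D, hD, hbound⟩ := exists_norm_pow_mul_integral_le hcomp hb (m + 2)
  have key : ∀ c : ℝ, 1 < c → ‖2 * Real.pi * T φ‖ ≤
      D * |C| * Real.pi * Real.exp (-((a - b) * c)) := by
    intro c hc
    rw [← hψ, two_pi_mul_apply_eq_integral T hcomp (by linarith : 0 < c)]
    have h0 : D * |C| * Real.pi * Real.exp (-((a - b) * c)) =
        ∫ x : ℝ, D * |C| * Real.exp (-((a - b) * c)) * (1 + x ^ 2)⁻¹ := by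
      rw [integral_const_mul, integral_univ_inv_one_add_sq]; ring
    rw [h0]
    refine norm_integral_le_of_norm_le (integrable_inv_one_add_sq.const_mul _)
      (ae_of_all _ fun x => ?_)
    have him : ((x : ℂ) + c * I).im = c := by simp
    have h1 := hbound (x + c * I) (by rw [him]; linarith)
    have h2 := hC (x + c * I) (by rwa [him])
    rw [him] at h1 h2
    have hz : ‖(x : ℂ) + c * I‖ ^ 2 = x ^ 2 + c ^ 2 := by
      rw [Complex.sq_norm, Complex.normSq_apply]; simp; ring
    have hz0 : 0 < ‖(x : ℂ) + c * I‖ := by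
      refine norm_pos_iff.2 fun h => ?_
      have := congrArg Complex.im h
      rw [him] at this
      simp at this
      linarith
    have hz1 : 1 + x ^ 2 ≤ ‖(x : ℂ) + c * I‖ ^ 2 := by rw [hz]; nlinarith
    have h3 : ‖fourierHat T (x + c * I)‖ ≤
        |C| * ‖(x : ℂ) + c * I‖ ^ m * Real.exp (-(a * c)) := by
      refine h2.trans ?_
      gcongr
      exact le_abs_self C
    rw [norm_mul, ← div_eq_mul_inv, le_div_iff₀ (by positivity)]
    set u := ‖(x : ℂ) + c * I‖
    set p := ‖∫ t : ℝ, ψ t * cexp (-I * (x + c * I) * t)‖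
    have hp : 0 ≤ p := norm_nonneg _
    have hE : Real.exp (b * c) * Real.exp (-(a * c)) = Real.exp (-((a - b) * c)) := by
      rw [← Real.exp_add]; congr 1; ring
    calc p * ‖fourierHat T (x + c * I)‖ * (1 + x ^ 2)
        ≤ p * (|C| * u ^ m * Real.exp (-(a * c))) * u ^ 2 := by gcongr
      _ = |C| * Real.exp (-(a * c)) * (u ^ (m + 2) * p) := by ring
      _ ≤ |C| * Real.exp (-(a * c)) * (D * Real.exp (b * c)) := by gcongr
      _ = D * |C| * (Real.exp (b * c) * Real.exp (-(a * c))) := by ring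
      _ = _ := by rw [hE]
  have hlim : Tendsto (fun c : ℝ => D * |C| * Real.pi * Real.exp (-((a - b) * c))) atTop (𝓝 0) := by
    have h1 : Tendsto (fun c : ℝ => (a - b) * c) atTop atTop :=
      tendsto_id.const_mul_atTop (by linarith)
    simpa using (Real.tendsto_exp_neg_atTop_nhds_zero.comp h1).const_mul (D * |C| * Real.pi)
  have h0 : ‖2 * Real.pi * T φ‖ ≤ 0 := ge_of_tendsto hlim (by
    filter_upwards [eventually_gt_atTop 1] with c hc
    exact key c hc)
  have h1 := norm_le_zero_iff.1 h0
  have hpi : (2 * Real.pi : ℂ) ≠ 0 := by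
    have := Real.pi_ne_zero
    simp [this]
  exact (mul_eq_zero.1 h1).resolve_left hpi

/-- The lower end of the support of a tempered distribution. -/
theorem isLeast_dsupport {T : 𝓢'(ℝ, ℂ)} {a : ℝ} (hT : Distribution.IsVanishingOn T (Iio a))
    (hmax : ∀ s, a ≤ s → Distribution.IsVanishingOn T (Iio s) → s ≤ a) :
    IsLeast (Distribution.dsupport T) a := by
  refine ⟨?_, fun t ht => ?_⟩
  · by_contra h
    obtain ⟨S, hS, hSo, haS⟩ := (Distribution.notMem_dsupport_iff a).1 h
    obtain ⟨ε, hε, hball⟩ := Metric.isOpen_iff.1 hSo a haS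
    refine absurd (hmax (a + ε) (by linarith) fun φ hφ => ?_) (by linarith)
    -- The step rises inside (a-ε, a): φ - ψ is supported strictly to the left of a, and ψ inside
    -- the ball where T vanishes. Together they would let T vanish beyond a.
    have hab : a - 2 * ε / 3 < a - ε / 3 := by linarith
    have hstep := smoothStep_temperate (a - 2 * ε / 3) (a - ε / 3)
    set ψ := SchwartzMap.smulLeftCLM ℂ (smoothStep (a - 2 * ε / 3) (a - ε / 3)) φ
    have h1 : T (φ - ψ) = 0 := by
      refine hT _ ((closure_minimal (fun t ht => ?_) (isClosed_Iic (a := a - ε / 3))).trans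
        (Iic_subset_Iio.2 (by linarith)))
      by_contra h
      refine ht ?_
      rw [sub_apply, SchwartzMap.smulLeftCLM_apply_apply hstep,
        smoothStep_eq_one hab (not_le.1 h).le, one_smul, sub_self]
    have h2 : T ψ = 0 := by
      refine hS _ fun t ht => hball ?_
      have h3 : t ∈ tsupport φ := (SchwartzMap.tsupport_smulLeftCLM_subset _ _ ht).1
      have h4 : t ∈ Ici (a - 2 * ε / 3) := by
        refine closure_minimal (fun t ht => ?_) isClosed_Ici ht
        by_contra h
        refine ht ?_
        rw [SchwartzMap.smulLeftCLM_apply_apply hstep, smoothStep_eq_zero hab (not_le.1 h).le,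
          zero_smul]
      have h5 : t < a + ε := hφ h3
      rw [mem_Ici] at h4
      rw [Real.ball_eq_Ioo]
      exact ⟨by linarith, h5⟩
    rw [map_sub, h2, sub_zero] at h1
    exact h1
  · by_contra h
    exact (Distribution.notMem_dsupport_iff t).2 ⟨Iio a, hT, isOpen_Iio, not_le.1 h⟩ ht

/-- A zero-free analytic function on the upper half-plane has an analytic logarithm. -/
theorem exists_log {F : ℂ → ℂ} (hF : DifferentiableOn ℂ F upperHalf)
    (h0 : ∀ z ∈ upperHalf, F z ≠ 0) :
    ∃ L : ℂ → ℂ, DifferentiableOn ℂ L upperHalf ∧ ∀ z ∈ upperHalf, cexp (L z) = F z := by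
  have hopen : IsOpen upperHalf := isOpen_aboveLine 0
  have hconv : Convex ℝ upperHalf := convex_halfSpace_im_gt 0
  have hsc : IsSimplyConnected upperHalf := by
    have := hconv.contractibleSpace ⟨I, by simp [upperHalf]⟩
    exact SimplyConnectedSpace.ofContractible _
  obtain ⟨L, hL, hexp⟩ := exists_continuousOn_eqOn_exp_comp hsc hopen hF.continuousOn (by
    rintro ⟨z, hz, h⟩
    exact h0 z hz h)
  refine ⟨L, fun z hz => DifferentiableAt.differentiableWithinAt ?_, hexp⟩
  have hn := hopen.mem_nhds hz
  have hc : ContinuousAt (fun w => (L w - L z).im) z :=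
    continuous_im.continuousAt.comp ((hL.continuousAt hn).sub continuousAt_const)
  have hlim : Tendsto (fun w => (L w - L z).im) (𝓝 z) (𝓝 0) := by
    have := hc.tendsto
    rwa [sub_self, zero_im] at this
  -- By continuity Im(L w - L z) stays in (-π, π) near z, so the continuous logarithm differs there
  -- from a principal logarithm by a constant only, and is differentiable.
  have hev : L =ᶠ[𝓝 z] fun w => L z + log (F w / F z) := by
    filter_upwards [hn, hlim.eventually (Ioo_mem_nhds (neg_lt_zero.2 Real.pi_pos) Real.pi_pos)]
      with w hw him
    rw [← hexp hw, ← hexp hz, Function.comp_apply, Function.comp_apply, ← Complex.exp_sub,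
      log_exp him.1 him.2.le]
    ring
  refine DifferentiableAt.congr_of_eventuallyEq ?_ hev
  refine (DifferentiableAt.clog ((hF.differentiableAt hn).div_const _) ?_).const_add _
  rw [div_self (h0 z hz)]
  exact one_mem_slitPlane

/-! ### The logarithm of the Fourier transform of a minimum phase distribution -/

theorem IsLogHat.norm_fourierHat {T : 𝓢'(ℝ, ℂ)} {L : ℂ → ℂ} (hL : IsLogHat T L) {z : ℂ}
    (hz : z ∈ upperHalf) : ‖fourierHat T z‖ = Real.exp (L z).re := by
  rw [← hL.2 z hz, Complex.norm_exp]

/-- The growth estimate is taken with starting point -1, strictly left of the support, which costs a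
factor e^{Im z}. Adding iz to L cancels it, as Re(iz) = -Im z. -/
theorem IsLogHat.isLogBounded {T : 𝓢'(ℝ, ℂ)} (hT : IsCausal T) {L : ℂ → ℂ} (hL : IsLogHat T L) :
    ∃ (A : ℝ) (N : ℕ) (M : ℝ), IsLogBounded (fun z => L z + I * z) A N M := by
  obtain ⟨C, N, b, hC, h⟩ := exists_norm_fourierHat_le hT le_rfl (by norm_num : (-1 : ℝ) < 0)
  have hC1 : 1 ≤ C + 1 := by linarith
  refine ⟨Real.log (C + 1), N, b, hL.1.add (by fun_prop), Real.log_nonneg hC1, by positivity,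
    by positivity, fun z hz => ?_⟩
  have hz' : 0 < z.im := hz
  have h1 := h z hz
  rw [hL.norm_fourierHat hz] at h1
  have h2 : Real.exp (L z).re ≤
      (C + 1) * (1 + ‖z‖) ^ N * Real.exp (z.im) * (1 + 1 / z.im) ^ b := by
    refine h1.trans ?_
    rw [mul_neg_one, neg_neg]
    gcongr
    linarith
  have h3 := Real.log_le_log (Real.exp_pos _) h2
  have hp1 : 0 < (1 + ‖z‖) ^ N := by positivity
  have hp2 : 0 < (1 + 1 / z.im) ^ b := by positivity
  rw [Real.log_exp, Real.log_mul (by positivity) hp2.ne', Real.log_mul (by positivity)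
    (Real.exp_pos _).ne', Real.log_mul (by positivity) hp1.ne', Real.log_exp, Real.log_pow,
    Real.log_pow] at h3
  simp only [add_re, I_mul_re]
  linarith

/-- After u = yt the integral is that of f(u/y) e^{-u}, and f(u/y) → f(0) = 0. So the term z² f̂(z)
is o(y) at z = iy and cannot disturb the linear coefficient. -/
theorem tendsto_mul_laplace {f : ℝ → ℂ} (hf : Continuous f) (hf0 : f 0 = 0) {C : ℝ} {k : ℕ}
    (hC : ∀ t, ‖f t‖ ≤ C * (1 + |t|) ^ k) :
    Tendsto (fun y : ℝ => (y : ℂ) * laplace f (I * y)) atTop (𝓝 0) := by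
  have hC0 : 0 ≤ C := by simpa using (norm_nonneg _).trans (hC 0)
  have h1 : ∀ y : ℝ, 0 < y → (y : ℂ) * laplace f (I * y) =
      ∫ u in Ioi (0 : ℝ), f (u / y) * Real.exp (-u) := by
    intro y hy
    have hy' : (y : ℂ) ≠ 0 := by exact_mod_cast hy.ne'
    have h2 := integral_comp_mul_left_Ioi (fun u : ℝ => f (u / y) * Real.exp (-u)) 0 hy
    rw [mul_zero, Complex.real_smul] at h2
    have h3 : laplace f (I * y) =
        ∫ t in Ioi (0 : ℝ), f (y * t / y) * Real.exp (-(y * t)) := by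
      rw [laplace]
      congr 1
      ext t
      rw [mul_div_cancel_left₀ _ hy.ne', ofReal_exp]
      congr 2
      push_cast
      linear_combination (y * t : ℂ) * I_mul_I
    rw [h3, h2]
    push_cast
    rw [mul_inv_cancel_left₀ hy']
  have h2 : Tendsto (fun y : ℝ => ∫ u in Ioi (0 : ℝ), f (u / y) * Real.exp (-u)) atTop
      (𝓝 (∫ u in Ioi (0 : ℝ), (0 : ℂ))) := by
    refine tendsto_integral_filter_of_dominated_convergence
      (fun u => C * ((1 + |u|) ^ k * Real.exp (-1 * u))) ?_ ?_
      ((integrable_pow_mul_exp_neg one_pos k).const_mul C) ?_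
    · exact Eventually.of_forall fun y => Continuous.aestronglyMeasurable (by fun_prop)
    · filter_upwards [eventually_ge_atTop 1] with y hy
      refine ae_of_all _ fun u => ?_
      have hu : |u / y| ≤ |u| := by
        rw [abs_div, abs_of_pos (by linarith : 0 < y)]
        exact div_le_self (abs_nonneg _) hy
      rw [norm_mul, norm_real, Real.norm_eq_abs, abs_of_pos (Real.exp_pos _), ← mul_assoc,
        neg_one_mul]
      gcongr
      exact (hC _).trans (by gcongr)
    · refine ae_of_all _ fun u => ?_
      have h3 : Tendsto (fun y : ℝ => u / y) atTop (𝓝 0) := tendsto_const_nhds.div_atTop tendsto_id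
      have h4 := ((hf.tendsto 0).comp h3).mul_const (Real.exp (-u) : ℂ)
      rwa [hf0, zero_mul] at h4
  rw [integral_zero] at h2
  refine h2.congr' ?_
  filter_upwards [eventually_gt_atTop 0] with y hy
  exact (h1 y hy).symm

/-- The linear coefficient of the logarithm bounds the onset time from above. -/
theorem IsLogHat.le_of_isVanishingOn {T : 𝓢'(ℝ, ℂ)} {L : ℂ → ℂ} (hL : IsLogHat T L) {a : ℝ}
    {f : ℝ → ℂ} (hf : Continuous f) (hf0 : f 0 = 0) {C : ℝ} {k : ℕ}
    (hC : ∀ t, ‖f t‖ ≤ C * (1 + |t|) ^ k)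
    (hrep : ∀ z ∈ upperHalf, L z = I * a * z - z ^ 2 * laplace f z) {s : ℝ} (hs : 0 ≤ s)
    (hT : Distribution.IsVanishingOn T (Iio s)) : s ≤ a := by
  by_contra hcon
  have hcon : a < s := not_le.1 hcon
  -- If a < s, fix r between a and s, at least -1. On the imaginary axis T̂ is at most a power times
  -- e^{-ry} but, with d = (r-a)/2, at least e^{-ay-dy}; this forces 1 ≤ const · (1+y)^N e^{-dy}.
  obtain ⟨r, hr1, hr2⟩ := exists_between (max_lt (show (-1 : ℝ) < s by linarith) hcon)
  obtain ⟨D, N, b, hD, h⟩ := exists_norm_fourierHat_le hT ((le_max_left _ _).trans hr1.le) hr2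
  have har : a < r := (le_max_right _ _).trans_lt hr1
  set d := (r - a) / 2 with hd
  have hd0 : 0 < d := by linarith
  set K := 2 ^ (N + 1) * (1 + ((N + 1).factorial : ℝ)) * (1 + 1 / d) ^ (N + 1)
  have hlim := (tendsto_mul_laplace hf hf0 hC).norm
  rw [norm_zero] at hlim
  -- Multiplying by one more factor 1+y, absorbed by e^{-dy}, turns the inequality into a bound on y
  -- itself, which is absurd. The factor 2^b bounds (1+1/y)^b for y ≥ 1.
  have hev : ∀ᶠ y : ℝ in atTop, 1 + y ≤ D * 2 ^ b * K := by
    filter_upwards [eventually_ge_atTop 1, hlim.eventually (gt_mem_nhds hd0)] with y hy1 hy2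
    have hy0 : 0 < y := by linarith
    have him : (I * (y : ℂ)).im = y := by simp
    have hmem : I * (y : ℂ) ∈ upperHalf := by
      change 0 < (I * (y : ℂ)).im
      rwa [him]
    have h1 := h _ hmem
    rw [hL.norm_fourierHat hmem, hrep _ hmem, him] at h1
    have hre : (I * a * (I * y) - (I * y) ^ 2 * laplace f (I * y) : ℂ) =
        ((-(a * y) : ℝ) : ℂ) + (y : ℝ) * (y * laplace f (I * y)) := by
      push_cast
      linear_combination (a * y - (y : ℂ) ^ 2 * laplace f (I * y)) * I_mul_I
    have h2 : -(d * y) ≤ ((y : ℝ) * ((y : ℂ) * laplace f (I * y))).re := by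
      rw [re_ofReal_mul]
      have := (abs_le.1 ((abs_re_le_norm ((y : ℂ) * laplace f (I * y))).trans hy2.le)).1
      nlinarith
    have hnorm : ‖I * (y : ℂ)‖ = y := by simp [abs_of_pos hy0]
    rw [hre, add_re, ofReal_re, hnorm] at h1
    have h3 : Real.exp (-(a * y) - d * y) ≤ D * (1 + y) ^ N * Real.exp (-(y * r)) * 2 ^ b := by
      refine (Real.exp_le_exp.2 (by linarith)).trans (h1.trans ?_)
      have : 1 / y ≤ 1 := (div_le_one hy0).2 hy1
      gcongr
      linarith
    have h4 : 1 ≤ D * 2 ^ b * ((1 + y) ^ N * Real.exp (-(d * y))) := by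
      have e1 : Real.exp (-(a * y) - d * y) * Real.exp (a * y + d * y) = 1 := by
        rw [← Real.exp_add]; simp
      have e2 : Real.exp (-(y * r)) * Real.exp (a * y + d * y) = Real.exp (-(d * y)) := by
        rw [← Real.exp_add]; congr 1; rw [hd]; ring
      calc 1 = Real.exp (-(a * y) - d * y) * Real.exp (a * y + d * y) := e1.symm
        _ ≤ D * (1 + y) ^ N * Real.exp (-(y * r)) * 2 ^ b * Real.exp (a * y + d * y) := by gcongr
        _ = D * 2 ^ b * ((1 + y) ^ N * (Real.exp (-(y * r)) * Real.exp (a * y + d * y))) := by ring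
        _ = _ := by rw [e2]
    have h5 := one_add_pow_mul_exp_neg_le (N + 1) hd0 hy0.le
    calc 1 + y = (1 + y) * 1 := by ring
      _ ≤ (1 + y) * (D * 2 ^ b * ((1 + y) ^ N * Real.exp (-(d * y)))) := by gcongr
      _ = D * 2 ^ b * ((1 + y) ^ (N + 1) * Real.exp (-(d * y))) := by ring
      _ ≤ _ := by gcongr
  obtain ⟨y, hy1, hy2⟩ := (hev.and (eventually_gt_atTop (D * 2 ^ b * K))).exists
  linarith

/-- The logarithm of the Fourier transform of a minimum phase distribution is the sum of a linear
term, with the onset time as coefficient, and of the Fourier transform of a second derivative. -/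
theorem IsLogHat.exists_rep {T : 𝓢'(ℝ, ℂ)} (hT : IsCausal T) {L : ℂ → ℂ} (hL : IsLogHat T L) :
    ∃ f : ℝ → ℂ, Continuous f ∧ (∀ t ≤ 0, f t = 0) ∧
      (∃ C : ℝ, ∀ t, ‖f t‖ ≤ C * (1 + |t|) ^ 4) ∧
      ∀ z ∈ upperHalf, L z = I * (sInf (Distribution.dsupport T) : ℝ) * z - z ^ 2 * laplace f z := by
  obtain ⟨A, N, M, hW⟩ := hL.isLogBounded hT
  obtain ⟨a, f, hf, hf0, ⟨C, hC⟩, hrep, k, hk⟩ := hW.exists_rep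
  -- The representation is that of L + iz, so the coefficient for L is smaller by one.
  have hrep' : ∀ z ∈ upperHalf, L z = I * (a - 1 : ℝ) * z - z ^ 2 * laplace f z := by
    intro z hz
    have := hrep z hz
    push_cast
    linear_combination this
  -- The one-sided bound on Re(W - iaz) exponentiates to |T̂| ≤ e^k |z|^N e^{-(a-1) Im z}, the
  -- hypothesis of Paley-Wiener.
  have hvan : Distribution.IsVanishingOn T (Iio (a - 1)) := by
    refine isVanishingOn_of_norm_fourierHat_le hT (C := Real.exp k) (m := N) fun z hz => ?_
    have hz0 : 0 < ‖z‖ := by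
      have := (le_abs_self _).trans (abs_im_le_norm z)
      linarith
    rw [hL.norm_fourierHat (show 0 < z.im by linarith), ← Real.exp_log (pow_pos hz0 N),
      Real.log_pow, ← Real.exp_add, ← Real.exp_add]
    refine Real.exp_le_exp.2 ?_
    have h1 := hk z hz
    have h2 : (L z + I * z - I * a * z).re = (L z).re - z.im + a * z.im := by
      simp [mul_assoc, sub_eq_add_neg]
    rw [h2] at h1
    linarith
  have hle : ∀ s, 0 ≤ s → Distribution.IsVanishingOn T (Iio s) → s ≤ a - 1 := fun s hs h =>
    hL.le_of_isVanishingOn hf (hf0 0 le_rfl) hC hrep' hs h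
  have ha : 0 ≤ a - 1 := hle 0 le_rfl hT
  have hleast := isLeast_dsupport hvan fun s hs h => hle s (ha.trans hs) h
  refine ⟨f, hf, hf0, ⟨C, hC⟩, ?_⟩
  rw [hleast.csInf_eq]
  exact hrep'

/-! ### Functions of polynomial growth as tempered distributions -/

theorem one_add_abs_pow_mul_norm_le (φ : 𝓢(ℝ, ℂ)) (k : ℕ) (t : ℝ) :
    (1 + |t|) ^ k * ‖φ t‖ ≤
      2 ^ k * (Finset.Iic ((k, 0) : ℕ × ℕ)).sup (schwartzSeminormFamily ℂ ℝ ℂ) φ := by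
  have := SchwartzMap.one_add_le_sup_seminorm_apply (𝕜 := ℂ) (m := (k, 0)) le_rfl le_rfl φ t
  rwa [norm_iteratedFDeriv_zero, Real.norm_eq_abs] at this

theorem PolyGrowth.exists_norm_mul_le {f : ℝ → ℂ} (hf : PolyGrowth f) :
    ∃ (D : ℝ) (k : ℕ), 0 ≤ D ∧ ∀ (φ : 𝓢(ℝ, ℂ)) (t : ℝ), ‖f t * φ t‖ ≤
      D * (Finset.Iic ((k, 0) : ℕ × ℕ)).sup (schwartzSeminormFamily ℂ ℝ ℂ) φ *
        (1 + t ^ 2)⁻¹ := by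
  obtain ⟨-, C, k, hC⟩ := hf
  have hC0 : 0 ≤ C := by simpa using (norm_nonneg _).trans (hC 0)
  refine ⟨C * 2 ^ (k + 2), k + 2, by positivity, fun φ t => ?_⟩
  rw [← div_eq_mul_inv, le_div_iff₀ (by positivity), norm_mul]
  have h1 : 1 + t ^ 2 ≤ (1 + |t|) ^ 2 := by nlinarith [abs_nonneg t, sq_abs t]
  calc ‖f t‖ * ‖φ t‖ * (1 + t ^ 2) ≤ C * (1 + |t|) ^ k * ‖φ t‖ * (1 + |t|) ^ 2 := by
        gcongr
        exact hC t
    _ = C * ((1 + |t|) ^ (k + 2) * ‖φ t‖) := by ring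
    _ ≤ C * (2 ^ (k + 2) *
        (Finset.Iic ((k + 2, 0) : ℕ × ℕ)).sup (schwartzSeminormFamily ℂ ℝ ℂ) φ) := by
        exact mul_le_mul_of_nonneg_left (one_add_abs_pow_mul_norm_le φ (k + 2) t) hC0
    _ = _ := by ring

theorem PolyGrowth.integrable_mul {f : ℝ → ℂ} (hf : PolyGrowth f) (φ : 𝓢(ℝ, ℂ)) :
    Integrable fun t => f t * φ t := by
  obtain ⟨D, k, -, h⟩ := hf.exists_norm_mul_le
  exact integrable_of_norm_le_one_add_sq (hf.1.mul φ.continuous.aestronglyMeasurable) _ (h φ)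

theorem PolyGrowth.exists_isFunction {f : ℝ → ℂ} (hf : PolyGrowth f) :
    ∃ U : 𝓢'(ℝ, ℂ), IsFunction U f := by
  obtain ⟨D, k, hD, h⟩ := hf.exists_norm_mul_le
  let U₀ : 𝓢(ℝ, ℂ) →L[ℂ] ℂ := SchwartzMap.mkCLMtoNormedSpace (fun φ => ∫ t, f t * φ t)
    (fun φ ψ => by
      rw [← integral_add (hf.integrable_mul φ) (hf.integrable_mul ψ)]
      congr 1; ext t
      rw [add_apply, mul_add])
    (fun a φ => by
      rw [RingHom.id_apply, smul_eq_mul, ← integral_const_mul]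
      congr 1; ext t
      rw [smul_apply, smul_eq_mul]; ring)
    ⟨Finset.Iic (k, 0), D * Real.pi, by positivity, fun φ => by
      refine (norm_integral_le_of_norm_le (integrable_inv_one_add_sq.const_mul _)
        (ae_of_all _ (h φ))).trans (le_of_eq ?_)
      rw [integral_const_mul, integral_univ_inv_one_add_sq]; ring⟩
  exact ⟨ContinuousLinearMap.toPointwiseConvergenceCLM _ _ _ _ U₀, hf, fun φ => rfl⟩

/-- The Fourier transform with kernel `exp (i w t)`, on Schwartz functions. -/
def angularFourier : 𝓢(ℝ, ℂ) →L[ℂ] 𝓢(ℝ, ℂ) :=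
  (SchwartzMap.compCLMOfContinuousLinearEquiv ℂ (ContinuousLinearEquiv.unitsEquivAut ℝ
    (Units.mk0 (2 * Real.pi)⁻¹ (by positivity)))).comp
    (FourierTransform.fourierInvCLM ℂ 𝓢(ℝ, ℂ))

theorem angularFourier_apply (φ : 𝓢(ℝ, ℂ)) (t : ℝ) :
    angularFourier φ t = ∫ w : ℝ, cexp (I * w * t) * φ w := by
  have h : angularFourier φ t = FourierTransformInv.fourierInv φ (t * (2 * Real.pi)⁻¹) := rfl
  rw [h, SchwartzMap.fourierInv_coe, Real.fourierInv_eq']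
  congr 1
  ext w
  rw [smul_eq_mul]
  congr 2
  have hpi : (Real.pi : ℂ) ≠ 0 := by exact_mod_cast Real.pi_ne_zero
  simp only [RCLike.inner_apply, conj_trivial]
  push_cast
  field_simp

theorem PolyGrowth.exists_isFourierOf {b : ℝ → ℂ} (hb : PolyGrowth b) :
    ∃ G : 𝓢'(ℝ, ℂ), IsFourierOf b G ∧ ∀ φ, G φ = ∫ t, b t * angularFourier φ t := by
  obtain ⟨U, -, hU⟩ := hb.exists_isFunction
  refine ⟨PointwiseConvergenceCLM.precomp ℂ angularFourier U, ⟨hb, fun φ => ?_⟩, fun φ => hU _⟩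
  exact (hU _).trans (integral_congr_ae (ae_of_all _ fun t =>
    congrArg (b t * ·) (angularFourier_apply φ t)))

/-! ### Causal functions -/

/-- Functions of polynomial growth, continuous on the positive half-line and vanishing on the
negative half-line. -/
structure IsCausalGrowth (g : ℝ → ℂ) : Prop where
  zero : ∀ t ≤ 0, g t = 0
  continuousOn : ContinuousOn g (Ioi 0)
  bound : ∃ (C : ℝ) (k : ℕ), 0 ≤ C ∧ ∀ t, ‖g t‖ ≤ C * (1 + |t|) ^ k

namespace IsCausalGrowth

variable {g h : ℝ → ℂ}

theorem aestronglyMeasurable (hg : IsCausalGrowth g) : AEStronglyMeasurable g := by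
  have h1 : g = (Ioi (0 : ℝ)).indicator g := by
    ext t
    by_cases ht : t ∈ Ioi (0 : ℝ)
    · rw [indicator_of_mem ht]
    · rw [indicator_of_notMem ht, hg.zero t (not_lt.1 ht)]
  rw [h1, aestronglyMeasurable_indicator_iff measurableSet_Ioi]
  exact hg.continuousOn.aestronglyMeasurable measurableSet_Ioi

theorem polyGrowth (hg : IsCausalGrowth g) : PolyGrowth g := by
  obtain ⟨C, k, -, hC⟩ := hg.bound
  exact ⟨hg.aestronglyMeasurable, C, k, hC⟩

theorem integrableOn (hg : IsCausalGrowth g) {z : ℂ} (hz : 0 < z.im) :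
    IntegrableOn (fun t : ℝ => g t * cexp (I * z * t)) (Ioi 0) := by
  obtain ⟨C, k, -, hC⟩ := hg.bound
  exact integrableOn_laplace (c := 0) hg.aestronglyMeasurable (fun t => by simpa using hC t) hz

theorem add (hg : IsCausalGrowth g) (hh : IsCausalGrowth h) :
    IsCausalGrowth fun t => g t + h t := by
  obtain ⟨C, k, hC0, hC⟩ := hg.bound
  obtain ⟨D, l, hD0, hD⟩ := hh.bound
  refine ⟨fun t ht => by simp [hg.zero t ht, hh.zero t ht], hg.continuousOn.add hh.continuousOn,
    C + D, k + l, by positivity, fun t => (norm_add_le _ _).trans ?_⟩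
  have h1 : (1 : ℝ) ≤ 1 + |t| := by linarith [abs_nonneg t]
  rw [add_mul]
  refine add_le_add ((hC t).trans ?_) ((hD t).trans ?_)
  · gcongr
    omega
  · gcongr
    omega

theorem const_mul (hg : IsCausalGrowth g) (c : ℂ) : IsCausalGrowth fun t => c * g t := by
  obtain ⟨C, k, hC0, hC⟩ := hg.bound
  refine ⟨fun t ht => by simp [hg.zero t ht], continuousOn_const.mul hg.continuousOn,
    ‖c‖ * C, k, by positivity, fun t => ?_⟩
  rw [norm_mul, mul_assoc]
  exact mul_le_mul_of_nonneg_left (hC t) (norm_nonneg c)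

theorem laplace_add (hg : IsCausalGrowth g) (hh : IsCausalGrowth h) {z : ℂ} (hz : 0 < z.im) :
    laplace (fun t => g t + h t) z = laplace g z + laplace h z := by
  rw [laplace, laplace, laplace, ← integral_add (hg.integrableOn hz) (hh.integrableOn hz)]
  simp_rw [add_mul]

end IsCausalGrowth

theorem laplace_const_mul (g : ℝ → ℂ) (c z : ℂ) :
    laplace (fun t => c * g t) z = c * laplace g z := by
  rw [laplace, laplace, ← integral_const_mul]
  simp_rw [mul_assoc]

/-- The Heaviside function, of transform i/z, encodes the linear term: iaz = z²·a·(i/z). Being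
discontinuous at 0, it is the reason for requiring continuity on t > 0 only. -/
theorem isCausalGrowth_indicator : IsCausalGrowth ((Ioi (0 : ℝ)).indicator fun _ => (1 : ℂ)) := by
  refine ⟨fun t ht => indicator_of_notMem (not_lt.2 ht) _, ?_, 1, 0, zero_le_one, fun t => ?_⟩
  · exact continuousOn_const.congr fun t ht => indicator_of_mem ht _
  · rw [pow_zero, mul_one]
    exact (norm_indicator_le_norm_self _ _).trans (by simp)

theorem laplace_indicator {z : ℂ} (hz : 0 < z.im) :
    laplace ((Ioi (0 : ℝ)).indicator fun _ => (1 : ℂ)) z = I / z := by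
  rw [← integral_cexp_I_mul hz, laplace]
  refine setIntegral_congr_fun measurableSet_Ioi fun t ht => ?_
  simp only [indicator_of_mem ht, one_mul]

/-- The convolution of `g` with the causal function of Fourier transform `1 / (z - w)`. -/
def causalConv (w : ℝ) (g : ℝ → ℂ) (t : ℝ) : ℂ :=
  -I * cexp (-I * w * t) * ∫ s in (0 : ℝ)..t, cexp (I * w * s) * g s

namespace IsCausalGrowth

variable {g : ℝ → ℂ}

theorem norm_cexp_I_real (w s : ℝ) : ‖cexp (I * w * s)‖ = 1 := by
  rw [Complex.norm_exp]; simp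

theorem intervalIntegrable (hg : IsCausalGrowth g) (w a b : ℝ) :
    IntervalIntegrable (fun s : ℝ => cexp (I * w * s) * g s) volume a b := by
  obtain ⟨C, k, -, hC⟩ := hg.bound
  refine ((by fun_prop : Continuous fun t : ℝ => C * (1 + |t|) ^ k).intervalIntegrable a
    b).mono_fun' ?_ (ae_of_all _ fun t => ?_)
  · exact ((Continuous.aestronglyMeasurable (by fun_prop)).mul hg.aestronglyMeasurable).restrict
  · simp only [norm_mul, norm_cexp_I_real, one_mul]
    exact hC t

theorem continuous_primitive (hg : IsCausalGrowth g) (w : ℝ) :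
    Continuous fun t : ℝ => ∫ s in (0 : ℝ)..t, cexp (I * w * s) * g s :=
  intervalIntegral.continuous_primitive (hg.intervalIntegrable w) 0

theorem hasDerivAt_primitive (hg : IsCausalGrowth g) (w : ℝ) {t : ℝ} (ht : 0 < t) :
    HasDerivAt (fun t : ℝ => ∫ s in (0 : ℝ)..t, cexp (I * w * s) * g s)
      (cexp (I * w * t) * g t) t := by
  refine intervalIntegral.integral_hasDerivAt_right (hg.intervalIntegrable w 0 t) ?_ ?_
  · exact ((Continuous.aestronglyMeasurable (by fun_prop)).mul
      hg.aestronglyMeasurable).stronglyMeasurableAtFilter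
  · exact ContinuousAt.mul (by fun_prop) (hg.continuousOn.continuousAt (Ioi_mem_nhds ht))

theorem primitive_eq_zero (hg : IsCausalGrowth g) (w : ℝ) {t : ℝ} (ht : t ≤ 0) :
    ∫ s in (0 : ℝ)..t, cexp (I * w * s) * g s = 0 := by
  rw [intervalIntegral.integral_congr (g := fun _ => (0 : ℂ)), intervalIntegral.integral_zero]
  intro s hs
  rw [uIcc_of_ge ht] at hs
  simp [hg.zero s hs.2]

theorem exists_norm_primitive_le (hg : IsCausalGrowth g) (w : ℝ) :
    ∃ (C : ℝ) (k : ℕ), 0 ≤ C ∧ ∀ t : ℝ,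
      ‖∫ s in (0 : ℝ)..t, cexp (I * w * s) * g s‖ ≤ C * (1 + |t|) ^ k := by
  obtain ⟨C, k, hC0, hC⟩ := hg.bound
  refine ⟨C, k + 1, hC0, fun t => ?_⟩
  have h := intervalIntegral.norm_integral_le_of_norm_le_const (a := 0) (b := t)
    (C := C * (1 + |t|) ^ k) (f := fun s : ℝ => cexp (I * w * s) * g s) fun s hs => ?_
  · refine h.trans ?_
    rw [sub_zero, pow_succ, ← mul_assoc]
    gcongr
    linarith
  · rw [norm_mul, norm_cexp_I_real, one_mul]
    refine (hC s).trans ?_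
    have h1 : |s| ≤ |t| := by
      have := abs_sub_left_of_mem_uIcc (uIoc_subset_uIcc hs)
      simpa using this
    gcongr

theorem causalConv (hg : IsCausalGrowth g) (w : ℝ) : IsCausalGrowth (causalConv w g) := by
  obtain ⟨C, k, hC0, hC⟩ := hg.exists_norm_primitive_le w
  refine ⟨fun t ht => ?_, Continuous.continuousOn ?_, C, k, hC0, fun t => ?_⟩
  · rw [MinPhase.causalConv, hg.primitive_eq_zero w ht, mul_zero]
  · exact (by fun_prop : Continuous fun t : ℝ => -I * cexp (-I * w * t)).mul
      (hg.continuous_primitive w)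
  · have h1 : ‖cexp (-I * w * t)‖ = 1 := by rw [Complex.norm_exp]; simp
    rw [MinPhase.causalConv, norm_mul, norm_mul, norm_neg, norm_I, h1, one_mul, one_mul]
    exact hC t

/-- Integration by parts against the primitive of e^{iws}g(s). The boundary term vanishes at 0
because the primitive does, and at infinity because the product and its derivative are integrable.
-/
theorem laplace_causalConv (hg : IsCausalGrowth g) (w : ℝ) {z : ℂ} (hz : 0 < z.im) :
    laplace (MinPhase.causalConv w g) z = laplace g z / (z - w) := by
  have him : (z - w).im = z.im := by simp
  have hne : z - w ≠ 0 := fun h => by rw [h] at him; simp at him; linarith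
  have hI : I * (z - w) ≠ 0 := mul_ne_zero I_ne_zero hne
  set H : ℝ → ℂ := fun t => ∫ s in (0 : ℝ)..t, cexp (I * w * s) * g s with hH
  have hHc : Continuous H := hg.continuous_primitive w
  obtain ⟨C, k, -, hC⟩ := hg.exists_norm_primitive_le w
  have hv : ∀ t : ℝ, HasDerivAt (fun t : ℝ => cexp (I * (z - w) * t) / (I * (z - w)))
      (cexp (I * (z - w) * t)) t := by
    intro t
    have h0 : HasDerivAt (fun s : ℝ => I * (z - w) * (s : ℂ)) (I * (z - w) * 1) t :=
      (Complex.ofRealCLM.hasDerivAt (x := t)).const_mul (I * (z - w))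
    exact (h0.cexp.div_const _).congr_deriv (by field_simp)
  have i1 : IntegrableOn (fun t : ℝ => H t * cexp (I * (z - w) * t)) (Ioi 0) :=
    integrableOn_laplace (c := 0) hHc.aestronglyMeasurable (fun t => by simpa using hC t)
      (by rwa [him])
  have e1 : ∀ t : ℝ, cexp (I * w * t) * g t * (cexp (I * (z - w) * t) / (I * (z - w))) =
      g t * cexp (I * z * t) / (I * (z - w)) := by
    intro t
    have : cexp (I * z * t) = cexp (I * w * t) * cexp (I * (z - w) * t) := by
      rw [← Complex.exp_add]; congr 1; ring
    rw [this]; ring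
  have i2 : IntegrableOn (fun t : ℝ =>
      cexp (I * w * t) * g t * (cexp (I * (z - w) * t) / (I * (z - w)))) (Ioi 0) := by
    simp_rw [e1]
    exact (hg.integrableOn hz).div_const _
  have i3 : IntegrableOn (H * fun t : ℝ => cexp (I * (z - w) * t) / (I * (z - w))) (Ioi 0) := by
    refine (i1.div_const (I * (z - w))).congr (ae_of_all _ fun t => ?_)
    simp only [Pi.mul_apply]; ring
  have hd : ∀ t ∈ Ioi (0 : ℝ), HasDerivAt H (cexp (I * w * t) * g t) t := fun t ht =>
    hg.hasDerivAt_primitive w ht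
  have h0 : Tendsto (H * fun t : ℝ => cexp (I * (z - w) * t) / (I * (z - w))) (𝓝[>] 0) (𝓝 0) := by
    have h1 : Continuous (H * fun t : ℝ => cexp (I * (z - w) * t) / (I * (z - w))) :=
      hHc.mul (by fun_prop)
    have h2 := (h1.tendsto 0).mono_left (nhdsWithin_le_nhds (s := Ioi 0))
    have h3 : H 0 = 0 := hg.primitive_eq_zero w le_rfl
    rwa [Pi.mul_apply, h3, zero_mul] at h2
  have hinf := tendsto_zero_of_hasDerivAt_of_integrableOn_Ioi
    (fun t ht => (hd t ht).mul (hv t)) (i2.add i1) i3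
  have hibp := integral_Ioi_mul_deriv_eq_deriv_mul hd (fun t _ => hv t) i1 i2 h0 hinf
  rw [laplace]
  have e2 : ∀ t : ℝ, MinPhase.causalConv w g t * cexp (I * z * t) =
      -I * (H t * cexp (I * (z - w) * t)) := by
    intro t
    have : cexp (I * (z - w) * t) = cexp (-I * w * t) * cexp (I * z * t) := by
      rw [← Complex.exp_add]; congr 1; ring
    rw [this, MinPhase.causalConv]; ring
  simp_rw [e2]
  rw [integral_const_mul, hibp]
  simp_rw [e1]
  rw [integral_div, laplace]
  field_simp
  ring

/-- The quotient by `(z - w)²` of `z²` times the transform of a causal function is such a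
transform. -/
theorem exists_laplace_eq_div (hg : IsCausalGrowth g) (w : ℝ) :
    ∃ G : ℝ → ℂ, IsCausalGrowth G ∧ ∀ z : ℂ, 0 < z.im →
      z ^ 2 * laplace g z = (z - w) ^ 2 * laplace G z := by
  have h1 := hg.causalConv w
  have h2 := h1.causalConv w
  -- From z² = (z-w)² + 2w(z-w) + w², the factor z²/(z-w)² is 1 + 2w/(z-w) + w²/(z-w)², and each
  -- 1/(z-w) is one causal convolution.
  refine ⟨_, (hg.add (h1.const_mul (2 * w))).add (h2.const_mul (w ^ 2)), fun z hz => ?_⟩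
  have him : (z - w).im = z.im := by simp
  have hne : z - w ≠ 0 := fun h => by rw [h] at him; simp at him; linarith
  rw [laplace_add (hg.add (h1.const_mul (2 * w))) (h2.const_mul (w ^ 2)) hz,
    laplace_add hg (h1.const_mul (2 * w)) hz, laplace_const_mul, laplace_const_mul,
    h1.laplace_causalConv w hz, hg.laplace_causalConv w hz]
  field_simp
  ring

end IsCausalGrowth

/-! ### Boundary values of transforms of causal functions -/

namespace IsCausalGrowth

variable {g : ℝ → ℂ}

theorem integral_laplace_mul (hg : IsCausalGrowth g) (φ : 𝓢(ℝ, ℂ)) {c : ℝ} (hc : 0 < c) :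
    (Integrable fun x : ℝ => laplace g (x + c * I) * φ x) ∧
    ∫ x : ℝ, laplace g (x + c * I) * φ x =
      ∫ t : ℝ, g t * Real.exp (-c * t) * angularFourier φ t := by
  have hgi : IntegrableOn (fun t : ℝ => g t * Real.exp (-c * t)) (Ioi 0) := by
    refine (hg.integrableOn (z := c * I) (by simpa using hc)).congr (ae_of_all _ fun t => ?_)
    simp only [ofReal_exp]
    congr 2
    push_cast
    linear_combination (c * t : ℂ) * I_mul_I
  have e1 : ∀ x t : ℝ, g t * cexp (I * (x + c * I) * t) * φ x =
      φ x * (g t * Real.exp (-c * t)) * cexp (I * x * t) := by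
    intro x t
    have : cexp (I * (x + c * I) * t) = Real.exp (-c * t) * cexp (I * x * t) := by
      rw [ofReal_exp, ← Complex.exp_add]
      congr 1
      push_cast
      linear_combination (c * t : ℂ) * I_mul_I
    rw [this]; ring
  have hprod : Integrable (fun p : ℝ × ℝ =>
      φ p.1 * (g p.2 * Real.exp (-c * p.2)) * cexp (I * p.1 * p.2))
      (volume.prod (volume.restrict (Ioi 0))) := by
    refine (φ.integrable.mul_prod hgi).mono ?_ (ae_of_all _ fun p => ?_)
    · exact (φ.integrable.mul_prod hgi).aestronglyMeasurable.mul
        (Continuous.aestronglyMeasurable (by fun_prop))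
    · rw [norm_mul, norm_cexp_I_real, mul_one]
  have e2 : ∀ x : ℝ, laplace g (x + c * I) * φ x =
      ∫ t in Ioi (0 : ℝ), φ x * (g t * Real.exp (-c * t)) * cexp (I * x * t) := by
    intro x
    rw [laplace, ← integral_mul_const]
    simp_rw [e1]
  simp_rw [e2]
  refine ⟨hprod.integral_prod_left, ?_⟩
  rw [integral_integral_swap hprod, ← integral_indicator measurableSet_Ioi]
  congr 1
  ext t
  by_cases ht : t ∈ Ioi (0 : ℝ)
  · rw [indicator_of_mem ht, angularFourier_apply, ← integral_const_mul]
    congr 1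
    ext x
    ring
  · rw [indicator_of_notMem ht, hg.zero t (not_lt.1 ht)]
    simp

theorem tendsto_integral_laplace_mul (hg : IsCausalGrowth g) (φ : 𝓢(ℝ, ℂ)) :
    Tendsto (fun c : ℝ => ∫ x : ℝ, laplace g (x + c * I) * φ x) (𝓝[>] 0)
      (𝓝 (∫ t : ℝ, g t * angularFourier φ t)) := by
  have h1 : Tendsto (fun c : ℝ => ∫ t : ℝ, g t * Real.exp (-c * t) * angularFourier φ t) (𝓝[>] 0)
      (𝓝 (∫ t : ℝ, g t * angularFourier φ t)) := by
    refine tendsto_integral_filter_of_dominated_convergence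
      (fun t => ‖g t * angularFourier φ t‖) ?_ ?_ (hg.polyGrowth.integrable_mul _).norm ?_
    · exact Eventually.of_forall fun c => (hg.aestronglyMeasurable.mul
        (Continuous.aestronglyMeasurable (by fun_prop))).mul
        (angularFourier φ).continuous.aestronglyMeasurable
    · filter_upwards [self_mem_nhdsWithin] with c hc
      refine ae_of_all _ fun t => ?_
      rcases le_or_gt t 0 with ht | ht
      · simp [hg.zero t ht]
      · rw [mul_right_comm, norm_mul, norm_real, Real.norm_eq_abs, abs_of_pos (Real.exp_pos _)]
        refine mul_le_of_le_one_right (norm_nonneg _) (Real.exp_le_one_iff.2 ?_)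
        have : 0 < c * t := mul_pos hc ht
        linarith
    · refine ae_of_all _ fun t => ?_
      have h2 : Continuous fun c : ℝ => g t * Real.exp (-c * t) * angularFourier φ t := by fun_prop
      have h3 := (h2.tendsto 0).mono_left (nhdsWithin_le_nhds (s := Ioi 0))
      simpa using h3
  refine h1.congr' ?_
  filter_upwards [self_mem_nhdsWithin] with c hc
  exact (hg.integral_laplace_mul φ hc).2.symm

end IsCausalGrowth

/-! ### Boundary values of (z - w)² times a causal transform. -/

theorem sub_sq_temperate (w : ℝ) : (fun x : ℝ => ((x : ℂ) - w) ^ 2).HasTemperateGrowth :=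
  Function.HasTemperateGrowth.pow
    (Function.Complex.hasTemperateGrowth_ofReal.sub (.const (w : ℂ))) 2

theorem sub_temperate (w : ℝ) : (fun x : ℝ => (x : ℂ) - w).HasTemperateGrowth :=
  Function.Complex.hasTemperateGrowth_ofReal.sub (.const (w : ℂ))

/-- The product of a Schwartz function and of `(x - w)²`. -/
def mulSubSq (w : ℝ) (φ : 𝓢(ℝ, ℂ)) : 𝓢(ℝ, ℂ) :=
  SchwartzMap.smulLeftCLM ℂ (fun x : ℝ => ((x : ℂ) - w) ^ 2) φ

theorem mulSubSq_apply (w : ℝ) (φ : 𝓢(ℝ, ℂ)) (x : ℝ) :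
    mulSubSq w φ x = ((x : ℂ) - w) ^ 2 * φ x := by
  rw [mulSubSq, SchwartzMap.smulLeftCLM_apply_apply (sub_sq_temperate w), smul_eq_mul]

/-- At height c the factor is (x-w)² + 2ic(x-w) - c². The first term passes to the test function,
and the other two vanish with c. -/
theorem boundaryValue_mulSubSq {L : ℂ → ℂ} {G : ℝ → ℂ} (hG : IsCausalGrowth G) {w : ℝ}
    (hL : ∀ z : ℂ, 0 < z.im → L z = (z - w) ^ 2 * laplace G z) (φ : 𝓢(ℝ, ℂ)) :
    (∀ c : ℝ, 0 < c → Integrable fun x : ℝ => L (x + c * I) * φ x) ∧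
    Tendsto (fun c : ℝ => ∫ x : ℝ, L (x + c * I) * φ x) (𝓝[>] 0)
      (𝓝 (∫ t : ℝ, G t * angularFourier (mulSubSq w φ) t)) := by
  set φ₁ : 𝓢(ℝ, ℂ) := SchwartzMap.smulLeftCLM ℂ (fun x : ℝ => (x : ℂ) - w) φ
  have hφ₁ : ∀ x, φ₁ x = ((x : ℂ) - w) * φ x := fun x => by
    rw [SchwartzMap.smulLeftCLM_apply_apply (sub_temperate w), smul_eq_mul]
  have e : ∀ c : ℝ, 0 < c → ∀ x : ℝ, L (x + c * I) * φ x =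
      laplace G (x + c * I) * mulSubSq w φ x +
        (2 * c * I * (laplace G (x + c * I) * φ₁ x) -
          c ^ 2 * (laplace G (x + c * I) * φ x)) := by
    intro c hc x
    rw [hL _ (by simpa using hc), mulSubSq_apply, hφ₁]
    linear_combination (c : ℂ) ^ 2 * laplace G (x + c * I) * φ x * I_mul_I
  have i : ∀ (ψ : 𝓢(ℝ, ℂ)) (c : ℝ), 0 < c → Integrable fun x : ℝ => laplace G (x + c * I) * ψ x :=
    fun ψ c hc => (hG.integral_laplace_mul ψ hc).1
  refine ⟨fun c hc => ?_, ?_⟩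
  · simp_rw [e c hc]
    exact (i _ c hc).add (((i _ c hc).const_mul _).sub ((i _ c hc).const_mul _))
  · have hc1 : Tendsto (fun c : ℝ => 2 * (c : ℂ) * I) (𝓝[>] 0) (𝓝 0) := by
      have : Continuous fun c : ℝ => 2 * (c : ℂ) * I := by fun_prop
      simpa using (this.tendsto 0).mono_left (nhdsWithin_le_nhds (s := Ioi 0))
    have hc2 : Tendsto (fun c : ℝ => (c : ℂ) ^ 2) (𝓝[>] 0) (𝓝 0) := by
      have : Continuous fun c : ℝ => (c : ℂ) ^ 2 := by fun_prop
      simpa using (this.tendsto 0).mono_left (nhdsWithin_le_nhds (s := Ioi 0))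
    have := (hG.tendsto_integral_laplace_mul (mulSubSq w φ)).add
      ((hc1.mul (hG.tendsto_integral_laplace_mul φ₁)).sub
        (hc2.mul (hG.tendsto_integral_laplace_mul φ)))
    rw [zero_mul, zero_mul, sub_zero, add_zero] at this
    refine this.congr' ?_
    filter_upwards [self_mem_nhdsWithin] with c hc
    have hc : 0 < c := hc
    simp_rw [e c hc]
    have i₂ : Integrable fun x : ℝ => 2 * c * I * (laplace G (x + c * I) * φ₁ x) -
        (c : ℂ) ^ 2 * (laplace G (x + c * I) * φ x) :=
      ((i _ c hc).const_mul _).sub ((i _ c hc).const_mul _)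
    rw [integral_add (i _ c hc) i₂,
      integral_sub ((i _ c hc).const_mul _) ((i _ c hc).const_mul _), integral_const_mul,
      integral_const_mul]

/-- The complex conjugate of a Schwartz function. -/
def conjSchwartz (φ : 𝓢(ℝ, ℂ)) : 𝓢(ℝ, ℂ) :=
  SchwartzMap.postcompCLM (𝕜 := ℝ) (conjCLE : ℂ →L[ℝ] ℂ) φ

theorem conjSchwartz_apply (φ : 𝓢(ℝ, ℂ)) (x : ℝ) :
    conjSchwartz φ x = (starRingEnd ℂ) (φ x) := by
  rw [conjSchwartz, SchwartzMap.postcompCLM_apply]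
  rfl

theorem mulSubSq_conj (w : ℝ) (φ : 𝓢(ℝ, ℂ)) :
    mulSubSq w (conjSchwartz φ) = conjSchwartz (mulSubSq w φ) := by
  ext x
  rw [mulSubSq_apply, conjSchwartz_apply, conjSchwartz_apply, mulSubSq_apply]
  simp

theorem angularFourier_conj (φ : 𝓢(ℝ, ℂ)) (t : ℝ) :
    angularFourier (conjSchwartz φ) t = (starRingEnd ℂ) (angularFourier φ (-t)) := by
  rw [angularFourier_apply, angularFourier_apply, ← integral_conj]
  congr 1
  ext x
  rw [conjSchwartz_apply, map_mul, ← exp_conj]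
  simp

/-- Conjugate the previous statement at the conjugate test function. Conjugation reverses time under
the Fourier transform, so the density G(t) becomes the conjugate of G(-t). -/
theorem boundaryValue_conj {L : ℂ → ℂ} {G : ℝ → ℂ} (hG : IsCausalGrowth G) {w : ℝ}
    (hL : ∀ z : ℂ, 0 < z.im → L z = (z - w) ^ 2 * laplace G z) (φ : 𝓢(ℝ, ℂ)) :
    (∀ c : ℝ, 0 < c → Integrable fun x : ℝ => (starRingEnd ℂ) (L (x + c * I)) * φ x) ∧
    Tendsto (fun c : ℝ => ∫ x : ℝ, (starRingEnd ℂ) (L (x + c * I)) * φ x) (𝓝[>] 0)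
      (𝓝 (∫ t : ℝ, (starRingEnd ℂ) (G (-t)) * angularFourier (mulSubSq w φ) t)) := by
  obtain ⟨h1, h2⟩ := boundaryValue_mulSubSq hG hL (conjSchwartz φ)
  have e : ∀ (c x : ℝ), (starRingEnd ℂ) (L (x + c * I)) * φ x =
      (starRingEnd ℂ) (L (x + c * I) * conjSchwartz φ x) := by
    intro c x
    rw [map_mul, conjSchwartz_apply, conj_conj]
  simp_rw [e]
  refine ⟨fun c hc => (conjCLE : ℂ →L[ℝ] ℂ).integrable_comp (h1 c hc), ?_⟩
  simp_rw [integral_conj]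
  have h3 := (continuous_conj.tendsto _).comp h2
  refine h3.trans (le_of_eq ?_)
  rw [← integral_conj, ← integral_neg_eq_self]
  congr 2
  ext t
  rw [mulSubSq_conj, angularFourier_conj, map_mul, conj_conj, neg_neg]

theorem IsCausalGrowth.polyGrowth_conj {G : ℝ → ℂ} (hG : IsCausalGrowth G) :
    PolyGrowth fun t => (starRingEnd ℂ) (G (-t)) := by
  obtain ⟨C, k, -, hC⟩ := hG.bound
  refine ⟨continuous_conj.comp_aestronglyMeasurable
    (hG.aestronglyMeasurable.comp_quasiMeasurePreserving
      (Measure.measurePreserving_neg volume).quasiMeasurePreserving), C, k, fun t => ?_⟩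
  rw [RCLike.norm_conj, ← abs_neg]
  exact hC (-t)

theorem PolyGrowth.linear_combination {f g : ℝ → ℂ} (hf : PolyGrowth f) (hg : PolyGrowth g)
    (a b : ℂ) : PolyGrowth fun t => a * f t + b * g t := by
  obtain ⟨hfm, C, k, hC⟩ := hf
  obtain ⟨hgm, D, l, hD⟩ := hg
  have hC0 : 0 ≤ C := by simpa using (norm_nonneg _).trans (hC 0)
  have hD0 : 0 ≤ D := by simpa using (norm_nonneg _).trans (hD 0)
  refine ⟨(hfm.const_mul a).add (hgm.const_mul b), ‖a‖ * C + ‖b‖ * D, k + l, fun t => ?_⟩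
  have h1 : (1 : ℝ) ≤ 1 + |t| := by linarith [abs_nonneg t]
  refine (norm_add_le _ _).trans ?_
  rw [norm_mul, norm_mul, add_mul, mul_assoc, mul_assoc]
  refine add_le_add (mul_le_mul_of_nonneg_left ((hC t).trans ?_) (norm_nonneg _))
    (mul_le_mul_of_nonneg_left ((hD t).trans ?_) (norm_nonneg _))
  · gcongr
    omega
  · gcongr
    omega

/-- The boundary value of a combination of `L` and of its conjugate. -/
theorem exists_boundaryValue {L : ℂ → ℂ} {G : ℝ → ℂ} (hG : IsCausalGrowth G) {w : ℝ}
    (hL : ∀ z : ℂ, 0 < z.im → L z = (z - w) ^ 2 * laplace G z) (a b : ℂ) :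
    ∃ A : 𝓢'(ℝ, ℂ), IsFourierOf (fun t => a * G t + b * (starRingEnd ℂ) (G (-t))) A ∧
      IsBoundaryValue (fun z => a * L z + b * (starRingEnd ℂ) (L z))
        (TemperedDistribution.smulLeftCLM ℂ (fun x : ℝ => ((x : ℂ) - w) ^ 2) A) := by
  have hp := hG.polyGrowth.linear_combination hG.polyGrowth_conj a b
  obtain ⟨A, hA, hA'⟩ := hp.exists_isFourierOf
  refine ⟨A, hA, fun φ => ?_⟩
  obtain ⟨h1, h2⟩ := boundaryValue_mulSubSq hG hL φ
  obtain ⟨h3, h4⟩ := boundaryValue_conj hG hL φ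
  have e : ∀ c x : ℝ, (a * L (x + c * I) + b * (starRingEnd ℂ) (L (x + c * I))) * φ x =
      a * (L (x + c * I) * φ x) + b * ((starRingEnd ℂ) (L (x + c * I)) * φ x) := fun c x => by ring
  simp_rw [e]
  refine ⟨fun c hc => ((h1 c hc).const_mul a).add ((h3 c hc).const_mul b), ?_⟩
  have h5 := (h2.const_mul a).add (h4.const_mul b)
  have h6 : TemperedDistribution.smulLeftCLM ℂ (fun x : ℝ => ((x : ℂ) - w) ^ 2) A φ =
      a * (∫ t : ℝ, G t * angularFourier (mulSubSq w φ) t) +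
        b * ∫ t : ℝ, (starRingEnd ℂ) (G (-t)) * angularFourier (mulSubSq w φ) t := by
    rw [TemperedDistribution.smulLeftCLM_apply_apply]
    refine (hA' (mulSubSq w φ)).trans ?_
    rw [← integral_const_mul, ← integral_const_mul, ← integral_add
      ((hG.polyGrowth.integrable_mul _).const_mul a)
      ((hG.polyGrowth_conj.integrable_mul _).const_mul b)]
    congr 1
    ext t
    ring
  rw [h6]
  refine h5.congr' ?_
  filter_upwards [self_mem_nhdsWithin] with c hc
  rw [integral_add ((h1 c hc).const_mul a) ((h3 c hc).const_mul b), integral_const_mul,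
    integral_const_mul]

theorem IsBoundaryValue.unique {u : ℂ → ℂ} {G H : 𝓢'(ℝ, ℂ)} (hG : IsBoundaryValue u G)
    (hH : IsBoundaryValue u H) : G = H := by
  ext φ
  exact tendsto_nhds_unique (hG φ).2 (hH φ).2

theorem IsFourierOf.neg {b : ℝ → ℂ} {G : 𝓢'(ℝ, ℂ)} (h : IsFourierOf b G) :
    IsFourierOf (fun t => -b t) (-G) := by
  obtain ⟨⟨hm, C, k, hC⟩, hG⟩ := h
  refine ⟨⟨hm.neg, C, k, fun t => by rw [norm_neg]; exact hC t⟩, fun φ => ?_⟩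
  have h1 : (-G) φ = -(G φ) := rfl
  rw [h1, hG, ← integral_neg]
  simp_rw [neg_mul]

/-- The distributional quotients of the real and imaginary parts of the boundary value are
Hilbert transforms of one another. -/
theorem exists_kkOnAxis {L : ℂ → ℂ} {G : ℝ → ℂ} (hG : IsCausalGrowth G) {w : ℝ}
    (hL : ∀ z : ℂ, 0 < z.im → L z = (z - w) ^ 2 * laplace G z) :
    ∃ R X : 𝓢'(ℝ, ℂ), IsBoundaryValue (fun z => ((L z).re : ℂ)) R ∧
      IsBoundaryValue (fun z => ((L z).im : ℂ)) X ∧ KKOnAxis R X w := by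
  -- These combinations of L and its conjugate are Re L and Im L. In the densities, G(t) lives on t
  -- > 0 and the conjugate of G(-t) on t < 0, so multiplication by -i sgn t takes the density of A
  -- to that of B, and that of B to minus that of A.
  obtain ⟨A, hA, hAb⟩ := exists_boundaryValue hG hL (1 / 2) (1 / 2)
  obtain ⟨B, hB, hBb⟩ := exists_boundaryValue hG hL (-I / 2) (I / 2)
  refine ⟨_, _, ?_, ?_, A, B, rfl, rfl, ⟨_, hB, ?_⟩, ⟨_, hA, ?_⟩⟩
  · convert hAb using 2 with z
    rw [re_eq_add_conj]; ring
  · convert hBb using 2 with z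
    rw [im_eq_sub_conj]
    field_simp
    linear_combination (L z - (starRingEnd ℂ) (L z)) * I_mul_I
  · convert hA.neg using 2 with t
    rcases lt_trichotomy t 0 with ht | ht | ht
    · rw [Real.sign_of_neg ht, hG.zero t ht.le]
      push_cast
      linear_combination (1 / 2) * (starRingEnd ℂ) (G (-t)) * I_mul_I
    · rw [ht, neg_zero, hG.zero 0 le_rfl]; simp
    · rw [Real.sign_of_pos ht, hG.zero (-t) (by linarith)]
      simp only [map_zero]
      push_cast
      linear_combination (1 / 2) * (G t) * I_mul_I
  · convert hB using 2 with t
    rcases lt_trichotomy t 0 with ht | ht | ht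
    · rw [Real.sign_of_neg ht, hG.zero t ht.le]
      push_cast
      ring
    · rw [ht, neg_zero, hG.zero 0 le_rfl]; simp
    · rw [Real.sign_of_pos ht, hG.zero (-t) (by linarith)]
      simp only [map_zero]
      push_cast
      ring

/-- R and X are constructed with w = 0. Any other w gives a pair through its own quotient
representation, and uniqueness of boundary values identifies the two pairs. -/
theorem exists_boundaryValue_forall_kkOnAxis {L : ℂ → ℂ} {g : ℝ → ℂ} (hg : IsCausalGrowth g)
    (hL : ∀ z : ℂ, 0 < z.im → L z = z ^ 2 * laplace g z) :
    ∃ R X : 𝓢'(ℝ, ℂ), IsBoundaryValue (fun z => ((L z).re : ℂ)) R ∧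
      IsBoundaryValue (fun z => ((L z).im : ℂ)) X ∧ ∀ w : ℝ, KKOnAxis R X w := by
  obtain ⟨R, X, hR, hX, -⟩ := exists_kkOnAxis (w := 0) hg (by simpa using hL)
  refine ⟨R, X, hR, hX, fun w => ?_⟩
  obtain ⟨G, hG, hGL⟩ := hg.exists_laplace_eq_div w
  obtain ⟨R', X', hR', hX', h⟩ := exists_kkOnAxis hG fun z hz => (hL z hz).trans (hGL z hz)
  rwa [hR.unique hR', hX.unique hX']

/-! ### The second derivative of a causal function -/

/-- Both derivatives move to the test function, which is e^{izt} on the support of f and so acquires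
the factor (iz)² = -z². -/
theorem fourierHat_secondDeriv {f : ℝ → ℂ} (hf0 : ∀ t ≤ 0, f t = 0) {U : 𝓢'(ℝ, ℂ)}
    (hU : IsFunction U f) {z : ℂ} (hz : 0 < z.im) :
    fourierHat (secondDeriv U) z = -(z ^ 2 * laplace f z) := by
  have h1 : fourierHat (secondDeriv U) z =
      U (SchwartzMap.derivCLM ℂ ℂ (SchwartzMap.derivCLM ℂ ℂ (expTest z))) := by
    rw [fourierHat, secondDeriv, TemperedDistribution.derivCLM_apply_apply,
      TemperedDistribution.derivCLM_apply_apply]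
    simp only [map_neg, neg_neg]
  have h2 : ∀ t : ℝ, 0 < t →
      SchwartzMap.derivCLM ℂ ℂ (SchwartzMap.derivCLM ℂ ℂ (expTest z)) t =
        -z ^ 2 * cexp (I * z * t) := by
    intro t ht
    have h3 := derivCLM_pow_apply 2 (expTest z) t
    have h4 : (expTest z : ℝ → ℂ) =ᶠ[𝓝 t] fun t => cexp (I * z * t) := by
      filter_upwards [Ioi_mem_nhds ht] with s hs
      exact expTest_apply hz (by linarith [mem_Ioi.1 hs])
    rw [h4.iteratedDeriv_eq 2, iteratedDeriv_cexp_line, pow_two, mul_apply_eq_comp] at h3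
    rw [h3]
    linear_combination z ^ 2 * cexp (I * z * t) * I_mul_I
  rw [h1, hU.2, laplace, ← integral_const_mul, ← integral_neg,
    ← integral_indicator measurableSet_Ioi]
  congr 1
  ext t
  by_cases ht : t ∈ Ioi (0 : ℝ)
  · rw [indicator_of_mem ht, h2 t ht]; ring
  · rw [indicator_of_notMem ht, hf0 t (not_lt.1 ht), zero_mul]

end MinPhase

end

/-! ### Assembly of the theorem. -/

theorem mainTheorem9 (T : 𝓢'(ℝ, ℂ)) (hT : MinPhase.IsMinimumPhase T) :
    (∃ L : ℂ → ℂ, MinPhase.IsLogHat T L) ∧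
    ∀ L : ℂ → ℂ, MinPhase.IsLogHat T L →
      MinPhase.SatisfiesKKTwoSubtractions L ∧
      ∃ (f : ℝ → ℂ) (U : 𝓢'(ℝ, ℂ)),
        Continuous f ∧ (∀ t < 0, f t = 0) ∧ MinPhase.IsFunction U f ∧
        ∀ z ∈ MinPhase.upperHalf,
          L z = I * (sInf (Distribution.dsupport T) : ℝ) * z +
            MinPhase.fourierHat (MinPhase.secondDeriv U) z := by
  refine ⟨MinPhase.exists_log hT.analytic hT.ne_zero, fun L hL => ?_⟩
  obtain ⟨A, N, M, hW⟩ := hL.isLogBounded hT.causal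
  obtain ⟨f, hf, hf0, ⟨C, hC⟩, hrep⟩ := hL.exists_rep hT.causal
  have hC0 : 0 ≤ C := by simpa using (norm_nonneg _).trans (hC 0)
  have hcausal : MinPhase.IsCausalGrowth f := ⟨hf0, hf.continuousOn, C, 4, hC0, hC⟩
  set a : ℝ := sInf (Distribution.dsupport T)
  refine ⟨⟨fun c hc => hW.kkOnLine (-I) (fun z => by ring) hc, ?_⟩, ?_⟩
  -- With a the onset time, L is z² times the transform of the single causal function a·1_{t>0} - f.
  · have hone := MinPhase.isCausalGrowth_indicator.const_mul a
    refine MinPhase.exists_boundaryValue_forall_kkOnAxis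
      (hone.add (hcausal.const_mul (-1))) fun z hz => ?_
    have hz0 : z ≠ 0 := fun h => by simp [h] at hz
    rw [hone.laplace_add (hcausal.const_mul (-1)) hz, MinPhase.laplace_const_mul,
      MinPhase.laplace_const_mul, MinPhase.laplace_indicator hz, hrep z hz]
    field_simp
    ring
  · obtain ⟨U, hU⟩ := hcausal.polyGrowth.exists_isFunction
    refine ⟨f, U, hf, fun t ht => hf0 t ht.le, hU, fun z hz => ?_⟩
    rw [MinPhase.fourierHat_secondDeriv hf0 hU hz, hrep z hz, sub_eq_add_neg]
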